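/- Let $\phi:[0,\infty)\to\mathbb{R}$ be such that $e^{2\phi}\in L^1((0,T))$ for every $T>0$, put $\tau(t)=\int_0^t e^{2\phi(s)}\,ds$, and let $h_{\mathrm{in}}\in L^1(\mathbb{R}^3)$ with $h_{\mathrm{in}}\ge 0$ a.e. For a measurable function $a\geq 0$ with $a\in L^1((0,T))$ for all $T>0$, a solution of the Cauchy problem $$\partial_t h=a(t)\,\partial_{p^i}\Big(\frac{p^ip^j}{|p|}\,\partial_{p^j}h\Big),\quad t>0,\ p\in\mathbb{R}^3,\qquad h(0,p)=h_{\mathrm{in}}(p)\qquad(\ast)$$ (sum over $i,j\in\{1,2,3\}$) means a function $h\in L^\infty((0,\infty);L^1(\mathbb{R}^3))$ such that $$\int_0^\infty\!\int_{\mathbb{R}^3}h\,\Big[\partial_t\psi+a(t)\,\partial_{p^i}\Big(\frac{p^ip^j}{|p|}\,\partial_{p^j}\psi\Big)\Big]dp\,dt+\int_{\mathbb{R}^3}h_{\mathrm{in}}(p)\,\psi(0,p)\,dp=0$$ for all test functions $\psi$ that are smooth and compactly supported in spherical coordinates, i.e. $\psi(t,p)=\Psi(t,|p|,p/|p|)$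 for $p\neq0$ with $\Psi\in C_c^\infty(\mathbb{R}\times\mathbb{R}\times\mathbb{R}^3)$ (all $\psi\in C^\infty_c(\mathbb{R}\times\mathbb{R}^3)$ are of this form). Then the problem $(\ast)$ with $a\equiv 1$ has a solution $g$, unique up to equality almost everywhere on $(0,\infty)\times\mathbb{R}^3$. Moreover, the problem $(\ast)$ with $a=e^{2\phi}$ and the same datum also has a unique solution $h$ (up to equality a.e.), and it is given by $$h(t,p)=g(\tau(t),p)\qquad\text{for almost every }(t,p)\in(0,\infty)\times\mathbb{R}^3.$$ -/

import Mathlib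

open MeasureTheory Set
open scoped ContDiff

/-- Momentum space `ℝ³` with the Euclidean norm. -/
abbrev Momentum : Type := EuclideanSpace ℝ (Fin 3)

/-- Lebesgue measure on `(0,∞) × ℝ³`. -/
noncomputable def timeMomentumMeasure : Measure (ℝ × Momentum) :=
  (volume.restrict (Ioi (0 : ℝ))).prod volume

/-- The partial derivative `∂u/∂pⁱ`. -/
noncomputable def partialDeriv (i : Fin 3) (u : Momentum → ℝ) (p : Momentum) : ℝ :=
  fderiv ℝ u p (EuclideanSpace.single i 1)

/-- The ultra-relativistic diffusion matrix `pⁱ pʲ / |p|`. -/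
noncomputable def ultraDiffusion (i j : Fin 3) (p : Momentum) : ℝ :=
  p i * p j / ‖p‖

/-- The operator `u ↦ ∂_{pⁱ} ((pⁱ pʲ / |p|) ∂_{pʲ} u)`, summed over `i` and `j`. -/
noncomputable def ultraOperator (u : Momentum → ℝ) (p : Momentum) : ℝ :=
  ∑ i, partialDeriv i (fun p' => ∑ j, ultraDiffusion i j p' * partialDeriv j u p') p

/-- Test functions: functions of `(t, p)` that are smooth and compactly supported in the spherical
coordinates `(t, q, ω) = (t, |p|, p/|p|)`, up to `t = 0` and up to `q = 0`. Every function in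
`C_c^∞(ℝ × ℝ³)` is of this kind; since the operator is purely radial and degenerates at the origin,
a test function may also have a limit at `p = 0` that depends on the direction `ω`. (The value at
the single point `p = 0` plays no role.) -/
def IsTestFunction (ψ : ℝ → Momentum → ℝ) : Prop :=
  ∃ Ψ : ℝ × ℝ × Momentum → ℝ, ContDiff ℝ ∞ Ψ ∧ HasCompactSupport Ψ ∧
    ∀ t p, p ≠ 0 → ψ t p = Ψ (t, ‖p‖, ‖p‖⁻¹ • p)

/-- `h` belongs to `L^∞((0,∞); L¹(ℝ³))`. -/
def MemLinftyL1 (h : ℝ → Momentum → ℝ) : Prop :=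
  AEStronglyMeasurable (fun z : ℝ × Momentum => h z.1 z.2) timeMomentumMeasure ∧
  ∃ C : ℝ, ∀ᵐ t ∂(volume.restrict (Ioi (0 : ℝ))),
    ∫⁻ p, ENNReal.ofReal |h t p| ≤ ENNReal.ofReal C

/-- `h ∈ L^∞((0,∞); L¹(ℝ³))` is a (weak) solution of the Cauchy problem
`∂_t h = a(t) ∂_{pⁱ} ((pⁱ pʲ / |p|) ∂_{pʲ} h)` for `t > 0`, `p ∈ ℝ³`, with `h(0, p) = h_in(p)`. -/
def IsSolution (a : ℝ → ℝ) (h_in : Momentum → ℝ) (h : ℝ → Momentum → ℝ) : Prop :=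
  MemLinftyL1 h ∧
  ∀ ψ : ℝ → Momentum → ℝ, IsTestFunction ψ →
    (∫ t in Ioi (0 : ℝ), ∫ p,
        h t p * (deriv (fun s => ψ s p) t + a t * ultraOperator (ψ t) p))
      + ∫ p, h_in p * ψ 0 p = 0

/-- The rescaled time `τ(t) = ∫₀ᵗ e^{2φ(s)} ds`. -/
noncomputable def rescaledTime (φ : ℝ → ℝ) (t : ℝ) : ℝ :=
  ∫ s in (0 : ℝ)..t, Real.exp (2 * φ s)

/-! The operator differentiates along rays only: in polar coordinates, `q` being the radius, it is
`L = q ∂_q² + 3 ∂_q`, with the direction as a parameter (`ultraOperator_spherical`). It is symmetric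
for the radial measure `q² dq`, because `q² L u = ∂_q (q³ ∂_q u)`. Everything rests on one explicit
family, the gamma profiles `V(β, q) = β⁻³ e^{-q/β}`, which satisfy `∂_β V = L V`. Write `τ(t) = ∫₀ᵗ
a`. Then `V(μ + τ(t), q)` solves the equation, `V(c - τ(t), q)` solves the adjoint one as long as
`τ(t) < c`, and both may be multiplied by any function of the direction.

Uniqueness is a duality argument. For a solution `h` with zero datum, testing with a time cutoff
times an angular factor times `V(c - τ(t), |p|)` shows that the pairing of `h(t)` with this profile
vanishes for almost every `t`. As `τ` is only absolutely continuous, the test functions use smooth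
scales, and the limit is taken afterwards (`integral_moving_gammaProfile_eq_zero`). Taking `c = τ(t)
+ 1/λ` turns the profile at time `t` into a multiple of `e^{-λ|p|}`, so every moment of `h(t)`
against an angular monomial times `e^{-λ|p|}`, `λ = 1, 2, …`, is zero. By Stone–Weierstrass in the
variables `(e^{-|p|}, p/|p|)`, `h(t) = 0` (`ae_eq_zero_of_forall_expMonomial`).

Existence starts from data that are finite sums of such exponentials, where the solution is an
explicit sum of gamma profiles (`isSolution_expFlow`). The evolution on each ray is a mixture of
gamma densities with Poisson weights, a positive kernel that preserves `q² dq`; hence it contracts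
`L¹` (`lintegral_evolvedExp_le`). An arbitrary integrable datum is an absolutely convergent `L¹`
series of exponential sums, and the corresponding solutions can be summed (`isSolution_tsum`).

This construction depends on `a` only through `τ`: a single flow `G`, chosen before `a`, gives the
solution `G(τ(t), p)` for every admissible `a ≥ 0` (`exists_flow`). By uniqueness `g = G` almost
everywhere when `a = 1`. Since `e^{2φ} > 0`, the time change pulls null sets back to null sets
(`quasiMeasurePreserving_primitive`), so `g(τ(t), p)` agrees with the solution `G(τ(t), p)`, and
uniqueness for `a = e^{2φ}` finishes the proof. -/

open Filter
open scoped Topology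

/-! ### Spherical coordinates and the radial form of the operator -/

/-- The direction `p / |p|` of a momentum (with the value `0` at the origin). -/
noncomputable def direction (p : Momentum) : Momentum := ‖p‖⁻¹ • p

/-- The time derivative of a function of `(t, q, ω)`. -/
noncomputable def timeDeriv (Ψ : ℝ × ℝ × Momentum → ℝ) (z : ℝ × ℝ × Momentum) : ℝ :=
  fderiv ℝ Ψ z (1, 0, 0)

/-- The radial derivative of a function of `(t, q, ω)`. -/
noncomputable def radDeriv (Ψ : ℝ × ℝ × Momentum → ℝ) (z : ℝ × ℝ × Momentum) : ℝ :=
  fderiv ℝ Ψ z (0, 1, 0)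

/-- The ultra-relativistic operator in the coordinates `(t, q, ω)`. -/
noncomputable def radialOperator (Ψ : ℝ × ℝ × Momentum → ℝ) (z : ℝ × ℝ × Momentum) : ℝ :=
  z.2.1 * radDeriv (radDeriv Ψ) z + 3 * radDeriv Ψ z

theorem measurable_direction : Measurable direction := by
  unfold direction; fun_prop

theorem norm_direction {p : Momentum} (hp : p ≠ 0) : ‖direction p‖ = 1 := by
  simp [direction, norm_smul, hp]

theorem norm_direction_le (p : Momentum) : ‖direction p‖ ≤ 1 := by
  by_cases hp : p = 0
  · simp [direction, hp]
  · exact (norm_direction hp).le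

theorem direction_smul {s : ℝ} (hs : 0 < s) (p : Momentum) : direction (s • p) = direction p := by
  simp only [direction, norm_smul, Real.norm_eq_abs, abs_of_pos hs, smul_smul]
  congr 1
  field_simp

theorem contDiff_timeDeriv {Ψ : ℝ × ℝ × Momentum → ℝ} (h : ContDiff ℝ ∞ Ψ) :
    ContDiff ℝ ∞ (timeDeriv Ψ) :=
  (h.fderiv_right (m := ∞) (by simp)).clm_apply contDiff_const

theorem contDiff_radDeriv {Ψ : ℝ × ℝ × Momentum → ℝ} (h : ContDiff ℝ ∞ Ψ) :
    ContDiff ℝ ∞ (radDeriv Ψ) :=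
  (h.fderiv_right (m := ∞) (by simp)).clm_apply contDiff_const

theorem hasCompactSupport_timeDeriv {Ψ : ℝ × ℝ × Momentum → ℝ} (h : HasCompactSupport Ψ) :
    HasCompactSupport (timeDeriv Ψ) := h.fderiv_apply ℝ _

theorem hasCompactSupport_radDeriv {Ψ : ℝ × ℝ × Momentum → ℝ} (h : HasCompactSupport Ψ) :
    HasCompactSupport (radDeriv Ψ) := h.fderiv_apply ℝ _

theorem contDiff_radialOperator {Ψ : ℝ × ℝ × Momentum → ℝ} (h : ContDiff ℝ ∞ Ψ) :
    ContDiff ℝ ∞ (radialOperator Ψ) := by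
  have h1 := contDiff_radDeriv h
  have h2 := contDiff_radDeriv h1
  unfold radialOperator
  fun_prop

theorem hasCompactSupport_radialOperator {Ψ : ℝ × ℝ × Momentum → ℝ} (h : HasCompactSupport Ψ) :
    HasCompactSupport (radialOperator Ψ) :=
  (hasCompactSupport_radDeriv (hasCompactSupport_radDeriv h)).mul_left.add
    (hasCompactSupport_radDeriv h).mul_left

theorem hasDerivAt_radDeriv {Ψ : ℝ × ℝ × Momentum → ℝ} (h : ContDiff ℝ ∞ Ψ) (t q : ℝ)
    (w : Momentum) : HasDerivAt (fun r => Ψ (t, r, w)) (radDeriv Ψ (t, q, w)) q := by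
  have h1 : HasDerivAt (fun r : ℝ => ((t, r, w) : ℝ × ℝ × Momentum)) (0, 1, 0) q :=
    (hasDerivAt_const q t).prodMk ((hasDerivAt_id q).prodMk (hasDerivAt_const q w))
  exact ((h.differentiable (by simp)) (t, q, w)).hasFDerivAt.comp_hasDerivAt q h1

theorem hasDerivAt_timeDeriv {Ψ : ℝ × ℝ × Momentum → ℝ} (h : ContDiff ℝ ∞ Ψ) (t q : ℝ)
    (w : Momentum) : HasDerivAt (fun s => Ψ (s, q, w)) (timeDeriv Ψ (t, q, w)) t := by
  have h1 : HasDerivAt (fun r : ℝ => ((r, q, w) : ℝ × ℝ × Momentum)) (1, 0, 0) t :=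
    (hasDerivAt_id t).prodMk ((hasDerivAt_const t q).prodMk (hasDerivAt_const t w))
  exact ((h.differentiable (by simp)) (t, q, w)).hasFDerivAt.comp_hasDerivAt t h1

theorem differentiableAt_spherical {Ψ : ℝ × ℝ × Momentum → ℝ} (h : ContDiff ℝ ∞ Ψ) (t : ℝ)
    {p : Momentum} (hp : p ≠ 0) :
    DifferentiableAt ℝ (fun p' => Ψ (t, ‖p'‖, direction p')) p := by
  have hn : DifferentiableAt ℝ (fun p' : Momentum => ‖p'‖) p :=
    (contDiffAt_norm ℝ (n := 1) hp).differentiableAt (by simp)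
  have hd : DifferentiableAt ℝ direction p := by
    unfold direction
    exact (hn.inv (by simpa using hp)).smul differentiableAt_id
  exact ((h.differentiable (by simp)) _).comp p
    ((differentiableAt_const t).prodMk (hn.prodMk hd))

/-- Euler's formula: the derivative along the ray. -/
theorem fderiv_spherical_self {Ψ : ℝ × ℝ × Momentum → ℝ} (h : ContDiff ℝ ∞ Ψ) (t : ℝ)
    {p : Momentum} (hp : p ≠ 0) :
    fderiv ℝ (fun p' => Ψ (t, ‖p'‖, direction p')) p p
      = ‖p‖ * radDeriv Ψ (t, ‖p‖, direction p) := by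
  have h1 : HasDerivAt (fun s : ℝ => s • p) p 1 := by
    simpa using (hasDerivAt_id (1 : ℝ)).smul_const p
  have h2 : HasDerivAt (fun s : ℝ => Ψ (t, ‖s • p‖, direction (s • p)))
      (fderiv ℝ (fun p' => Ψ (t, ‖p'‖, direction p')) p p) 1 := by
    have := (differentiableAt_spherical h t hp).hasFDerivAt
    exact HasFDerivAt.comp_hasDerivAt_of_eq (1 : ℝ) this h1 (by simp)
  have h3 : HasDerivAt (fun s : ℝ => Ψ (t, s * ‖p‖, direction p))
      (radDeriv Ψ (t, ‖p‖, direction p) * ‖p‖) 1 := by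
    have h4 : HasDerivAt (fun s : ℝ => s * ‖p‖) ‖p‖ 1 := by
      simpa using (hasDerivAt_id (1 : ℝ)).mul_const ‖p‖
    exact HasDerivAt.comp_of_eq (1 : ℝ) (hasDerivAt_radDeriv h t ‖p‖ (direction p)) h4 (by simp)
  have h5 : (fun s : ℝ => Ψ (t, ‖s • p‖, direction (s • p))) =ᶠ[nhds 1]
      fun s : ℝ => Ψ (t, s * ‖p‖, direction p) := by
    filter_upwards [lt_mem_nhds (zero_lt_one' ℝ)] with s hs
    rw [direction_smul hs, norm_smul, Real.norm_eq_abs, abs_of_pos hs]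
  rw [mul_comm]
  exact h2.unique (h3.congr_of_eventuallyEq h5)

theorem sum_smul_single (p : Momentum) :
    ∑ i, p i • (EuclideanSpace.single i (1 : ℝ) : Momentum) = p := by
  ext j
  simp [Finset.sum_apply, Pi.single_apply]

/-- The matrix has rank one, so the flux is `p` times the radial derivative; its divergence is `3
∂_q + q ∂_q²` by Euler's formula, the 3 being the dimension. -/
theorem ultraOperator_spherical {Ψ : ℝ × ℝ × Momentum → ℝ} (h : ContDiff ℝ ∞ Ψ) (t : ℝ)
    {u : Momentum → ℝ} (hu : ∀ p, p ≠ 0 → u p = Ψ (t, ‖p‖, direction p))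
    {p : Momentum} (hp : p ≠ 0) :
    ultraOperator u p = radialOperator Ψ (t, ‖p‖, direction p) := by
  have hev : ∀ {p' : Momentum}, p' ≠ 0 → u =ᶠ[nhds p'] fun p' => Ψ (t, ‖p'‖, direction p') := by
    intro p' hp'
    filter_upwards [isOpen_ne.mem_nhds hp'] with x hx using hu x hx
  -- Contracting with `p'ʲ` gives `|p'|` times the radial derivative, which cancels the singular
  -- factor `1/|p'|`.
  have hflux : ∀ i, (fun p' : Momentum => ∑ j, ultraDiffusion i j p' * partialDeriv j u p')
      =ᶠ[nhds p] fun p' => p' i * radDeriv Ψ (t, ‖p'‖, direction p') := by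
    intro i
    filter_upwards [isOpen_ne.mem_nhds hp] with p' hp'
    have hn : ‖p'‖ ≠ 0 := by simpa using hp'
    have h1 : ∑ j, p' j * partialDeriv j u p' = ‖p'‖ * radDeriv Ψ (t, ‖p'‖, direction p') := by
      rw [← fderiv_spherical_self h t hp', ← (hev hp').fderiv_eq]
      conv_rhs => arg 2; rw [← sum_smul_single p']
      simp only [partialDeriv, map_sum, map_smul, smul_eq_mul]
    calc ∑ j, ultraDiffusion i j p' * partialDeriv j u p'
        = p' i / ‖p'‖ * ∑ j, p' j * partialDeriv j u p' := by
          rw [Finset.mul_sum]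
          refine Finset.sum_congr rfl fun j _ => ?_
          simp only [ultraDiffusion]; ring
      _ = _ := by rw [h1]; field_simp
  have hr := contDiff_radDeriv h
  have hd := differentiableAt_spherical hr t hp
  have hpart : ∀ i, partialDeriv i
      (fun p' : Momentum => ∑ j, ultraDiffusion i j p' * partialDeriv j u p') p
      = radDeriv Ψ (t, ‖p‖, direction p) + p i *
        fderiv ℝ (fun p' => radDeriv Ψ (t, ‖p'‖, direction p')) p (EuclideanSpace.single i 1) := by
    intro i
    have hpi : HasFDerivAt (fun p' : Momentum => p' i)
        (EuclideanSpace.proj i : Momentum →L[ℝ] ℝ) p :=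
      (EuclideanSpace.proj i : Momentum →L[ℝ] ℝ).hasFDerivAt
    rw [partialDeriv, (hflux i).fderiv_eq, (hpi.fun_mul hd.hasFDerivAt).fderiv]
    simp
    ring
  rw [ultraOperator, Finset.sum_congr rfl fun i _ => hpart i, Finset.sum_add_distrib]
  have h2 : ∑ i, p i *
      fderiv ℝ (fun p' => radDeriv Ψ (t, ‖p'‖, direction p')) p (EuclideanSpace.single i 1)
      = ‖p‖ * radDeriv (radDeriv Ψ) (t, ‖p‖, direction p) := by
    rw [← fderiv_spherical_self hr t hp]
    conv_rhs => arg 2; rw [← sum_smul_single p]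
    simp only [map_sum, map_smul, smul_eq_mul]
  rw [h2]
  simp [radialOperator]
  ring

/-! ### Integration in polar coordinates -/

theorem lintegral_volumeIoiPow_two (f : ℝ → ENNReal) (hf : Measurable f) :
    ∫⁻ r : Ioi (0 : ℝ), f r ∂Measure.volumeIoiPow 2
      = ∫⁻ q in Ioi (0 : ℝ), ENNReal.ofReal (q ^ 2) * f q := by
  rw [Measure.volumeIoiPow, lintegral_withDensity_eq_lintegral_mul _ (by fun_prop) (by fun_prop)]
  exact lintegral_subtype_comap measurableSet_Ioi fun q => ENNReal.ofReal (q ^ 2) * f q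

theorem integral_volumeIoiPow_two (f : ℝ → ℝ) :
    ∫ r : Ioi (0 : ℝ), f r ∂Measure.volumeIoiPow 2 = ∫ q in Ioi (0 : ℝ), q ^ 2 * f q := by
  simp only [Measure.volumeIoiPow, ENNReal.ofReal]
  rw [integral_withDensity_eq_integral_smul,
    integral_subtype_comap measurableSet_Ioi fun a ↦ Real.toNNReal (a ^ 2) • f a,
    setIntegral_congr_fun measurableSet_Ioi fun x hx ↦ ?_]
  · rw [NNReal.smul_def, Real.coe_toNNReal _ (pow_nonneg hx.out.le _), smul_eq_mul]
  · exact (measurable_subtype_coe.pow_const _).real_toNNReal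

/-- The surface measure of the unit sphere of momentum space. -/
noncomputable abbrev sphereMeasure : Measure (Metric.sphere (0 : Momentum) 1) :=
  (volume : Measure Momentum).toSphere

theorem measurePreserving_polar :
    MeasurePreserving (homeomorphUnitSphereProd Momentum) (volume.comap Subtype.val)
      (sphereMeasure.prod (Measure.volumeIoiPow 2)) := by
  have h := (volume : Measure Momentum).measurePreserving_homeomorphUnitSphereProd
  rwa [finrank_euclideanSpace_fin] at h

theorem polar_apply (x : ({0}ᶜ : Set Momentum)) :
    (((homeomorphUnitSphereProd Momentum x).2 : ℝ) •
      ((homeomorphUnitSphereProd Momentum x).1 : Momentum)) = x := by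
  have h := (homeomorphUnitSphereProd Momentum).symm_apply_apply x
  rw [← homeomorphUnitSphereProd_symm_apply_coe, h]

theorem lintegral_polar {F : Momentum → ENNReal} (hF : Measurable F) :
    ∫⁻ p, F p = ∫⁻ w : Metric.sphere (0 : Momentum) 1,
      (∫⁻ q in Ioi (0 : ℝ), ENNReal.ofReal (q ^ 2) * F (q • (w : Momentum))) ∂sphereMeasure := by
  calc ∫⁻ p, F p = ∫⁻ x : ({0}ᶜ : Set Momentum), F x ∂(volume.comap Subtype.val) := by
        rw [lintegral_subtype_comap (measurableSet_singleton _).compl F, restrict_compl_singleton]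
    _ = ∫⁻ x, F ((x.2 : ℝ) • (x.1 : Momentum)) ∂(sphereMeasure.prod (Measure.volumeIoiPow 2)) := by
        rw [← measurePreserving_polar.lintegral_comp_emb (Homeomorph.measurableEmbedding _)]
        simp only [polar_apply]
    _ = _ := by
        rw [lintegral_prod _ (by fun_prop)]
        refine lintegral_congr fun w => ?_
        exact lintegral_volumeIoiPow_two (fun q => F (q • (w : Momentum))) (by fun_prop)

theorem integral_polar {F : Momentum → ℝ} (hF : Integrable F) :
    ∫ p, F p = ∫ w : Metric.sphere (0 : Momentum) 1,
      (∫ q in Ioi (0 : ℝ), q ^ 2 * F (q • (w : Momentum))) ∂sphereMeasure := by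
  have hemb := (homeomorphUnitSphereProd Momentum).measurableEmbedding
  have hF' : Integrable (fun x : ({0}ᶜ : Set Momentum) => F x) (volume.comap Subtype.val) := by
    have := (integrableOn_iff_comap_subtypeVal (measurableSet_singleton (0 : Momentum)).compl).1
      (hF.integrableOn (s := {0}ᶜ))
    exact this
  have hint : Integrable (fun x : Metric.sphere (0 : Momentum) 1 × Ioi (0 : ℝ) =>
      F ((x.2 : ℝ) • (x.1 : Momentum))) (sphereMeasure.prod (Measure.volumeIoiPow 2)) := by
    rw [← measurePreserving_polar.integrable_comp_emb hemb]
    simpa only [Function.comp_def, polar_apply] using hF'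
  calc ∫ p, F p = ∫ x : ({0}ᶜ : Set Momentum), F x ∂(volume.comap Subtype.val) := by
        rw [integral_subtype_comap (measurableSet_singleton _).compl F, restrict_compl_singleton]
    _ = ∫ x, F ((x.2 : ℝ) • (x.1 : Momentum)) ∂(sphereMeasure.prod (Measure.volumeIoiPow 2)) := by
        rw [← measurePreserving_polar.integral_comp hemb]
        simp only [polar_apply]
    _ = _ := by
        rw [integral_prod _ hint]
        refine integral_congr_ae (Filter.Eventually.of_forall fun w => ?_)
        exact integral_volumeIoiPow_two (fun q => F (q • (w : Momentum)))

/-- No integrability is needed: the integral of a non-integrable function is zero by convention. -/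
theorem integral_eq_zero_of_rays {F : Momentum → ℝ}
    (h : ∀ w : Momentum, ‖w‖ = 1 → ∫ q in Ioi (0 : ℝ), q ^ 2 * F (q • w) = 0) :
    ∫ p, F p = 0 := by
  by_cases hF : Integrable F
  · rw [integral_polar hF]
    simp [fun w : Metric.sphere (0 : Momentum) 1 => h w (by simp)]
  · exact integral_undef hF

theorem lintegral_mono_of_rays {F G : Momentum → ENNReal} (hF : Measurable F) (hG : Measurable G)
    (h : ∀ w : Momentum, ‖w‖ = 1 →
      ∫⁻ q in Ioi (0 : ℝ), ENNReal.ofReal (q ^ 2) * F (q • w)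
        ≤ ∫⁻ q in Ioi (0 : ℝ), ENNReal.ofReal (q ^ 2) * G (q • w)) :
    ∫⁻ p, F p ≤ ∫⁻ p, G p := by
  rw [lintegral_polar hF, lintegral_polar hG]
  exact lintegral_mono fun w => h w (by simp)

theorem direction_smul_of_norm_eq_one {q : ℝ} (hq : 0 < q) {w : Momentum} (hw : ‖w‖ = 1) :
    direction (q • w) = w := by
  rw [direction_smul hq, direction, hw, inv_one, one_smul]

theorem norm_smul_of_norm_eq_one {q : ℝ} (hq : 0 < q) {w : Momentum} (hw : ‖w‖ = 1) :
    ‖q • w‖ = q := by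
  rw [norm_smul, hw, mul_one, Real.norm_eq_abs, abs_of_pos hq]

/-! ### Gamma profiles -/

/-- The self-similar solution `β⁻³ exp (-q / β)` of `∂_β V = q ∂_q² V + 3 ∂_q V`. -/
noncomputable def gammaProfile (β q : ℝ) : ℝ := (β ^ 3)⁻¹ * Real.exp (-(q / β))

/-- The image of `gammaProfile` under the radial operator. -/
noncomputable def gammaProfileOp (β q : ℝ) : ℝ := (q / β ^ 2 - 3 / β) * gammaProfile β q

theorem hasDerivAt_gammaProfile_left {β : ℝ} (hβ : 0 < β) (q : ℝ) :
    HasDerivAt (fun b => gammaProfile b q) (gammaProfileOp β q) β := by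
  have h0 : β ≠ 0 := hβ.ne'
  have h1 := ((hasDerivAt_pow 3 β).fun_inv (pow_ne_zero 3 h0)).fun_mul
    ((((hasDerivAt_const β q).fun_div (hasDerivAt_id β) h0).fun_neg).exp)
  refine h1.congr_deriv ?_
  simp only [gammaProfileOp, gammaProfile, id]
  field_simp
  ring

theorem hasDerivAt_gammaProfile_right (β q : ℝ) :
    HasDerivAt (fun r => gammaProfile β r) (-β⁻¹ * gammaProfile β q) q := by
  have h1 := ((((hasDerivAt_id q).div_const β).fun_neg).exp).const_mul ((β ^ 3)⁻¹)
  refine h1.congr_deriv ?_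
  simp only [gammaProfile, id]
  ring

theorem gammaProfile_nonneg {β : ℝ} (hβ : 0 < β) (q : ℝ) : 0 ≤ gammaProfile β q := by
  unfold gammaProfile; positivity

theorem gammaProfile_le {β q : ℝ} (hβ : 0 < β) (hq : 0 ≤ q) : gammaProfile β q ≤ (β ^ 3)⁻¹ := by
  unfold gammaProfile
  have : Real.exp (-(q / β)) ≤ 1 := Real.exp_le_one_iff.2 (by have := div_nonneg hq hβ.le; linarith)
  exact mul_le_of_le_one_right (by positivity) this

theorem mul_gammaProfile_le {β q : ℝ} (hβ : 0 < β) :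
    q / β * gammaProfile β q ≤ (β ^ 3)⁻¹ := by
  have h1 : q / β * Real.exp (-(q / β)) ≤ 1 := by
    have := Real.add_one_le_exp (q / β)
    rw [Real.exp_neg, ← div_eq_mul_inv, div_le_one (Real.exp_pos _)]
    linarith
  calc q / β * gammaProfile β q = (β ^ 3)⁻¹ * (q / β * Real.exp (-(q / β))) := by
        unfold gammaProfile; ring
    _ ≤ _ := mul_le_of_le_one_right (by positivity) h1

theorem abs_gammaProfileOp_le {β q : ℝ} (hβ : 0 < β) (hq : 0 ≤ q) :
    |gammaProfileOp β q| ≤ 4 * (β ^ 4)⁻¹ := by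
  have h1 := mul_gammaProfile_le (q := q) hβ
  have h2 := gammaProfile_le hβ hq
  have h3 := gammaProfile_nonneg hβ q
  have h4 : 0 ≤ q / β := by positivity
  have e : gammaProfileOp β q = β⁻¹ * (q / β * gammaProfile β q - 3 * gammaProfile β q) := by
    unfold gammaProfileOp; field_simp
  have e2 : 4 * (β ^ 4)⁻¹ = β⁻¹ * (4 * (β ^ 3)⁻¹) := by field_simp
  rw [e, e2, abs_mul, abs_of_pos (inv_pos.2 hβ)]
  refine mul_le_mul_of_nonneg_left ?_ (inv_pos.2 hβ).le
  rw [abs_le]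
  have h5 := mul_nonneg h4 h3
  have h6 : 0 ≤ (β ^ 3)⁻¹ := by positivity
  constructor <;> linarith

theorem contDiffAt_gammaProfile {β : ℝ} (hβ : 0 < β) (q : ℝ) :
    ContDiffAt ℝ ∞ (fun z : ℝ × ℝ => gammaProfile z.1 z.2) (β, q) := by
  unfold gammaProfile
  have : ContDiffAt ℝ ∞ (fun z : ℝ × ℝ => z.1) (β, q) := contDiffAt_fst
  have h2 : ContDiffAt ℝ ∞ (fun z : ℝ × ℝ => z.2) (β, q) := contDiffAt_snd
  exact ((this.pow 3).inv (pow_ne_zero 3 hβ.ne')).mul ((h2.div this hβ.ne').neg.exp)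

theorem measurable_gammaProfile : Measurable fun z : ℝ × ℝ => gammaProfile z.1 z.2 := by
  unfold gammaProfile; fun_prop

theorem measurable_gammaProfileOp : Measurable fun z : ℝ × ℝ => gammaProfileOp z.1 z.2 := by
  unfold gammaProfileOp gammaProfile; fun_prop

/-! ### The weak formulation in spherical coordinates -/

/-- The point of `(0,∞) × ℝ³` in the coordinates `(t, q, ω)`. -/
noncomputable def spherical (z : ℝ × Momentum) : ℝ × ℝ × Momentum := (z.1, ‖z.2‖, direction z.2)

theorem measurable_spherical : Measurable spherical :=
  measurable_fst.prodMk (measurable_snd.norm.prodMk (measurable_direction.comp measurable_snd))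

/-- The origin is a null set, and away from it both derivatives of the test function are those of
its spherical representative. From here on the Cartesian operator is not needed. -/
theorem isSolution_iff {a : ℝ → ℝ} {h_in : Momentum → ℝ} {h : ℝ → Momentum → ℝ} :
    IsSolution a h_in h ↔ MemLinftyL1 h ∧
      ∀ Ψ : ℝ × ℝ × Momentum → ℝ, ContDiff ℝ ∞ Ψ → HasCompactSupport Ψ →
        (∫ t in Ioi (0 : ℝ), ∫ p, h t p * (timeDeriv Ψ (spherical (t, p))
          + a t * radialOperator Ψ (spherical (t, p))))
        + ∫ p, h_in p * Ψ (spherical (0, p)) = 0 := by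
  have key : ∀ (ψ : ℝ → Momentum → ℝ) (Ψ : ℝ × ℝ × Momentum → ℝ), ContDiff ℝ ∞ Ψ →
      (∀ t p, p ≠ 0 → ψ t p = Ψ (t, ‖p‖, direction p)) →
      (∫ t in Ioi (0 : ℝ), ∫ p,
        h t p * (deriv (fun s => ψ s p) t + a t * ultraOperator (ψ t) p))
        + ∫ p, h_in p * ψ 0 p = (∫ t in Ioi (0 : ℝ), ∫ p, h t p * (timeDeriv Ψ (spherical (t, p))
          + a t * radialOperator Ψ (spherical (t, p))))
        + ∫ p, h_in p * Ψ (spherical (0, p)) := by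
    intro ψ Ψ hΨ hψ
    have hne : ∀ᵐ p : Momentum, p ≠ 0 := by simp [ae_iff]
    congr 1
    · congr 1
      ext t
      refine integral_congr_ae ?_
      filter_upwards [hne] with p hp
      rw [ultraOperator_spherical hΨ t (hψ t) hp]
      simp only [hψ _ p hp]
      rw [(hasDerivAt_timeDeriv hΨ t ‖p‖ (direction p)).deriv]
      rfl
    · refine integral_congr_ae ?_
      filter_upwards [hne] with p hp
      rw [hψ 0 p hp]
      rfl
  constructor
  · rintro ⟨h1, h2⟩
    refine ⟨h1, fun Ψ hΨ hc => ?_⟩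
    rw [← key (fun t p => Ψ (t, ‖p‖, direction p)) Ψ hΨ (fun _ _ _ => rfl)]
    exact h2 _ ⟨Ψ, hΨ, hc, fun _ _ _ => rfl⟩
  · rintro ⟨h1, h2⟩
    refine ⟨h1, ?_⟩
    rintro ψ ⟨Ψ, hΨ, hc, hψ⟩
    rw [key ψ Ψ hΨ hψ]
    exact h2 Ψ hΨ hc

/-- The duality between `L^∞_t L¹_p` and `L¹_t L^∞_p`, the source of every integrability claim
below: `a` is only locally integrable in time, while test functions are bounded in `p`. -/
theorem lintegral_pairing_le {h : ℝ → Momentum → ℝ} {C : ℝ}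
    (hm : AEStronglyMeasurable (fun z : ℝ × Momentum => h z.1 z.2) timeMomentumMeasure)
    (hC : ∀ᵐ t ∂(volume.restrict (Ioi (0 : ℝ))),
      ∫⁻ p, ENNReal.ofReal |h t p| ≤ ENNReal.ofReal C)
    {Θ : ℝ × Momentum → ℝ} (hΘ : AEStronglyMeasurable Θ timeMomentumMeasure)
    {b : ℝ → ℝ} (hb : ∀ᵐ t ∂(volume.restrict (Ioi (0 : ℝ))), ∀ p, |Θ (t, p)| ≤ b t) :
    ∫⁻ z, ‖h z.1 z.2 * Θ z‖ₑ ∂timeMomentumMeasure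
      ≤ ENNReal.ofReal C * ∫⁻ t in Ioi (0 : ℝ), ENNReal.ofReal (b t) := by
  have hmm := (hm.mul hΘ).enorm
  rw [timeMomentumMeasure] at hmm ⊢
  change AEMeasurable (fun z : ℝ × Momentum => ‖h z.1 z.2 * Θ z‖ₑ) _ at hmm
  rw [lintegral_prod _ hmm, ← lintegral_const_mul' _ _ ENNReal.ofReal_ne_top]
  refine lintegral_mono_ae ?_
  filter_upwards [hC, hb] with t ht hbt
  calc ∫⁻ p, ‖h t p * Θ (t, p)‖ₑ
      ≤ ∫⁻ p, ENNReal.ofReal |h t p| * ENNReal.ofReal (b t) := by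
        refine lintegral_mono fun p => ?_
        rw [enorm_mul, Real.enorm_eq_ofReal_abs, Real.enorm_eq_ofReal_abs]
        gcongr
        exact hbt p
    _ = (∫⁻ p, ENNReal.ofReal |h t p|) * ENNReal.ofReal (b t) :=
        lintegral_mul_const' _ _ ENNReal.ofReal_ne_top
    _ ≤ _ := by gcongr

theorem integrable_pairing {h : ℝ → Momentum → ℝ} (hh : MemLinftyL1 h)
    {Θ : ℝ × Momentum → ℝ} (hΘ : AEStronglyMeasurable Θ timeMomentumMeasure)
    {b : ℝ → ℝ} (hbi : IntegrableOn b (Ioi 0))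
    (hb : ∀ᵐ t ∂(volume.restrict (Ioi (0 : ℝ))), ∀ p, |Θ (t, p)| ≤ b t) :
    Integrable (fun z : ℝ × Momentum => h z.1 z.2 * Θ z) timeMomentumMeasure := by
  obtain ⟨hm, C, hC⟩ := hh
  refine ⟨hm.mul hΘ, ?_⟩
  refine (lintegral_pairing_le hm hC hΘ hb).trans_lt ?_
  refine ENNReal.mul_lt_top ENNReal.ofReal_lt_top ?_
  exact hbi.lintegral_lt_top

theorem abs_integral_pairing_le {h : ℝ → Momentum → ℝ} {C : ℝ} (hC0 : 0 ≤ C)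
    (hm : AEStronglyMeasurable (fun z : ℝ × Momentum => h z.1 z.2) timeMomentumMeasure)
    (hC : ∀ᵐ t ∂(volume.restrict (Ioi (0 : ℝ))),
      ∫⁻ p, ENNReal.ofReal |h t p| ≤ ENNReal.ofReal C)
    {Θ : ℝ × Momentum → ℝ} (hΘ : AEStronglyMeasurable Θ timeMomentumMeasure)
    {b : ℝ → ℝ} (hbi : IntegrableOn b (Ioi 0))
    (hb : ∀ᵐ t ∂(volume.restrict (Ioi (0 : ℝ))), ∀ p, |Θ (t, p)| ≤ b t) :
    ∫ z : ℝ × Momentum, |h z.1 z.2 * Θ z| ∂timeMomentumMeasure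
      ≤ C * ∫ t in Ioi (0 : ℝ), b t := by
  have hb0 : ∀ᵐ t ∂(volume.restrict (Ioi (0 : ℝ))), 0 ≤ b t := by
    filter_upwards [hb] with t ht using (abs_nonneg _).trans (ht 0)
  have h1 := lintegral_pairing_le hm hC hΘ hb
  rw [← ofReal_integral_eq_lintegral_ofReal hbi hb0, ← ENNReal.ofReal_mul hC0] at h1
  have h2 : ∫ z : ℝ × Momentum, |h z.1 z.2 * Θ z| ∂timeMomentumMeasure
      = (∫⁻ z, ‖h z.1 z.2 * Θ z‖ₑ ∂timeMomentumMeasure).toReal :=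
    integral_norm_eq_lintegral_enorm (hm.mul hΘ)
  rw [h2]
  refine ENNReal.toReal_le_of_le_ofReal (mul_nonneg hC0 (integral_nonneg_of_ae hb0)) h1

theorem iterated_eq_integral {F : ℝ × Momentum → ℝ} (hF : Integrable F timeMomentumMeasure) :
    ∫ t in Ioi (0 : ℝ), ∫ p, F (t, p) = ∫ z, F z ∂timeMomentumMeasure := by
  rw [timeMomentumMeasure] at hF ⊢
  rw [integral_prod _ hF]

theorem ae_timeMomentumMeasure_of_forall_ae {P : ℝ × Momentum → Prop} {Q : ℝ → Prop}
    (hQ : ∀ᵐ t ∂(volume.restrict (Ioi (0 : ℝ))), Q t) (hP : ∀ t p, Q t → P (t, p)) :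
    ∀ᵐ z ∂timeMomentumMeasure, P z := by
  have : ∀ᵐ z ∂timeMomentumMeasure, Q z.1 := by
    unfold timeMomentumMeasure
    exact Measure.quasiMeasurePreserving_fst.ae hQ
  filter_upwards [this] with z hz using hP z.1 z.2 hz

theorem exists_indicator_bound {F : ℝ × ℝ × Momentum → ℝ} (hF : Continuous F)
    (hc : HasCompactSupport F) :
    ∃ M T : ℝ, 0 ≤ M ∧ 0 < T ∧
      ∀ z, |F z| ≤ (Icc (-T) T).indicator (fun _ => M) z.1 := by
  obtain ⟨M, hM⟩ := hF.bounded_above_of_compact_support hc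
  obtain ⟨T, hT⟩ := hc.isCompact.isBounded.exists_norm_le
  refine ⟨max M 0, max T 1, le_max_right _ _, by positivity, fun z => ?_⟩
  by_cases hz : F z = 0
  · rw [hz, abs_zero]
    exact indicator_nonneg (fun _ _ => le_max_right _ _) _
  · have h1 := hT z (subset_tsupport _ hz)
    have h2 : ‖z.1‖ ≤ max T 1 := ((norm_fst_le z).trans h1).trans (le_max_left _ _)
    rw [Real.norm_eq_abs, abs_le] at h2
    rw [indicator_of_mem (by exact h2)]
    exact (hM z).trans (le_max_left _ _)

theorem aestronglyMeasurable_Ioi_of_integrableOn {a : ℝ → ℝ}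
    (ha : ∀ T : ℝ, 0 < T → IntegrableOn a (Ioc 0 T)) :
    AEStronglyMeasurable a (volume.restrict (Ioi 0)) := by
  have : Ioi (0 : ℝ) = ⋃ n : ℕ, Ioc (0 : ℝ) (n + 1) := by
    ext x
    simp only [mem_Ioi, mem_iUnion, mem_Ioc, exists_and_left]
    refine ⟨fun h => ⟨h, ?_⟩, fun h => h.1⟩
    obtain ⟨n, hn⟩ := exists_nat_ge x
    exact ⟨n, by linarith⟩
  rw [this, aestronglyMeasurable_iUnion_iff]
  exact fun n => (ha (n + 1) (by positivity)).aestronglyMeasurable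

theorem aestronglyMeasurable_comp_fst {a : ℝ → ℝ}
    (ha : AEStronglyMeasurable a (volume.restrict (Ioi 0))) :
    AEStronglyMeasurable (fun z : ℝ × Momentum => a z.1) timeMomentumMeasure := by
  unfold timeMomentumMeasure
  exact ha.comp_fst

theorem integrableOn_weight {a : ℝ → ℝ} (ha : ∀ T : ℝ, 0 < T → IntegrableOn a (Ioc 0 T))
    (M T : ℝ) (hT : 0 < T) :
    IntegrableOn ((Icc (-T) T).indicator fun t => M * (1 + |a t|)) (Ioi 0) := by
  rw [IntegrableOn, integrable_indicator_iff measurableSet_Icc, IntegrableOn,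
    Measure.restrict_restrict measurableSet_Icc]
  have : Icc (-T) T ∩ Ioi 0 = Ioc 0 T := by
    ext x; simp only [mem_inter_iff, mem_Icc, mem_Ioi, mem_Ioc]
    constructor
    · rintro ⟨h1, h2⟩; exact ⟨h2, h1.2⟩
    · rintro ⟨h1, h2⟩; exact ⟨⟨by linarith, h2⟩, h1⟩
  rw [this]
  exact ((integrable_const 1).add (ha T hT).abs).const_mul M

/-- The weight that a solution is paired with in the weak formulation is integrable in time,
uniformly in the momentum. -/
theorem exists_weight {a : ℝ → ℝ} (ha : ∀ T : ℝ, 0 < T → IntegrableOn a (Ioc 0 T))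
    {F G : ℝ × ℝ × Momentum → ℝ} (hF : Continuous F) (hFc : HasCompactSupport F)
    (hG : Continuous G) (hGc : HasCompactSupport G) :
    AEStronglyMeasurable (fun z => F (spherical z) + a z.1 * G (spherical z))
      timeMomentumMeasure ∧
    ∃ b : ℝ → ℝ, IntegrableOn b (Ioi 0) ∧
      ∀ t p, |F (spherical (t, p)) + a t * G (spherical (t, p))| ≤ b t := by
  refine ⟨?_, ?_⟩
  · have h1 : Measurable fun z => F (spherical z) := hF.measurable.comp measurable_spherical
    have h2 : Measurable fun z => G (spherical z) := hG.measurable.comp measurable_spherical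
    exact h1.aestronglyMeasurable.add
      ((aestronglyMeasurable_comp_fst (aestronglyMeasurable_Ioi_of_integrableOn ha)).mul
        h2.aestronglyMeasurable)
  · obtain ⟨M, T, hM, hT, hb⟩ := exists_indicator_bound hF hFc
    obtain ⟨M', T', hM', hT', hb'⟩ := exists_indicator_bound hG hGc
    refine ⟨_, (integrableOn_weight ha M T hT).add (integrableOn_weight ha M' T' hT'), ?_⟩
    intro t p
    refine (abs_add_le _ _).trans (add_le_add ?_ ?_)
    · refine (hb _).trans ?_
      refine indicator_le_indicator ?_
      change M ≤ M * (1 + |a t|)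
      nlinarith [mul_nonneg hM (abs_nonneg (a t))]
    · rw [abs_mul]
      have h1 := hb' (spherical (t, p))
      change _ ≤ (Icc (-T') T').indicator (fun _ => M') t at h1
      by_cases ht : t ∈ Icc (-T') T'
      · rw [indicator_of_mem ht] at h1 ⊢
        have := mul_le_mul_of_nonneg_left h1 (abs_nonneg (a t))
        nlinarith
      · rw [indicator_of_notMem ht] at h1 ⊢
        have := mul_le_mul_of_nonneg_left h1 (abs_nonneg (a t))
        linarith

/-- The function that a solution is paired with in the weak formulation. -/
noncomputable def weakIntegrand (a : ℝ → ℝ) (Ψ : ℝ × ℝ × Momentum → ℝ) (z : ℝ × Momentum) : ℝ :=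
  timeDeriv Ψ (spherical z) + a z.1 * radialOperator Ψ (spherical z)

theorem exists_weight_weakIntegrand {a : ℝ → ℝ} (ha : ∀ T : ℝ, 0 < T → IntegrableOn a (Ioc 0 T))
    {Ψ : ℝ × ℝ × Momentum → ℝ} (hΨ : ContDiff ℝ ∞ Ψ) (hc : HasCompactSupport Ψ) :
    AEStronglyMeasurable (weakIntegrand a Ψ) timeMomentumMeasure ∧
    ∃ b : ℝ → ℝ, IntegrableOn b (Ioi 0) ∧ ∀ t p, |weakIntegrand a Ψ (t, p)| ≤ b t :=
  exists_weight ha (contDiff_timeDeriv hΨ).continuous (hasCompactSupport_timeDeriv hc)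
    (contDiff_radialOperator hΨ).continuous (hasCompactSupport_radialOperator hc)

theorem integrable_weakIntegrand {a : ℝ → ℝ} (ha : ∀ T : ℝ, 0 < T → IntegrableOn a (Ioc 0 T))
    {h : ℝ → Momentum → ℝ} (hh : MemLinftyL1 h)
    {Ψ : ℝ × ℝ × Momentum → ℝ} (hΨ : ContDiff ℝ ∞ Ψ) (hc : HasCompactSupport Ψ) :
    Integrable (fun z : ℝ × Momentum => h z.1 z.2 * weakIntegrand a Ψ z) timeMomentumMeasure := by
  obtain ⟨hm, b, hbi, hb⟩ := exists_weight_weakIntegrand ha hΨ hc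
  exact integrable_pairing hh hm hbi (Filter.Eventually.of_forall hb)

theorem integrable_datum {h_in : Momentum → ℝ} (h_int : Integrable h_in)
    {Ψ : ℝ × ℝ × Momentum → ℝ} (hΨ : ContDiff ℝ ∞ Ψ) (hc : HasCompactSupport Ψ) (t : ℝ) :
    Integrable fun p => h_in p * Ψ (spherical (t, p)) := by
  obtain ⟨M, hM⟩ := hΨ.continuous.bounded_above_of_compact_support hc
  have hmeas : Measurable fun p : Momentum => Ψ (spherical (t, p)) :=
    hΨ.continuous.measurable.comp (measurable_spherical.comp (measurable_const.prodMk measurable_id))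
  exact h_int.mul_bdd hmeas.aestronglyMeasurable (Filter.Eventually.of_forall fun p => hM _)

/-- The pairing is jointly integrable, so the iterated integral is a single one on the product
space, linear in `h` and open to limit theorems. -/
theorem isSolution_iff_integral {a : ℝ → ℝ} (ha : ∀ T : ℝ, 0 < T → IntegrableOn a (Ioc 0 T))
    {h_in : Momentum → ℝ} {h : ℝ → Momentum → ℝ} :
    IsSolution a h_in h ↔ MemLinftyL1 h ∧
      ∀ Ψ : ℝ × ℝ × Momentum → ℝ, ContDiff ℝ ∞ Ψ → HasCompactSupport Ψ →
        (∫ z : ℝ × Momentum, h z.1 z.2 * weakIntegrand a Ψ z ∂timeMomentumMeasure)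
        + ∫ p, h_in p * Ψ (spherical (0, p)) = 0 := by
  rw [isSolution_iff]
  refine and_congr_right fun hh => forall_congr' fun Ψ => forall_congr' fun hΨ =>
    forall_congr' fun hc => ?_
  rw [← iterated_eq_integral (integrable_weakIntegrand ha hh hΨ hc)]
  rfl

theorem MemLinftyL1.sub {h₁ h₂ : ℝ → Momentum → ℝ} (hh₁ : MemLinftyL1 h₁)
    (hh₂ : MemLinftyL1 h₂) : MemLinftyL1 fun t p => h₁ t p - h₂ t p := by
  obtain ⟨hm₁, C₁, hC₁⟩ := hh₁
  obtain ⟨hm₂, C₂, hC₂⟩ := hh₂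
  -- The bounds `C₁` and `C₂` may be negative, whereas `ENNReal.ofReal` is additive only on
  -- nonnegative reals.
  refine ⟨hm₁.sub hm₂, max C₁ 0 + max C₂ 0, ?_⟩
  have hs : ∀ᵐ t ∂(volume.restrict (Ioi (0 : ℝ))), AEStronglyMeasurable (h₁ t) volume := by
    rw [timeMomentumMeasure] at hm₁
    exact hm₁.prodMk_left
  filter_upwards [hC₁, hC₂, hs] with t h1 h2 h3
  calc ∫⁻ p, ENNReal.ofReal |h₁ t p - h₂ t p|
      ≤ ∫⁻ p, (ENNReal.ofReal |h₁ t p| + ENNReal.ofReal |h₂ t p|) := by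
        refine lintegral_mono fun p => ?_
        rw [← ENNReal.ofReal_add (abs_nonneg _) (abs_nonneg _)]
        exact ENNReal.ofReal_le_ofReal (abs_sub _ _)
    _ = (∫⁻ p, ENNReal.ofReal |h₁ t p|) + ∫⁻ p, ENNReal.ofReal |h₂ t p| :=
        lintegral_add_left' (by simpa [← Real.enorm_eq_ofReal_abs] using h3.enorm) _
    _ ≤ _ := by
        rw [ENNReal.ofReal_add (le_max_right _ _) (le_max_right _ _)]
        exact add_le_add (h1.trans (ENNReal.ofReal_le_ofReal (le_max_left _ _)))
          (h2.trans (ENNReal.ofReal_le_ofReal (le_max_left _ _)))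

theorem IsSolution.sub {a : ℝ → ℝ} (ha : ∀ T : ℝ, 0 < T → IntegrableOn a (Ioc 0 T))
    {h_in : Momentum → ℝ} {h₁ h₂ : ℝ → Momentum → ℝ} (hh₁ : IsSolution a h_in h₁)
    (hh₂ : IsSolution a h_in h₂) :
    IsSolution a (fun _ => 0) fun t p => h₁ t p - h₂ t p := by
  rw [isSolution_iff_integral ha] at hh₁ hh₂ ⊢
  refine ⟨hh₁.1.sub hh₂.1, fun Ψ hΨ hc => ?_⟩
  simp only [sub_mul, zero_mul, integral_zero, add_zero]
  rw [integral_sub (integrable_weakIntegrand ha hh₁.1 hΨ hc)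
    (integrable_weakIntegrand ha hh₂.1 hΨ hc)]
  linarith [hh₁.2 Ψ hΨ hc, hh₂.2 Ψ hΨ hc]

theorem IsSolution.congr {a : ℝ → ℝ} (ha : ∀ T : ℝ, 0 < T → IntegrableOn a (Ioc 0 T))
    {h_in : Momentum → ℝ} {h₁ h₂ : ℝ → Momentum → ℝ} (hh : IsSolution a h_in h₁)
    (he : ∀ᵐ z ∂timeMomentumMeasure, h₁ z.1 z.2 = h₂ z.1 z.2) : IsSolution a h_in h₂ := by
  rw [isSolution_iff_integral ha] at hh ⊢
  obtain ⟨⟨hm, C, hC⟩, hw⟩ := hh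
  refine ⟨⟨hm.congr he, C, ?_⟩, fun Ψ hΨ hc => ?_⟩
  · have he' := he
    rw [timeMomentumMeasure] at he'
    filter_upwards [hC, Measure.ae_ae_of_ae_prod he'] with t h1 h2
    refine le_of_eq_of_le (lintegral_congr_ae ?_) h1
    filter_upwards [h2] with p hp
    rw [← hp]
  · refine (congrArg (· + ∫ p, h_in p * Ψ (spherical (0, p))) (integral_congr_ae ?_)).trans
      (hw Ψ hΨ hc)
    filter_upwards [he] with z hz
    rw [hz]

/-! ### Density of exponential polynomials -/

/-- The four coordinates `(s, ω₁, ω₂, ω₃)`. -/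
def radialAngularCoords (s : ℝ) (w : Momentum) : Option (Fin 3) → ℝ
  | none => s
  | some i => w i

/-- The function `e^{-|p|} P(e^{-|p|}, p / |p|)`. -/
noncomputable def expPoly (P : MvPolynomial (Option (Fin 3)) ℝ) (p : Momentum) : ℝ :=
  Real.exp (-‖p‖) *
    MvPolynomial.eval (radialAngularCoords (Real.exp (-‖p‖)) (direction p)) P

/-- The angular part of a monomial. -/
noncomputable def angularMonomial (m : Option (Fin 3) →₀ ℕ) (w : Momentum) : ℝ :=
  ∏ i : Fin 3, w i ^ m (some i)

/-- The decay rate of the radial part of a monomial. -/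
noncomputable def decayRate (m : Option (Fin 3) →₀ ℕ) : ℝ := m none + 1

theorem decayRate_pos (m : Option (Fin 3) →₀ ℕ) : 0 < decayRate m := by
  unfold decayRate; positivity

theorem expPoly_eq_sum (P : MvPolynomial (Option (Fin 3)) ℝ) (p : Momentum) :
    expPoly P p = ∑ m ∈ P.support, P.coeff m *
      (angularMonomial m (direction p) * Real.exp (-(decayRate m * ‖p‖))) := by
  rw [expPoly, MvPolynomial.eval_eq', Finset.mul_sum]
  refine Finset.sum_congr rfl fun m _ => ?_
  rw [Fintype.prod_option]
  -- The prefactor `e^{-|p|}` is what makes every decay rate at least 1, hence positive.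
  have h1 : Real.exp (-(decayRate m * ‖p‖)) = Real.exp (-‖p‖) * Real.exp (-‖p‖) ^ m none := by
    rw [← Real.exp_nat_mul, ← Real.exp_add]
    unfold decayRate
    congr 1; ring
  rw [h1, angularMonomial]
  simp only [radialAngularCoords]
  ring

/-- Stone–Weierstrass for `f / e^{-|p|}` as a function of `(s, ω) = (e^{-|p|}, p/|p|)`. A uniform
error there becomes an error weighted by `e^{-|p|}`, which is integrable. -/
theorem exists_expPoly_near {f : Momentum → ℝ} (hf : Continuous f) (hc : HasCompactSupport f)
    {ε : ℝ} (hε : 0 < ε) :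
    ∃ P : MvPolynomial (Option (Fin 3)) ℝ, ∀ p, |f p - expPoly P p| ≤ ε * Real.exp (-‖p‖) := by
  -- The full ball replaces the sphere because `direction 0 = 0` must also lie in the domain.
  set K : Set (ℝ × Momentum) := Icc 0 1 ×ˢ Metric.closedBall 0 1 with hK
  have hKc : IsCompact K := isCompact_Icc.prod (isCompact_closedBall 0 1)
  have : CompactSpace K := isCompact_iff_compactSpace.1 hKc
  let X : Option (Fin 3) → C(K, ℝ) := fun o =>
    ⟨fun x => radialAngularCoords x.1.1 x.1.2 o, by
      cases o <;> simp only [radialAngularCoords] <;> fun_prop⟩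
  let A : Subalgebra ℝ C(K, ℝ) := (MvPolynomial.aeval X).range
  have hsep : A.SeparatesPoints := by
    intro x y hxy
    by_contra hcon
    push Not at hcon
    have hX : ∀ o, X o x = X o y := fun o =>
      hcon _ ⟨X o, ⟨MvPolynomial.X o, by simp⟩, rfl⟩
    refine hxy (Subtype.ext (Prod.ext (hX none) ?_))
    ext i
    exact hX (some i)
  obtain ⟨R, hR⟩ := hc.isCompact.isBounded.exists_norm_le
  -- `s < δ` means `|p| > max R 0 + 1`, beyond the support of `f`. Truncating `s` at `δ` avoids the
  -- singularity of `log s` and `1/s` at infinite momentum without changing the function at the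
  -- points that occur.
  set δ : ℝ := Real.exp (-(max R 0 + 1)) with hδ
  have hδ0 : 0 < δ := Real.exp_pos _
  let F : C(K, ℝ) := ⟨fun x => (max x.1.1 δ)⁻¹ * f ((-Real.log (max x.1.1 δ)) • x.1.2), by
    have h1 : Continuous fun x : K => max x.1.1 δ := by fun_prop
    have h2 : ∀ x : K, max x.1.1 δ ≠ 0 := fun x => (lt_max_of_lt_right hδ0).ne'
    exact (h1.inv₀ h2).mul (hf.comp ((h1.log h2).neg.smul (by fun_prop)))⟩
  obtain ⟨⟨g, P, hP⟩, hg⟩ :=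
    ContinuousMap.exists_mem_subalgebra_near_continuousMap_of_separatesPoints A hsep F ε hε
  refine ⟨P, fun p => ?_⟩
  have hmem : (Real.exp (-‖p‖), direction p) ∈ K := by
    refine ⟨⟨(Real.exp_pos _).le, Real.exp_le_one_iff.2 (by simp)⟩, ?_⟩
    simpa using norm_direction_le p
  have h1 : F ⟨_, hmem⟩ * Real.exp (-‖p‖) = f p := by
    change (max (Real.exp (-‖p‖)) δ)⁻¹ * f ((-Real.log (max (Real.exp (-‖p‖)) δ)) • direction p)
      * Real.exp (-‖p‖) = f p
    by_cases hp : ‖p‖ ≤ max R 0 + 1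
    · rw [max_eq_left (Real.exp_le_exp.2 (by linarith)), Real.log_exp, neg_neg]
      have : ‖p‖ • direction p = p := by
        by_cases h0 : p = 0
        · simp [h0]
        · rw [direction, smul_smul, mul_inv_cancel₀ (by simpa using h0), one_smul]
      rw [this, mul_comm, ← mul_assoc, mul_inv_cancel₀ (Real.exp_pos _).ne', one_mul]
    · push Not at hp
      have hfar : ∀ x : Momentum, max R 0 + 1 ≤ ‖x‖ → f x = 0 := by
        intro x hx
        by_contra hne
        have := hR x (subset_tsupport _ hne)
        linarith [le_max_left R 0]
      rw [max_eq_right (Real.exp_le_exp.2 (by linarith)), Real.log_exp, neg_neg, hfar p hp.le,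
        hfar _ _, mul_zero, zero_mul]
      have h0 : p ≠ 0 := by
        rintro rfl
        have := le_max_right R 0
        simp at hp
        linarith
      rw [norm_smul, norm_direction h0, mul_one]
      exact le_abs_self _
  have h2 : g ⟨_, hmem⟩ * Real.exp (-‖p‖) = expPoly P p := by
    rw [expPoly, mul_comm]
    congr 1
    have := congrArg (ContinuousMap.evalAlgHom ℝ ℝ (⟨_, hmem⟩ : K)) hP
    change _ = g _ at this
    rw [← this]
    change (ContinuousMap.evalAlgHom ℝ ℝ (⟨_, hmem⟩ : K)) (MvPolynomial.aeval X P) = _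
    rw [MvPolynomial.comp_aeval_apply, MvPolynomial.aeval_eq_eval]
    rfl
  have h3 : |g ⟨_, hmem⟩ - F ⟨_, hmem⟩| ≤ ε :=
    ((ContinuousMap.norm_coe_le_norm (g - F) ⟨_, hmem⟩)).trans hg.le
  rw [← h1, ← h2, ← sub_mul, abs_mul, abs_sub_comm, abs_of_pos (Real.exp_pos _)]
  exact mul_le_mul_of_nonneg_right h3 (Real.exp_pos _).le

theorem abs_angularMonomial_le (m : Option (Fin 3) →₀ ℕ) (p : Momentum) :
    |angularMonomial m (direction p)| ≤ 1 := by
  rw [angularMonomial, Finset.abs_prod]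
  refine Finset.prod_le_one (fun _ _ => abs_nonneg _) fun i _ => ?_
  rw [abs_pow]
  refine pow_le_one₀ (abs_nonneg _) ?_
  exact (PiLp.norm_apply_le (direction p) i).trans (norm_direction_le p)

theorem contDiff_angularMonomial (m : Option (Fin 3) →₀ ℕ) :
    ContDiff ℝ ∞ (angularMonomial m) := by
  unfold angularMonomial
  fun_prop

theorem measurable_angularMonomial_direction (m : Option (Fin 3) →₀ ℕ) :
    Measurable fun p => angularMonomial m (direction p) :=
  (contDiff_angularMonomial m).continuous.measurable.comp measurable_direction

/-- An integrable function whose exponential moments all vanish is zero. -/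
theorem ae_eq_zero_of_forall_expMonomial {f : Momentum → ℝ} (hf : Integrable f)
    (h : ∀ m, ∫ p, f p * (angularMonomial m (direction p) * Real.exp (-(decayRate m * ‖p‖))) = 0) :
    ∀ᵐ p, f p = 0 := by
  have hmono : ∀ m, Integrable fun p =>
      f p * (angularMonomial m (direction p) * Real.exp (-(decayRate m * ‖p‖))) := by
    intro m
    refine hf.mul_bdd (c := 1) ?_ (Filter.Eventually.of_forall fun p => ?_)
    · exact ((measurable_angularMonomial_direction m).mul (by fun_prop)).aestronglyMeasurable
    · rw [Real.norm_eq_abs, abs_mul, abs_of_pos (Real.exp_pos _)]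
      refine mul_le_one₀ (abs_angularMonomial_le m p) (Real.exp_pos _).le ?_
      rw [Real.exp_le_one_iff]
      have := mul_nonneg (decayRate_pos m).le (norm_nonneg p)
      linarith
  have heq : ∀ (P : MvPolynomial (Option (Fin 3)) ℝ) (p : Momentum), f p * expPoly P p =
      ∑ m ∈ P.support, P.coeff m *
        (f p * (angularMonomial m (direction p) * Real.exp (-(decayRate m * ‖p‖)))) := by
    intro P p
    rw [expPoly_eq_sum, Finset.mul_sum]
    exact Finset.sum_congr rfl fun m _ => by ring
  have hint : ∀ P, Integrable fun p => f p * expPoly P p := by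
    intro P
    simp only [heq]
    exact integrable_finsetSum _ fun m _ => (hmono m).const_mul _
  have hzero : ∀ P, ∫ p, f p * expPoly P p = 0 := by
    intro P
    simp only [heq]
    rw [integral_finsetSum _ fun m _ => (hmono m).const_mul _]
    exact Finset.sum_eq_zero fun m _ => by rw [integral_const_mul, h, mul_zero]
  refine ae_eq_zero_of_integral_contDiff_smul_eq_zero hf.locallyIntegrable fun g hg hgc => ?_
  obtain ⟨M, hM⟩ := hg.continuous.bounded_above_of_compact_support hgc
  have hgi : Integrable fun p => f p * g p :=
    hf.mul_bdd hg.continuous.aestronglyMeasurable (Filter.Eventually.of_forall hM)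
  have hle : ∀ ε > 0, |∫ p, g p • f p| ≤ ε * (∫ p, |f p|) := by
    intro ε hε
    obtain ⟨P, hP⟩ := exists_expPoly_near hg.continuous hgc hε
    calc |∫ p, g p • f p| = |∫ p, (f p * g p - f p * expPoly P p)| := by
          rw [integral_sub hgi (hint P), hzero, sub_zero]
          simp only [smul_eq_mul, mul_comm]
      _ ≤ ∫ p, |f p * g p - f p * expPoly P p| := abs_integral_le_integral_abs
      _ ≤ ∫ p, ε * |f p| := by
          refine integral_mono (hgi.sub (hint P)).abs (hf.abs.const_mul ε) fun p => ?_
          change |f p * g p - f p * expPoly P p| ≤ ε * |f p|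
          rw [← mul_sub, abs_mul, mul_comm]
          refine mul_le_mul_of_nonneg_right ((hP p).trans ?_) (abs_nonneg _)
          exact mul_le_of_le_one_right hε.le (Real.exp_le_one_iff.2 (by simp))
      _ = _ := integral_const_mul _ _
  have hnn : 0 ≤ ∫ p, |f p| := integral_nonneg fun p => abs_nonneg _
  by_contra hne
  have hpos : 0 < |∫ p, g p • f p| := abs_pos.2 hne
  -- With this `ε` the bound makes the integral smaller than itself unless it vanishes; the `+ 1`
  -- covers `‖f‖₁ = 0`.
  have := hle (|∫ p, g p • f p| / (2 * ((∫ p, |f p|) + 1))) (by positivity)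
  rw [div_mul_eq_mul_div, le_div_iff₀ (by positivity)] at this
  nlinarith

/-! ### Uniqueness -/

/-- A smooth cutoff on the line, equal to one near the origin. -/
theorem exists_radial_cutoff : ∃ ζ : ℝ → ℝ, ∃ M : ℝ, ContDiff ℝ ∞ ζ ∧ ζ 0 = 1 ∧
    (∀ x, 2 ≤ |x| → ζ x = 0) ∧ 0 ≤ M ∧ (∀ x, |ζ x| ≤ M) ∧ (∀ x, |deriv ζ x| ≤ M) ∧
    ∀ x, |x * deriv (deriv ζ) x| ≤ M := by
  let ζ : ContDiffBump (0 : ℝ) := ⟨1, 2, one_pos, one_lt_two⟩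
  have hs : ContDiff ℝ ∞ (ζ : ℝ → ℝ) := ζ.contDiff
  have hc : HasCompactSupport (ζ : ℝ → ℝ) := ζ.hasCompactSupport
  have hs1 : ContDiff ℝ ∞ (deriv (ζ : ℝ → ℝ)) := (contDiff_infty_iff_deriv.1 hs).2
  have hs2 : ContDiff ℝ ∞ (deriv (deriv (ζ : ℝ → ℝ))) := (contDiff_infty_iff_deriv.1 hs1).2
  obtain ⟨M₀, h0⟩ := hs.continuous.bounded_above_of_compact_support hc
  obtain ⟨M₁, h1⟩ := hs1.continuous.bounded_above_of_compact_support hc.deriv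
  have hc2 : HasCompactSupport fun x => x * deriv (deriv (ζ : ℝ → ℝ)) x := hc.deriv.deriv.mul_left
  obtain ⟨M₂, h2⟩ := (continuous_id.mul hs2.continuous).bounded_above_of_compact_support hc2
  refine ⟨ζ, max M₀ (max M₁ M₂), hs, ζ.one_of_mem_closedBall (by simp [ζ]), fun x hx => ?_,
    (norm_nonneg _).trans ((h0 0).trans (le_max_left _ _)), fun x => (h0 x).trans (le_max_left _ _),
    fun x => (h1 x).trans ((le_max_left _ _).trans (le_max_right _ _)),
    fun x => (h2 x).trans ((le_max_right _ _).trans (le_max_right _ _))⟩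
  exact ζ.zero_of_le_dist (by simpa [ζ] using hx)

/-! ### Gamma profiles cut off to test functions -/

section TestFunction

variable {χ β ζ : ℝ → ℝ} {η : Momentum → ℝ} {ε : ℝ}

/-- A gamma profile with time-dependent scale, cut off in time, radius and direction. -/
noncomputable def profileTest (χ β ζ : ℝ → ℝ) (η : Momentum → ℝ) (ε : ℝ)
    (z : ℝ × ℝ × Momentum) : ℝ :=
  χ z.1 * gammaProfile (β z.1) z.2.1 * ζ (ε * z.2.1) * η z.2.2

theorem contDiff_profileTest (hχ : ContDiff ℝ ∞ χ) (hβ : ContDiff ℝ ∞ β) (hβ0 : ∀ t, 0 < β t)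
    (hζ : ContDiff ℝ ∞ ζ) (hη : ContDiff ℝ ∞ η) :
    ContDiff ℝ ∞ (profileTest χ β ζ η ε) := by
  have h1 : ContDiff ℝ ∞ fun z : ℝ × ℝ × Momentum => gammaProfile (β z.1) z.2.1 := by
    rw [contDiff_iff_contDiffAt]
    intro z
    have h2 : ContDiff ℝ ∞ fun z : ℝ × ℝ × Momentum => (β z.1, z.2.1) := by fun_prop
    exact (contDiffAt_gammaProfile (hβ0 z.1) z.2.1).comp z h2.contDiffAt
  unfold profileTest
  fun_prop

theorem hasCompactSupport_profileTest (hχ : HasCompactSupport χ) (hζ : ∀ x, 2 ≤ |x| → ζ x = 0)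
    (hη : HasCompactSupport η) (hε : 0 < ε) : HasCompactSupport (profileTest χ β ζ η ε) := by
  refine HasCompactSupport.intro
    (hχ.isCompact.prod ((isCompact_closedBall (0 : ℝ) (2 / ε)).prod hη.isCompact)) ?_
  rintro ⟨t, q, w⟩ hz
  simp only [mem_prod, not_and_or] at hz
  simp only [profileTest]
  rcases hz with h | h | h
  · rw [image_eq_zero_of_notMem_tsupport h]; ring
  · rw [hζ (ε * q)]
    · ring
    · rw [mem_closedBall_zero_iff, Real.norm_eq_abs, not_le, div_lt_iff₀ hε] at h
      rw [abs_mul, abs_of_pos hε]; linarith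
  · rw [image_eq_zero_of_notMem_tsupport h]; ring

/-- The weak integrand of `profileTest`, written out. -/
noncomputable def profileIntegrand (a χ β ζ : ℝ → ℝ) (η : Momentum → ℝ) (ε : ℝ)
    (z : ℝ × Momentum) : ℝ :=
  η (direction z.2) *
    (ζ (ε * ‖z.2‖) * (deriv χ z.1 * gammaProfile (β z.1) ‖z.2‖
        + χ z.1 * (a z.1 + deriv β z.1) * gammaProfileOp (β z.1) ‖z.2‖)
      + a z.1 * χ z.1 * (ε * (deriv ζ (ε * ‖z.2‖) * (3 * gammaProfile (β z.1) ‖z.2‖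
            - 2 * (‖z.2‖ / β z.1 * gammaProfile (β z.1) ‖z.2‖))
          + (ε * ‖z.2‖ * deriv (deriv ζ) (ε * ‖z.2‖)) * gammaProfile (β z.1) ‖z.2‖)))

/-- Since `∂_β V = L V`, the scale contributes `(a + β') L V`, which would cancel for `β' = -a`. The
terms in which the radial cutoff is differentiated all carry a factor `ε`. -/
theorem weakIntegrand_profileTest (a : ℝ → ℝ) (hχ : ContDiff ℝ ∞ χ) (hβ : ContDiff ℝ ∞ β)
    (hβ0 : ∀ t, 0 < β t) (hζ : ContDiff ℝ ∞ ζ) (hη : ContDiff ℝ ∞ η) (z : ℝ × Momentum) :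
    weakIntegrand a (profileTest χ β ζ η ε) z = profileIntegrand a χ β ζ η ε z := by
  obtain ⟨t, p⟩ := z
  have hs := contDiff_profileTest (ε := ε) hχ hβ hβ0 hζ hη
  have hs1 := contDiff_radDeriv hs
  have hζ1 : ContDiff ℝ ∞ (deriv ζ) := (contDiff_infty_iff_deriv.1 hζ).2
  have dζ : ∀ q, HasDerivAt (fun r => ζ (ε * r)) (ε * deriv ζ (ε * q)) q := by
    intro q
    have h1 : HasDerivAt (fun r : ℝ => ε * r) ε q := by
      simpa using (hasDerivAt_id q).const_mul ε
    have := ((hζ.differentiable (by simp)) (ε * q)).hasDerivAt.comp q h1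
    rwa [mul_comm] at this
  have dζ1 : ∀ q, HasDerivAt (fun r => deriv ζ (ε * r)) (ε * deriv (deriv ζ) (ε * q)) q := by
    intro q
    have h1 : HasDerivAt (fun r : ℝ => ε * r) ε q := by
      simpa using (hasDerivAt_id q).const_mul ε
    have := ((hζ1.differentiable (by simp)) (ε * q)).hasDerivAt.comp q h1
    rwa [mul_comm] at this
  have hrad : ∀ q w, radDeriv (profileTest χ β ζ η ε) (t, q, w)
      = χ t * gammaProfile (β t) q * (ε * deriv ζ (ε * q) - (β t)⁻¹ * ζ (ε * q)) * η w := by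
    intro q w
    have h1 := ((((hasDerivAt_gammaProfile_right (β t) q).const_mul (χ t)).fun_mul
      (dζ q)).mul_const (η w))
    rw [(hasDerivAt_radDeriv hs t q w).unique h1]
    ring
  have hrad2 : ∀ q w, radDeriv (radDeriv (profileTest χ β ζ η ε)) (t, q, w)
      = χ t * gammaProfile (β t) q * (ε ^ 2 * deriv (deriv ζ) (ε * q)
        - 2 * (β t)⁻¹ * (ε * deriv ζ (ε * q)) + (β t)⁻¹ ^ 2 * ζ (ε * q)) * η w := by
    intro q w
    have h1 := (((hasDerivAt_gammaProfile_right (β t) q).const_mul (χ t)).fun_mul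
      (((dζ1 q).const_mul ε).fun_sub ((dζ q).const_mul (β t)⁻¹))).mul_const (η w)
    have h2 := hasDerivAt_radDeriv hs1 t q w
    simp only [hrad] at h2
    rw [h2.unique h1]
    ring
  have htime : ∀ q w, timeDeriv (profileTest χ β ζ η ε) (t, q, w)
      = (deriv χ t * gammaProfile (β t) q + χ t * (gammaProfileOp (β t) q * deriv β t))
        * ζ (ε * q) * η w := by
    intro q w
    have h1 := (hχ.differentiable (by simp) t).hasDerivAt
    have h2 := (hβ.differentiable (by simp) t).hasDerivAt
    have h3 := (hasDerivAt_gammaProfile_left (hβ0 t) q).comp t h2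
    have h4 := ((h1.fun_mul h3).mul_const (ζ (ε * q))).mul_const (η w)
    exact (hasDerivAt_timeDeriv hs t q w).unique h4
  have hb : β t ≠ 0 := (hβ0 t).ne'
  simp only [weakIntegrand, spherical, radialOperator, hrad, hrad2, htime, profileIntegrand,
    gammaProfileOp]
  field_simp
  ring

end TestFunction

theorem continuous_profileIntegrand_epsilon {ζ : ℝ → ℝ} (hζ : ContDiff ℝ ∞ ζ) (a χ β : ℝ → ℝ)
    (η : Momentum → ℝ) (z : ℝ × Momentum) :
    Continuous fun ε => profileIntegrand a χ β ζ η ε z := by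
  have hζ1 : ContDiff ℝ ∞ (deriv ζ) := (contDiff_infty_iff_deriv.1 hζ).2
  have hζ2 : ContDiff ℝ ∞ (deriv (deriv ζ)) := (contDiff_infty_iff_deriv.1 hζ1).2
  have h0 := hζ.continuous
  have h1 := hζ1.continuous
  have h2 := hζ2.continuous
  unfold profileIntegrand
  fun_prop

theorem inv_pow_le_of_le {β₀ β : ℝ} (h0 : 0 < β₀) (h : β₀ ≤ β) (n : ℕ) :
    (β ^ n)⁻¹ ≤ (β₀ ^ n)⁻¹ :=
  inv_anti₀ (pow_pos h0 n) (pow_le_pow_left₀ h0.le h n)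

/-- The bound is independent of `ε` and `p`, so it dominates while the radial cutoff is removed. It
uses that `V`, `(q/β) V` and `x ζ''(x)` are bounded. -/
theorem abs_profileIntegrand_le {a χ β ζ : ℝ → ℝ} {η : Momentum → ℝ} {ε β₀ M N : ℝ}
    (hβ₀ : 0 < β₀) (hβ : ∀ t, β₀ ≤ β t) (hM : 0 ≤ M) (hζ : ∀ x, |ζ x| ≤ M)
    (hζ1 : ∀ x, |deriv ζ x| ≤ M) (hζ2 : ∀ x, |x * deriv (deriv ζ) x| ≤ M)
    (hη : ∀ w, |η w| ≤ N) (hε0 : 0 ≤ ε) (hε : ε ≤ 1) (z : ℝ × Momentum) :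
    |profileIntegrand a χ β ζ η ε z| ≤ N * (M * (|deriv χ z.1| * (β₀ ^ 3)⁻¹
      + |χ z.1| * (|a z.1| + |deriv β z.1|) * (4 * (β₀ ^ 4)⁻¹))
      + |a z.1| * |χ z.1| * (M * (6 * (β₀ ^ 3)⁻¹))) := by
  obtain ⟨t, p⟩ := z
  have hb : 0 < β t := hβ₀.trans_le (hβ t)
  have hq : 0 ≤ ‖p‖ := norm_nonneg p
  have v0 := gammaProfile_nonneg hb ‖p‖
  have v1 := (gammaProfile_le hb hq).trans (inv_pow_le_of_le hβ₀ (hβ t) 3)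
  have v2 := (mul_gammaProfile_le (q := ‖p‖) hb).trans (inv_pow_le_of_le hβ₀ (hβ t) 3)
  have v3 : |gammaProfileOp (β t) ‖p‖| ≤ 4 * (β₀ ^ 4)⁻¹ :=
    (abs_gammaProfileOp_le hb hq).trans
      (mul_le_mul_of_nonneg_left (inv_pow_le_of_le hβ₀ (hβ t) 4) (by norm_num))
  have v20 : 0 ≤ ‖p‖ / β t * gammaProfile (β t) ‖p‖ := by positivity
  have hN : 0 ≤ N := (abs_nonneg _).trans (hη 0)
  have hK : 0 ≤ (β₀ ^ 3)⁻¹ := by positivity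
  have e1 : |3 * gammaProfile (β t) ‖p‖ - 2 * (‖p‖ / β t * gammaProfile (β t) ‖p‖)|
      ≤ 5 * (β₀ ^ 3)⁻¹ := by
    rw [abs_le]; constructor <;> linarith
  simp only [profileIntegrand]
  rw [abs_mul]
  refine mul_le_mul (hη _) ?_ (abs_nonneg _) hN
  refine (abs_add_le _ _).trans (add_le_add ?_ ?_)
  · rw [abs_mul]
    refine mul_le_mul (hζ _) ?_ (abs_nonneg _) hM
    refine (abs_add_le _ _).trans (add_le_add ?_ ?_)
    · rw [abs_mul, abs_of_nonneg v0]
      exact mul_le_mul_of_nonneg_left v1 (abs_nonneg _)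
    · rw [abs_mul, abs_mul]
      refine mul_le_mul ?_ v3 (abs_nonneg _) (by positivity)
      exact mul_le_mul_of_nonneg_left (abs_add_le _ _) (abs_nonneg _)
  · rw [abs_mul, abs_mul]
    refine mul_le_mul_of_nonneg_left ?_ (by positivity)
    rw [abs_mul, abs_of_nonneg hε0]
    refine (mul_le_of_le_one_left (abs_nonneg _) hε).trans ?_
    refine (abs_add_le _ _).trans ?_
    rw [abs_mul, abs_mul, abs_of_nonneg v0]
    have f1 := mul_le_mul (hζ1 (ε * ‖p‖)) e1 (abs_nonneg _) hM
    have f2 := mul_le_mul (hζ2 (ε * ‖p‖)) v1 v0 hM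
    linarith

/-- The weak formulation against gamma profiles with a smooth time-dependent scale. -/
theorem integral_gammaProfile_eq_zero {a : ℝ → ℝ}
    (ha : ∀ T : ℝ, 0 < T → IntegrableOn a (Ioc 0 T)) {h : ℝ → Momentum → ℝ}
    (hh : IsSolution a (fun _ => 0) h) {χ β : ℝ → ℝ} {η : Momentum → ℝ} {β₀ : ℝ}
    (hχ : ContDiff ℝ ∞ χ) (hχc : HasCompactSupport χ) (hβ : ContDiff ℝ ∞ β) (hβ₀ : 0 < β₀)
    (hβ0 : ∀ t, β₀ ≤ β t) (hη : ContDiff ℝ ∞ η) (hηc : HasCompactSupport η) :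
    ∫ z : ℝ × Momentum, h z.1 z.2 * (η (direction z.2) *
      (deriv χ z.1 * gammaProfile (β z.1) ‖z.2‖
        + χ z.1 * (a z.1 + deriv β z.1) * gammaProfileOp (β z.1) ‖z.2‖)) ∂timeMomentumMeasure
      = 0 := by
  obtain ⟨ζ, M, hζ, hζ0, hζs, hM, hb0, hb1, hb2⟩ := exists_radial_cutoff
  obtain ⟨N, hN⟩ := hη.continuous.bounded_above_of_compact_support hηc
  rw [isSolution_iff_integral ha] at hh
  have hβpos : ∀ t, 0 < β t := fun t => hβ₀.trans_le (hβ0 t)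
  set ε : ℕ → ℝ := fun n => 1 / ((n : ℝ) + 1) with hεdef
  have hε0 : ∀ n, 0 < ε n := fun n => by positivity
  have hε1 : ∀ n, ε n ≤ 1 := fun n => by
    rw [hεdef]; simp only; rw [div_le_one (by positivity)]; linarith [n.cast_nonneg (α := ℝ)]
  have hεlim : Filter.Tendsto ε Filter.atTop (nhds 0) := tendsto_one_div_add_atTop_nhds_zero_nat
  have hzero : ∀ n, ∫ z : ℝ × Momentum, h z.1 z.2 * profileIntegrand a χ β ζ η (ε n) z
      ∂timeMomentumMeasure = 0 := by
    intro n
    have := hh.2 (profileTest χ β ζ η (ε n)) (contDiff_profileTest hχ hβ hβpos hζ hη)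
      (hasCompactSupport_profileTest hχc hζs hηc (hε0 n))
    simpa only [weakIntegrand_profileTest a hχ hβ hβpos hζ hη, zero_mul, integral_zero,
      add_zero] using this
  set b : ℝ → ℝ := fun t => N * (M * (|deriv χ t| * (β₀ ^ 3)⁻¹
      + |χ t| * (|a t| + |deriv β t|) * (4 * (β₀ ^ 4)⁻¹))
      + |a t| * |χ t| * (M * (6 * (β₀ ^ 3)⁻¹))) with hbdef
  have hχ1 : ContDiff ℝ ∞ (deriv χ) := (contDiff_infty_iff_deriv.1 hχ).2
  have hβ1 : ContDiff ℝ ∞ (deriv β) := (contDiff_infty_iff_deriv.1 hβ).2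
  have i1 : Integrable fun t => |deriv χ t| :=
    (hχ1.continuous.integrable_of_hasCompactSupport hχc.deriv).abs
  have i2 : Integrable fun t => |χ t| * |deriv β t| := by
    have : HasCompactSupport fun t => χ t * deriv β t := hχc.mul_right
    have := ((hχ.continuous.mul hβ1.continuous).integrable_of_hasCompactSupport
      (μ := volume) this).abs
    simpa only [Pi.mul_apply, abs_mul] using this
  have i3 : IntegrableOn (fun t => |χ t| * |a t|) (Ioi 0) := by
    obtain ⟨D, hD⟩ := hχ.continuous.bounded_above_of_compact_support hχc
    obtain ⟨R, hR⟩ := hχc.isCompact.isBounded.exists_norm_le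
    have hsub : IntegrableOn (fun t => χ t * a t) (Ioc 0 (max R 1)) :=
      Integrable.bdd_mul (ha (max R 1) (by positivity))
        hχ.continuous.aestronglyMeasurable (Filter.Eventually.of_forall hD)
    have : IntegrableOn (fun t => χ t * a t) (Ioi 0) := by
      refine hsub.of_forall_sdiff_eq_zero measurableSet_Ioi ?_
      intro t ht
      simp only [Set.mem_sdiff, mem_Ioi, mem_Ioc, not_and, not_le] at ht
      have h1 := ht.2 ht.1
      have : t ∉ tsupport χ := by
        intro hmem
        have := hR t hmem
        rw [Real.norm_eq_abs, abs_of_pos ht.1] at this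
        linarith [le_max_left R 1]
      rw [image_eq_zero_of_notMem_tsupport this, zero_mul]
    simpa only [abs_mul, IntegrableOn] using this.abs
  have hbi : IntegrableOn b (Ioi 0) := by
    have hb' : b = fun t => (N * M * (β₀ ^ 3)⁻¹) * |deriv χ t|
        + (N * M * 4 * (β₀ ^ 4)⁻¹) * (|χ t| * |deriv β t|)
        + (N * M * 4 * (β₀ ^ 4)⁻¹ + N * M * 6 * (β₀ ^ 3)⁻¹) * (|χ t| * |a t|) := by
      ext t; rw [hbdef]; ring
    rw [hb']
    exact ((i1.integrableOn.const_mul _).add (i2.integrableOn.const_mul _)).add (i3.const_mul _)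
  have hmeas : ∀ n, AEStronglyMeasurable (profileIntegrand a χ β ζ η (ε n))
      timeMomentumMeasure := by
    intro n
    refine (exists_weight_weakIntegrand ha (contDiff_profileTest (ε := ε n) hχ hβ hβpos hζ hη)
      (hasCompactSupport_profileTest hχc hζs hηc (hε0 n))).1.congr ?_
    exact Filter.Eventually.of_forall fun z => weakIntegrand_profileTest a hχ hβ hβpos hζ hη z
  have hbound : ∀ n (z : ℝ × Momentum), |profileIntegrand a χ β ζ η (ε n) z| ≤ b z.1 :=
    fun n z => abs_profileIntegrand_le hβ₀ hβ0 hM hb0 hb1 hb2 hN (hε0 n).le (hε1 n) z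
  have hb0' : ∀ t, 0 ≤ b t := fun t => (abs_nonneg _).trans (hbound 0 (t, 0))
  have hdom : Integrable (fun z : ℝ × Momentum => h z.1 z.2 * b z.1) timeMomentumMeasure :=
    integrable_pairing hh.1 (aestronglyMeasurable_comp_fst hbi.aestronglyMeasurable) hbi
      (Filter.Eventually.of_forall fun t p => (abs_of_nonneg (hb0' t)).le)
  -- At `ε = 0` the cutoff is `ζ 0 = 1` and the error terms vanish.
  have hlim := tendsto_integral_of_dominated_convergence
    (μ := timeMomentumMeasure) (F := fun n z => h z.1 z.2 * profileIntegrand a χ β ζ η (ε n) z)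
    (f := fun z => h z.1 z.2 * profileIntegrand a χ β ζ η 0 z) (fun z => |h z.1 z.2 * b z.1|)
    (fun n => hh.1.1.mul (hmeas n)) hdom.abs
    (fun n => Filter.Eventually.of_forall fun z => by
      rw [Real.norm_eq_abs, abs_mul, abs_mul, abs_of_nonneg (hb0' z.1)]
      exact mul_le_mul_of_nonneg_left (hbound n z) (abs_nonneg _))
    (Filter.Eventually.of_forall fun z =>
      (((continuous_profileIntegrand_epsilon hζ a χ β η z).tendsto 0).comp hεlim).const_mul _)
  simp only [hzero] at hlim
  have := tendsto_nhds_unique hlim tendsto_const_nhds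
  simpa only [profileIntegrand, zero_mul, hζ0, one_mul, mul_zero, add_zero] using this

/-! ### The clock `τ(t) = ∫₀ᵗ a` and backward-moving profiles -/

theorem intervalIntegrable_of_integrableOn {a : ℝ → ℝ}
    (ha : ∀ T : ℝ, 0 < T → IntegrableOn a (Ioc 0 T)) {T : ℝ} (hT : 0 ≤ T) :
    IntervalIntegrable a volume 0 T := by
  rcases hT.eq_or_lt with rfl | h
  · exact IntervalIntegrable.refl
  · exact (intervalIntegrable_iff_integrableOn_Ioc_of_le hT).2 (ha T h)

theorem continuousOn_primitive_Ici {a : ℝ → ℝ}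
    (ha : ∀ T : ℝ, 0 < T → IntegrableOn a (Ioc 0 T)) :
    ContinuousOn (fun t => ∫ s in (0 : ℝ)..t, a s) (Ici 0) := by
  intro t ht
  have ht0 : (0 : ℝ) ≤ t := ht
  have h1 := intervalIntegral.continuousOn_primitive_interval'
    (intervalIntegrable_of_integrableOn ha (T := t + 1) (by linarith)) left_mem_uIcc
  rw [uIcc_of_le (by linarith)] at h1
  have h2 := h1 t ⟨ht0, by linarith⟩
  refine h2.mono_of_mem_nhdsWithin ?_
  have : Iio (t + 1) ∈ 𝓝 t := Iio_mem_nhds (by linarith)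
  filter_upwards [self_mem_nhdsWithin, mem_nhdsWithin_of_mem_nhds this] with x hx hx'
  exact ⟨hx, le_of_lt hx'⟩

theorem primitive_le_primitive {a : ℝ → ℝ}
    (ha : ∀ T : ℝ, 0 < T → IntegrableOn a (Ioc 0 T)) (ha0 : ∀ t, 0 ≤ a t) {s t : ℝ} (hs : 0 ≤ s)
    (hst : s ≤ t) : ∫ r in (0 : ℝ)..s, a r ≤ ∫ r in (0 : ℝ)..t, a r :=
  intervalIntegral.integral_mono_interval le_rfl hs hst (Eventually.of_forall ha0)
    (intervalIntegrable_of_integrableOn ha (hs.trans hst))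

/-- Smooth approximation of the speed of time on a bounded interval. -/
theorem exists_smooth_speed {a : ℝ → ℝ} (ha : ∀ T : ℝ, 0 < T → IntegrableOn a (Ioc 0 T))
    (ha0 : ∀ t, 0 ≤ a t) {T : ℝ} (hT : 0 < T) {δ : ℝ} (hδ : 0 < δ) :
    ∃ α : ℝ → ℝ, ContDiff ℝ ∞ α ∧
      IntegrableOn (fun t => |a t - α t|) (Ioc 0 T) ∧ ∫ t in Ioc 0 T, |a t - α t| ≤ δ ∧
      (∀ t, ∫ s in (0 : ℝ)..t, α s ≤ (∫ s in (0 : ℝ)..T, a s) + δ) ∧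
      ∀ t ∈ Icc 0 T, |(∫ s in (0 : ℝ)..t, α s) - ∫ s in (0 : ℝ)..t, a s| ≤ δ := by
  -- Truncation makes the speed globally integrable, so that smooth compactly supported functions
  -- approximate it in `L¹`; it also keeps the primitive of `α` below `τ(T) + δ` at all times, not
  -- only on `[0, T]`.
  set a₁ : ℝ → ℝ := (Ioc 0 T).indicator a with ha₁
  have hi : Integrable a₁ := (integrable_indicator_iff measurableSet_Ioc).2 (ha T hT)
  obtain ⟨α, hαc, hα, hle⟩ := (memLp_one_iff_integrable.2 hi).exist_eLpNorm_sub_le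
    ENNReal.one_ne_top le_rfl hδ
  have hαi : Integrable α := hα.continuous.integrable_of_hasCompactSupport hαc
  have hdi : Integrable fun t => |a₁ t - α t| := (hi.sub hαi).abs
  have hdle : ∫ t, |a₁ t - α t| ≤ δ := by
    rw [eLpNorm_one_eq_lintegral_enorm] at hle
    have h2 : ∫ t, |a₁ t - α t| = (∫⁻ t, ‖(a₁ - α) t‖ₑ).toReal :=
      integral_norm_eq_lintegral_enorm (hi.sub hαi).aestronglyMeasurable
    rw [h2]
    exact ENNReal.toReal_le_of_le_ofReal hδ.le hle
  have hprim : ∀ t, |(∫ s in (0 : ℝ)..t, α s) - ∫ s in (0 : ℝ)..t, a₁ s| ≤ δ := by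
    intro t
    rw [← intervalIntegral.integral_sub hαi.intervalIntegrable hi.intervalIntegrable]
    refine (intervalIntegral.norm_integral_le_integral_norm_uIoc (f := fun s => α s - a₁ s)).trans ?_
    refine le_trans ?_ hdle
    simp only [Real.norm_eq_abs, abs_sub_comm (α _)]
    exact setIntegral_le_integral hdi (Eventually.of_forall fun _ => abs_nonneg _)
  have ha₁0 : ∀ t, 0 ≤ a₁ t := fun t => indicator_nonneg (fun s _ => ha0 s) t
  have heq : ∀ t ∈ Icc 0 T, ∫ s in (0 : ℝ)..t, a₁ s = ∫ s in (0 : ℝ)..t, a s := by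
    intro t ht
    refine intervalIntegral.integral_congr_ae (Eventually.of_forall fun s hs => ?_)
    rw [uIoc_of_le ht.1] at hs
    exact indicator_of_mem (show s ∈ Ioc 0 T from ⟨hs.1, hs.2.trans ht.2⟩) a
  have htot : ∀ t, ∫ s in (0 : ℝ)..t, a₁ s ≤ ∫ s in (0 : ℝ)..T, a s := by
    intro t
    have hfull : ∫ s, a₁ s = ∫ s in (0 : ℝ)..T, a s := by
      rw [intervalIntegral.integral_of_le hT.le, ha₁, integral_indicator measurableSet_Ioc]
    rcases le_total 0 t with h | h
    · rw [intervalIntegral.integral_of_le h, ← hfull]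
      exact setIntegral_le_integral hi (Eventually.of_forall ha₁0)
    · rw [intervalIntegral.integral_of_ge h, ← hfull]
      have h1 : 0 ≤ ∫ s in Ioc t 0, a₁ s := setIntegral_nonneg measurableSet_Ioc fun s _ => ha₁0 s
      have h2 : 0 ≤ ∫ s, a₁ s := integral_nonneg ha₁0
      linarith
  have hcongr : EqOn (fun t => |a₁ t - α t|) (fun t => |a t - α t|) (Ioc 0 T) := by
    intro t ht
    simp only [ha₁, indicator_of_mem ht]
  refine ⟨α, hα, hdi.integrableOn.congr_fun hcongr measurableSet_Ioc, ?_, fun t => ?_,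
    fun t ht => ?_⟩
  · rw [← setIntegral_congr_fun measurableSet_Ioc hcongr]
    exact (setIntegral_le_integral hdi (Eventually.of_forall fun _ => abs_nonneg _)).trans hdle
  · linarith [htot t, (abs_le.1 (hprim t)).2]
  · rw [← heq t ht]; exact hprim t

theorem contDiff_primitive {α : ℝ → ℝ} (hα : ContDiff ℝ ∞ α) (c : ℝ) :
    ContDiff ℝ ∞ (fun t => ∫ s in c..t, α s) ∧
      ∀ t, HasDerivAt (fun t => ∫ s in c..t, α s) (α t) t := by
  have h : ∀ t, HasDerivAt (fun t => ∫ s in c..t, α s) (α t) t := fun t =>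
    hα.continuous.integral_hasStrictDerivAt c t |>.hasDerivAt
  refine ⟨contDiff_infty_iff_deriv.2 ⟨fun t => (h t).differentiableAt, ?_⟩, h⟩
  rwa [show deriv (fun t => ∫ s in c..t, α s) = α from funext fun t => (h t).deriv]

/-- The weak formulation against the gamma profile that moves with the equation. -/
theorem integral_moving_gammaProfile_eq_zero {a : ℝ → ℝ}
    (ha : ∀ T : ℝ, 0 < T → IntegrableOn a (Ioc 0 T)) (ha0 : ∀ t, 0 ≤ a t) {h : ℝ → Momentum → ℝ}
    (hh : IsSolution a (fun _ => 0) h) {χ : ℝ → ℝ} {η : Momentum → ℝ} {T c : ℝ} (hT : 0 < T)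
    (hc : ∫ s in (0 : ℝ)..T, a s < c) (hχ : ContDiff ℝ ∞ χ) (hχc : HasCompactSupport χ)
    (hχT : ∀ t, T ≤ t → χ t = 0 ∧ deriv χ t = 0)
    (hη : ContDiff ℝ ∞ η) (hηc : HasCompactSupport η) :
    ∫ z : ℝ × Momentum, h z.1 z.2 * (η (direction z.2) *
      (deriv χ z.1 * gammaProfile (c - ∫ s in (0 : ℝ)..z.1, a s) ‖z.2‖)) ∂timeMomentumMeasure
      = 0 := by
  -- Half the gap `c - τ(T)`: the approximation may spend the other half, `δ n ≤ β₀`, and every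
  -- smooth scale still satisfies `β n ≥ β₀ > 0`.
  set β₀ : ℝ := (c - ∫ s in (0 : ℝ)..T, a s) / 2 with hβ₀def
  have hβ₀ : 0 < β₀ := by rw [hβ₀def]; linarith
  set δ : ℕ → ℝ := fun n => β₀ * (1 / ((n : ℝ) + 1)) with hδdef
  have hδ0 : ∀ n, 0 < δ n := fun n => by positivity
  have hδ1 : ∀ n, δ n ≤ β₀ := fun n => by
    refine mul_le_of_le_one_right hβ₀.le ?_
    rw [div_le_one (by positivity)]; linarith [n.cast_nonneg (α := ℝ)]
  have hδlim : Tendsto δ atTop (𝓝 0) := by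
    simpa [hδdef] using (tendsto_one_div_add_atTop_nhds_zero_nat (𝕜 := ℝ)).const_mul β₀
  choose α hα hαi hαle hαtot hαprim using fun n => exists_smooth_speed ha ha0 hT (hδ0 n)
  set β : ℕ → ℝ → ℝ := fun n t => c - ∫ s in (0 : ℝ)..t, α n s with hβdef
  have hβs : ∀ n, ContDiff ℝ ∞ (β n) := fun n => contDiff_const.sub (contDiff_primitive (hα n) 0).1
  have hβd : ∀ n t, deriv (β n) t = -α n t := fun n t =>
    (((contDiff_primitive (hα n) 0).2 t).const_sub c).deriv
  have hβ0 : ∀ n t, β₀ ≤ β n t := fun n t => by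
    have := hαtot n t
    have := hδ1 n
    simp only [hβdef]; linarith
  obtain ⟨N, hN⟩ := hη.continuous.bounded_above_of_compact_support hηc
  obtain ⟨D, hD⟩ := hχ.continuous.bounded_above_of_compact_support hχc
  have hN0 : 0 ≤ N := (norm_nonneg _).trans (hN 0)
  have hD0 : 0 ≤ D := (norm_nonneg _).trans (hD 0)
  have hχ1 : ContDiff ℝ ∞ (deriv χ) := (contDiff_infty_iff_deriv.1 hχ).2
  obtain ⟨hmem, -⟩ := id hh
  obtain ⟨hm, C, hC⟩ := id hmem
  have hC' : ∀ᵐ t ∂(volume.restrict (Ioi (0 : ℝ))),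
      ∫⁻ p, ENNReal.ofReal |h t p| ≤ ENNReal.ofReal (max C 0) := by
    filter_upwards [hC] with t ht using ht.trans (ENNReal.ofReal_le_ofReal (le_max_left _ _))
  have hηm : Measurable fun z : ℝ × Momentum => η (direction z.2) :=
    hη.continuous.measurable.comp (measurable_direction.comp measurable_snd)
  have hβm : ∀ n, Measurable fun z : ℝ × Momentum => (β n z.1, ‖z.2‖) := fun n =>
    ((hβs n).continuous.measurable.comp measurable_fst).prodMk measurable_snd.norm
  have hGm : ∀ n, Measurable fun z : ℝ × Momentum => gammaProfile (β n z.1) ‖z.2‖ := fun n =>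
    measurable_gammaProfile.comp (hβm n)
  have hGOm : ∀ n, Measurable fun z : ℝ × Momentum => gammaProfileOp (β n z.1) ‖z.2‖ := fun n =>
    measurable_gammaProfileOp.comp (hβm n)
  -- the main term
  set Θ : ℕ → ℝ × Momentum → ℝ := fun n z => η (direction z.2) *
    (deriv χ z.1 * gammaProfile (β n z.1) ‖z.2‖) with hΘ
  have hΘm : ∀ n, Measurable (Θ n) := fun n =>
    hηm.mul ((hχ1.continuous.measurable.comp measurable_fst).mul (hGm n))
  set b : ℝ → ℝ := fun t => N * (|deriv χ t| * (β₀ ^ 3)⁻¹) with hb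
  have hbi : Integrable b :=
    ((hχ1.continuous.integrable_of_hasCompactSupport hχc.deriv).abs.mul_const _).const_mul _
  have hb0 : ∀ t, 0 ≤ b t := fun t => by positivity
  have hΘb : ∀ n (z : ℝ × Momentum), |Θ n z| ≤ b z.1 := fun n z => by
    have hβp : 0 < β n z.1 := hβ₀.trans_le (hβ0 n z.1)
    simp only [hΘ, hb, abs_mul, abs_of_nonneg (gammaProfile_nonneg hβp ‖z.2‖)]
    refine mul_le_mul (hN _) ?_ (mul_nonneg (abs_nonneg _) (gammaProfile_nonneg hβp _)) hN0
    exact mul_le_mul_of_nonneg_left ((gammaProfile_le hβp (norm_nonneg _)).trans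
      (inv_pow_le_of_le hβ₀ (hβ0 n z.1) 3)) (abs_nonneg _)
  -- the error term
  set E : ℕ → ℝ × Momentum → ℝ := fun n z => η (direction z.2) *
    (χ z.1 * (a z.1 + deriv (β n) z.1) * gammaProfileOp (β n z.1) ‖z.2‖) with hE
  have ham := aestronglyMeasurable_comp_fst (aestronglyMeasurable_Ioi_of_integrableOn ha)
  have hEm : ∀ n, AEStronglyMeasurable (E n) timeMomentumMeasure := fun n => by
    have h1 : Measurable fun z : ℝ × Momentum => deriv (β n) z.1 := by
      simp only [hβd]
      exact ((hα n).continuous.measurable.comp measurable_fst).neg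
    exact hηm.aestronglyMeasurable.mul
      (((hχ.continuous.measurable.comp measurable_fst).aestronglyMeasurable.mul
        (ham.add h1.aestronglyMeasurable)).mul (hGOm n).aestronglyMeasurable)
  set e : ℕ → ℝ → ℝ := fun n => (Ioc 0 T).indicator
    fun t => (N * D * (4 * (β₀ ^ 4)⁻¹)) * |a t - α n t| with he
  have hei : ∀ n, Integrable (e n) := fun n =>
    (integrable_indicator_iff measurableSet_Ioc).2 ((hαi n).const_mul _)
  have hEb : ∀ n, ∀ᵐ t ∂(volume.restrict (Ioi (0 : ℝ))), ∀ p, |E n (t, p)| ≤ e n t := by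
    intro n
    filter_upwards [ae_restrict_mem measurableSet_Ioi] with t ht p
    have ht0 : 0 < t := ht
    by_cases htT : t ≤ T
    · have hβp : 0 < β n t := hβ₀.trans_le (hβ0 n t)
      simp only [hE, he]
      rw [indicator_of_mem (show t ∈ Ioc 0 T from ⟨ht0, htT⟩), hβd, ← sub_eq_add_neg]
      simp only [abs_mul]
      have v : |gammaProfileOp (β n t) ‖p‖| ≤ 4 * (β₀ ^ 4)⁻¹ :=
        (abs_gammaProfileOp_le hβp (norm_nonneg p)).trans
          (mul_le_mul_of_nonneg_left (inv_pow_le_of_le hβ₀ (hβ0 n t) 4) (by norm_num))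
      calc |η (direction p)| * (|χ t| * |a t - α n t| * |gammaProfileOp (β n t) ‖p‖|)
          ≤ N * (D * |a t - α n t| * (4 * (β₀ ^ 4)⁻¹)) := by
            have h1 := hN (direction p)
            have h2 := hD t
            rw [Real.norm_eq_abs] at h1 h2
            gcongr
        _ = _ := by ring
    · simp only [hE, he, (hχT t (not_le.1 htT).le).1]
      rw [indicator_of_notMem (fun hmem => htT hmem.2)]
      simp
  have hΘint : ∀ n, Integrable (fun z : ℝ × Momentum => h z.1 z.2 * Θ n z) timeMomentumMeasure :=
    fun n => integrable_pairing hmem (hΘm n).aestronglyMeasurable hbi.integrableOn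
      (Eventually.of_forall fun t p => hΘb n (t, p))
  have hEint : ∀ n, Integrable (fun z : ℝ × Momentum => h z.1 z.2 * E n z) timeMomentumMeasure :=
    fun n => integrable_pairing hmem (hEm n) (hei n).integrableOn (hEb n)
  have hsum : ∀ n, ∫ z : ℝ × Momentum, h z.1 z.2 * Θ n z ∂timeMomentumMeasure
      = -∫ z : ℝ × Momentum, h z.1 z.2 * E n z ∂timeMomentumMeasure := by
    intro n
    have h1 := integral_gammaProfile_eq_zero ha hh hχ hχc (hβs n) hβ₀ (hβ0 n) hη hηc
    rw [eq_neg_iff_add_eq_zero, ← integral_add (hΘint n) (hEint n), ← h1]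
    refine integral_congr_ae (Eventually.of_forall fun z => ?_)
    simp only [hΘ, hE]
    ring
  -- The error carries the factor `a + β n' = a - α n`, small in `L¹(0, T)`, against a factor
  -- bounded by means of `β n ≥ β₀`.
  have hElim : Tendsto (fun n => ∫ z : ℝ × Momentum, h z.1 z.2 * E n z ∂timeMomentumMeasure)
      atTop (𝓝 0) := by
    have hbd : ∀ n, ‖∫ z : ℝ × Momentum, h z.1 z.2 * E n z ∂timeMomentumMeasure‖
        ≤ max C 0 * ((N * D * (4 * (β₀ ^ 4)⁻¹)) * δ n) := by
      intro n
      refine (norm_integral_le_integral_norm _).trans ?_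
      refine (abs_integral_pairing_le (le_max_right C 0) hm hC' (hEm n) (hei n).integrableOn
        (hEb n)).trans ?_
      refine mul_le_mul_of_nonneg_left ?_ (le_max_right C 0)
      have h1 : ∫ t in Ioi (0 : ℝ), e n t ≤ ∫ t, e n t :=
        setIntegral_le_integral (hei n) (Eventually.of_forall fun t =>
          indicator_nonneg (fun s _ => by positivity) t)
      refine h1.trans ?_
      rw [he]
      simp only
      rw [integral_indicator measurableSet_Ioc, integral_const_mul]
      exact mul_le_mul_of_nonneg_left (hαle n) (by positivity)
    refine squeeze_zero_norm hbd ?_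
    simpa using (hδlim.const_mul (N * D * (4 * (β₀ ^ 4)⁻¹))).const_mul (max C 0)
  have hdom : Integrable (fun z : ℝ × Momentum => h z.1 z.2 * b z.1) timeMomentumMeasure :=
    integrable_pairing hmem
      (aestronglyMeasurable_comp_fst hbi.integrableOn.aestronglyMeasurable) hbi.integrableOn
      (Eventually.of_forall fun t p => (abs_of_nonneg (hb0 t)).le)
  have hpos : ∀ᵐ z ∂timeMomentumMeasure, 0 < z.1 :=
    ae_timeMomentumMeasure_of_forall_ae (Q := fun t => 0 < t) (ae_restrict_mem measurableSet_Ioi)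
      fun t p ht => ht
  have hlim := tendsto_integral_of_dominated_convergence
    (μ := timeMomentumMeasure) (F := fun n z => h z.1 z.2 * Θ n z)
    (f := fun z => h z.1 z.2 * (η (direction z.2) *
      (deriv χ z.1 * gammaProfile (c - ∫ s in (0 : ℝ)..z.1, a s) ‖z.2‖)))
    (fun z => |h z.1 z.2 * b z.1|) (fun n => hm.mul (hΘm n).aestronglyMeasurable) hdom.abs
    (fun n => Eventually.of_forall fun z => by
      rw [Real.norm_eq_abs, abs_mul, abs_mul _ (b z.1), abs_of_nonneg (hb0 z.1)]
      exact mul_le_mul_of_nonneg_left (hΘb n z) (abs_nonneg _))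
    (by
      filter_upwards [hpos] with z hz
      refine Tendsto.const_mul _ (Tendsto.const_mul _ ?_)
      -- After `T` the limiting scale may be nonpositive, but `χ'` vanishes there.
      by_cases hzT : z.1 ≤ T
      · refine Tendsto.const_mul _ ?_
        have hβt : Tendsto (fun n => β n z.1) atTop (𝓝 (c - ∫ s in (0 : ℝ)..z.1, a s)) := by
          refine Tendsto.const_sub c ?_
          rw [tendsto_iff_norm_sub_tendsto_zero]
          exact squeeze_zero (fun _ => norm_nonneg _) (fun n => hαprim n z.1 ⟨hz.le, hzT⟩) hδlim
        have hpos' : 0 < c - ∫ s in (0 : ℝ)..z.1, a s := by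
          have := primitive_le_primitive ha ha0 hz.le hzT
          linarith
        exact (hasDerivAt_gammaProfile_left hpos' ‖z.2‖).continuousAt.tendsto.comp hβt
      · simp only [(hχT z.1 (not_le.1 hzT).le).2, zero_mul]
        exact tendsto_const_nhds)
  simp only [hsum] at hlim
  have := hElim.neg
  rw [neg_zero] at this
  exact tendsto_nhds_unique hlim this

/-- A smooth function supported in `(0, T)` is, for positive times, the derivative of a smooth
compactly supported function that vanishes after `T`. -/
theorem exists_primitive_test {θ : ℝ → ℝ} (hθ : ContDiff ℝ ∞ θ) {T : ℝ} (hT : 0 < T)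
    (hs : tsupport θ ⊆ Ioo 0 T) :
    ∃ χ : ℝ → ℝ, ContDiff ℝ ∞ χ ∧ HasCompactSupport χ ∧ (∀ t, T ≤ t → χ t = 0 ∧ deriv χ t = 0) ∧
      ∀ t, 0 < t → deriv χ t = θ t := by
  have hθ0 : ∀ t, t ∉ Ioo 0 T → θ t = 0 := fun t ht =>
    image_eq_zero_of_notMem_tsupport fun h => ht (hs h)
  obtain ⟨hP, hPd⟩ := contDiff_primitive hθ T
  -- The base point `T` makes the primitive vanish after `T`. The transition factor kills it for `t
  -- ≤ -1` and is 1 for `t ≥ 0`, so nothing changes at positive times. The value at `t = 0` is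
  -- unconstrained.
  set χ : ℝ → ℝ := fun t => Real.smoothTransition (t + 1) * ∫ s in T..t, θ s with hχ
  have hd : ∀ t, 0 < t → deriv χ t = θ t := by
    intro t ht
    have : χ =ᶠ[𝓝 t] fun t => ∫ s in T..t, θ s := by
      filter_upwards [Ioi_mem_nhds ht] with s hs'
      have : (0 : ℝ) < s := hs'
      rw [hχ]
      simp only
      rw [Real.smoothTransition.one_of_one_le (by linarith), one_mul]
    rw [this.deriv_eq, (hPd t).deriv]
  have hz : ∀ t, T ≤ t → χ t = 0 := by
    intro t ht
    have : ∫ s in T..t, θ s = 0 := by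
      refine intervalIntegral.integral_zero_ae (Eventually.of_forall fun s hs' => ?_)
      rw [uIoc_of_le ht] at hs'
      exact hθ0 s fun h => absurd h.2 (not_lt.2 hs'.1.le)
    simp only [hχ, this, mul_zero]
  refine ⟨χ, ?_, ?_, fun t ht => ⟨hz t ht, ?_⟩, hd⟩
  · have h1 : ContDiff ℝ ∞ fun t : ℝ => Real.smoothTransition (t + 1) :=
      Real.smoothTransition.contDiff.comp (by fun_prop)
    exact h1.mul hP
  · refine HasCompactSupport.intro (isCompact_Icc (a := (-1 : ℝ)) (b := T)) fun t ht => ?_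
    rcases lt_or_ge t (-1) with h | h
    · simp only [hχ, Real.smoothTransition.zero_of_nonpos (show t + 1 ≤ 0 by linarith), zero_mul]
    · exact hz t (le_of_lt (not_le.1 fun h' => ht ⟨h, h'⟩))
  · rw [hd t (hT.trans_le ht)]
    exact hθ0 t fun h => absurd h.2 (not_lt.2 ht)

/-! ### Vanishing of the exponential moments -/

theorem exists_angular_test (m : Option (Fin 3) →₀ ℕ) :
    ∃ η : Momentum → ℝ, ContDiff ℝ ∞ η ∧ HasCompactSupport η ∧
      ∀ p, η (direction p) = angularMonomial m (direction p) := by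
  let κ : ContDiffBump (0 : Momentum) := ⟨1, 2, one_pos, one_lt_two⟩
  refine ⟨fun w => κ w * angularMonomial m w, κ.contDiff.mul (contDiff_angularMonomial m),
    κ.hasCompactSupport.mul_right, fun p => ?_⟩
  have : κ (direction p) = 1 :=
    κ.one_of_mem_closedBall (by simpa [κ] using norm_direction_le p)
  simp only [this, one_mul]

/-- The zero datum allows test functions that do not vanish at `t = 0`. Hence `χ'` can be an
arbitrary `θ` supported in `(0, T)`, with no mean-zero condition, and the pairing is zero rather
than merely constant. -/
theorem ae_integral_moving_gammaProfile_eq_zero {a : ℝ → ℝ}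
    (ha : ∀ T : ℝ, 0 < T → IntegrableOn a (Ioc 0 T)) (ha0 : ∀ t, 0 ≤ a t) {h : ℝ → Momentum → ℝ}
    (hh : IsSolution a (fun _ => 0) h) {T c : ℝ} (hT : 0 < T)
    (hc : ∫ s in (0 : ℝ)..T, a s < c) (m : Option (Fin 3) →₀ ℕ) :
    ∀ᵐ t, t ∈ Ioo 0 T → ∫ p, h t p * (angularMonomial m (direction p) *
      gammaProfile (c - ∫ s in (0 : ℝ)..t, a s) ‖p‖) = 0 := by
  obtain ⟨η, hη, hηc, hηe⟩ := exists_angular_test m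
  set τ : ℝ → ℝ := fun t => ∫ s in (0 : ℝ)..t, a s with hτ
  have hβ₀ : 0 < c - τ T := by linarith
  set Θ : ℝ × Momentum → ℝ := fun z => (Ioo 0 T).indicator 1 z.1 *
    (angularMonomial m (direction z.2) * gammaProfile (c - τ z.1) ‖z.2‖) with hΘ
  have hτm : AEStronglyMeasurable τ (volume.restrict (Ioi 0)) :=
    ((continuousOn_primitive_Ici ha).mono Ioi_subset_Ici_self).aestronglyMeasurable
      measurableSet_Ioi
  have hΘm : AEStronglyMeasurable Θ timeMomentumMeasure := by
    have h1 : Measurable fun z : ℝ × Momentum => (Ioo 0 T).indicator (1 : ℝ → ℝ) z.1 :=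
      (measurable_one.indicator measurableSet_Ioo).comp measurable_fst
    have h2 : Measurable fun z : ℝ × Momentum => angularMonomial m (direction z.2) :=
      (measurable_angularMonomial_direction m).comp measurable_snd
    have h3 : AEMeasurable (fun z : ℝ × Momentum => (c - τ z.1, ‖z.2‖)) timeMomentumMeasure :=
      ((aestronglyMeasurable_comp_fst hτm).aemeasurable.const_sub c).prodMk
        measurable_snd.norm.aemeasurable
    exact h1.aestronglyMeasurable.mul (h2.aestronglyMeasurable.mul
      (measurable_gammaProfile.comp_aemeasurable h3).aestronglyMeasurable)
  have hΘb : ∀ t p, |Θ (t, p)| ≤ (Ioo 0 T).indicator (fun _ => ((c - τ T) ^ 3)⁻¹) t := by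
    intro t p
    by_cases ht : t ∈ Ioo 0 T
    · have hle : c - τ T ≤ c - τ t := by
        have := primitive_le_primitive ha ha0 ht.1.le ht.2.le
        simp only [hτ]; linarith
      have hp := hβ₀.trans_le hle
      simp only [hΘ, indicator_of_mem ht, Pi.one_apply, one_mul, abs_mul,
        abs_of_nonneg (gammaProfile_nonneg hp ‖p‖)]
      refine (mul_le_of_le_one_left (gammaProfile_nonneg hp _) (abs_angularMonomial_le m p)).trans ?_
      exact (gammaProfile_le hp (norm_nonneg p)).trans (inv_pow_le_of_le hβ₀ hle 3)
    · simp [hΘ, indicator_of_notMem ht]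
  have hbi : Integrable ((Ioo 0 T).indicator fun _ => ((c - τ T) ^ 3)⁻¹) :=
    (integrable_indicator_iff measurableSet_Ioo).2 (integrableOn_const (by simp))
  have hint := integrable_pairing hh.1 hΘm hbi.integrableOn (Eventually.of_forall hΘb)
  set w : ℝ → ℝ := fun t => ∫ p, h t p * (angularMonomial m (direction p) *
      gammaProfile (c - τ t) ‖p‖) with hw
  have hslice : ∀ t ∈ Ioo 0 T, ∫ p, h t p * Θ (t, p) = w t := by
    intro t ht
    simp only [hΘ, indicator_of_mem ht, Pi.one_apply, one_mul, hw]
  have hwi : IntegrableOn w (Ioo 0 T) := by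
    have h1 : IntegrableOn (fun t => ∫ p, h t p * Θ (t, p)) (Ioi 0) := by
      rw [timeMomentumMeasure] at hint
      exact hint.integral_prod_left
    exact (h1.mono_set Ioo_subset_Ioi_self).congr_fun hslice measurableSet_Ioo
  refine isOpen_Ioo.ae_eq_zero_of_integral_contDiff_smul_eq_zero hwi.locallyIntegrableOn ?_
  intro θ hθ hθc hθs
  obtain ⟨χ, hχ, hχc, hχT, hχd⟩ := exists_primitive_test hθ hT hθs
  have hθ0 : ∀ t, t ∉ Ioo 0 T → θ t = 0 := fun t ht =>
    image_eq_zero_of_notMem_tsupport fun h => ht (hθs h)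
  obtain ⟨B, hB⟩ := hθ.continuous.bounded_above_of_compact_support hθc
  have hzero := integral_moving_gammaProfile_eq_zero ha ha0 hh hT hc hχ hχc hχT hη hηc
  have hpos : ∀ᵐ z ∂timeMomentumMeasure, 0 < z.1 :=
    ae_timeMomentumMeasure_of_forall_ae (Q := fun t => 0 < t) (ae_restrict_mem measurableSet_Ioi)
      fun t p ht => ht
  have hcongr : ∫ z : ℝ × Momentum, θ z.1 * (h z.1 z.2 * Θ z) ∂timeMomentumMeasure = 0 := by
    rw [← hzero]
    refine integral_congr_ae ?_
    filter_upwards [hpos] with z hz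
    rw [hχd z.1 hz, hηe]
    by_cases ht : z.1 ∈ Ioo 0 T
    · simp only [hΘ, indicator_of_mem ht, Pi.one_apply, hτ]; ring
    · rw [hθ0 _ ht]; ring
  have hint2 : Integrable (fun z : ℝ × Momentum => θ z.1 * (h z.1 z.2 * Θ z))
      timeMomentumMeasure :=
    hint.bdd_mul (hθ.continuous.measurable.comp measurable_fst).aestronglyMeasurable
      (Eventually.of_forall fun z => hB z.1)
  rw [← iterated_eq_integral hint2] at hcongr
  rw [← setIntegral_eq_integral_of_forall_compl_eq_zero (s := Ioi (0 : ℝ))]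
  · refine Eq.trans ?_ hcongr
    refine setIntegral_congr_fun measurableSet_Ioi fun t _ => ?_
    change θ t • w t = ∫ p, θ t * (h t p * Θ (t, p))
    rw [integral_const_mul, smul_eq_mul]
    by_cases ht' : t ∈ Ioo 0 T
    · rw [hslice t ht']
    · rw [hθ0 t ht', zero_mul, zero_mul]
  · intro t ht
    rw [hθ0 t fun h' => ht h'.1, zero_smul]

theorem MemLinftyL1.ae_integrable {h : ℝ → Momentum → ℝ} (hh : MemLinftyL1 h) :
    ∀ᵐ t ∂(volume.restrict (Ioi (0 : ℝ))), Integrable (h t) := by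
  obtain ⟨hm, C, hC⟩ := hh
  rw [timeMomentumMeasure] at hm
  filter_upwards [hm.prodMk_left, hC] with t h1 h2
  refine ⟨h1, ?_⟩
  simp only [HasFiniteIntegral, Real.enorm_eq_ofReal_abs]
  exact h2.trans_lt ENNReal.ofReal_lt_top

/-- At time `t` the choice `c = τ(t) + 1/λ` makes the backward profile a multiple of `e^{-λ|p|}`, so
all exponential moments of `h(t)` vanish. -/
theorem ae_eq_zero_of_isSolution_zero {a : ℝ → ℝ}
    (ha : ∀ T : ℝ, 0 < T → IntegrableOn a (Ioc 0 T)) (ha0 : ∀ t, 0 ≤ a t) {h : ℝ → Momentum → ℝ}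
    (hh : IsSolution a (fun _ => 0) h) :
    ∀ᵐ z ∂timeMomentumMeasure, h z.1 z.2 = 0 := by
  -- The exceptional null set of times depends on `T`, `c` and `m`, so `c` cannot depend on `t`
  -- directly. Rational parameters leave countably many null sets.
  have hcount : ∀ᵐ t, ∀ (T c : ℚ) (m : Option (Fin 3) →₀ ℕ), 0 < (T : ℝ) →
      ∫ s in (0 : ℝ)..T, a s < c → t ∈ Ioo 0 (T : ℝ) →
      ∫ p, h t p * (angularMonomial m (direction p) *
        gammaProfile (c - ∫ s in (0 : ℝ)..t, a s) ‖p‖) = 0 := by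
    simp only [ae_all_iff]
    intro T c m hT hc
    exact ae_integral_moving_gammaProfile_eq_zero ha ha0 hh hT hc m
  have hslice : ∀ᵐ t ∂(volume.restrict (Ioi (0 : ℝ))), ∀ᵐ p, h t p = 0 := by
    filter_upwards [ae_restrict_of_ae hcount, hh.1.ae_integrable,
      ae_restrict_mem measurableSet_Ioi] with t ht hti ht0
    have ht0 : (0 : ℝ) < t := ht0
    refine ae_eq_zero_of_forall_expMonomial hti fun m => ?_
    set x : ℝ := (∫ s in (0 : ℝ)..t, a s) + (decayRate m)⁻¹ with hx
    have hlam := decayRate_pos m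
    -- The approximation of `x` is from above, so the scales `c n - τ(t)` stay at least `1/λ` and
    -- the profiles are uniformly bounded.
    choose c hc1 hc2 using fun n : ℕ =>
      exists_rat_btwn (show x < x + 1 / ((n : ℝ) + 1) by linarith [Nat.one_div_pos_of_nat (α := ℝ) (n := n)])
    have hclim : Tendsto (fun n => (c n : ℝ)) atTop (𝓝 x) := by
      refine tendsto_of_tendsto_of_tendsto_of_le_of_le tendsto_const_nhds ?_
        (fun n => (hc1 n).le) (fun n => (hc2 n).le)
      simpa using (tendsto_one_div_add_atTop_nhds_zero_nat (𝕜 := ℝ)).const_add x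
    have hz : ∀ n, ∫ p, h t p * (angularMonomial m (direction p) *
        gammaProfile (c n - ∫ s in (0 : ℝ)..t, a s) ‖p‖) = 0 := by
      intro n
      have hcont : ContinuousAt (fun t => ∫ s in (0 : ℝ)..t, a s) t :=
        (continuousOn_primitive_Ici ha).continuousAt (Ici_mem_nhds ht0)
      have hlt : ∫ s in (0 : ℝ)..t, a s < c n := by
        have := hc1 n
        have := inv_pos.2 hlam
        linarith
      -- Continuity of the clock leaves room for a rational `T > t` with `τ(T) < c n`.
      have hev : ∀ᶠ s in 𝓝[>] t, ∫ r in (0 : ℝ)..s, a r < c n :=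
        (hcont.eventually (gt_mem_nhds hlt)).filter_mono nhdsWithin_le_nhds
      obtain ⟨s, hs, hs'⟩ := (hev.and self_mem_nhdsWithin).exists
      obtain ⟨T, hT1, hT2⟩ := exists_rat_btwn (show t < s from hs')
      refine ht T (c n) m (ht0.trans hT1) ?_ ⟨ht0, hT1⟩
      exact (primitive_le_primitive ha ha0 (ht0.trans hT1).le hT2.le).trans_lt hs
    have hge : ∀ n, (decayRate m)⁻¹ ≤ c n - ∫ s in (0 : ℝ)..t, a s := fun n => by
      have := hc1 n
      linarith
    have hlim := tendsto_integral_of_dominated_convergence (μ := (volume : Measure Momentum))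
      (F := fun n p => h t p * (angularMonomial m (direction p) *
        gammaProfile (c n - ∫ s in (0 : ℝ)..t, a s) ‖p‖))
      (f := fun p => h t p * (angularMonomial m (direction p) *
        gammaProfile ((decayRate m)⁻¹) ‖p‖))
      (fun p => |h t p| * (((decayRate m)⁻¹) ^ 3)⁻¹)
      (fun n => by
        refine hti.aestronglyMeasurable.mul (Measurable.aestronglyMeasurable ?_)
        exact (measurable_angularMonomial_direction m).mul
          (measurable_gammaProfile.comp (measurable_const.prodMk measurable_norm)))
      (hti.abs.mul_const _)
      (fun n => Eventually.of_forall fun p => by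
        have hp := (inv_pos.2 hlam).trans_le (hge n)
        rw [Real.norm_eq_abs, abs_mul, abs_mul, abs_of_nonneg (gammaProfile_nonneg hp ‖p‖)]
        refine mul_le_mul_of_nonneg_left ?_ (abs_nonneg _)
        refine (mul_le_of_le_one_left (gammaProfile_nonneg hp _)
          (abs_angularMonomial_le m p)).trans ?_
        exact (gammaProfile_le hp (norm_nonneg p)).trans
          (inv_pow_le_of_le (inv_pos.2 hlam) (hge n) 3))
      (Eventually.of_forall fun p => by
        refine Tendsto.const_mul _ (Tendsto.const_mul _ ?_)
        have h1 : Tendsto (fun n => (c n : ℝ) - ∫ s in (0 : ℝ)..t, a s) atTop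
            (𝓝 ((decayRate m)⁻¹)) := by
          have := hclim.sub_const (∫ s in (0 : ℝ)..t, a s)
          rwa [hx, add_sub_cancel_left] at this
        exact (hasDerivAt_gammaProfile_left (inv_pos.2 hlam) ‖p‖).continuousAt.tendsto.comp h1)
    simp only [hz] at hlim
    have h0 := tendsto_nhds_unique hlim tendsto_const_nhds
    have hfac : ∀ p : Momentum, h t p * (angularMonomial m (direction p) *
        gammaProfile ((decayRate m)⁻¹) ‖p‖) = decayRate m ^ 3 * (h t p *
        (angularMonomial m (direction p) * Real.exp (-(decayRate m * ‖p‖)))) := by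
      intro p
      rw [gammaProfile, inv_pow, inv_inv, div_inv_eq_mul, mul_comm ‖p‖]
      ring
    simp only [hfac] at h0
    rw [integral_const_mul] at h0
    exact (mul_eq_zero.1 h0).resolve_left (pow_pos hlam 3).ne'
  have hm := hh.1.1
  rw [timeMomentumMeasure] at hm ⊢
  have h0 : ∫⁻ z : ℝ × Momentum, ‖h z.1 z.2‖ₑ ∂((volume.restrict (Ioi (0 : ℝ))).prod volume)
      = 0 := by
    rw [lintegral_prod _ hm.enorm]
    refine (lintegral_congr_ae ?_).trans lintegral_zero
    filter_upwards [hslice] with t ht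
    refine (lintegral_congr_ae ?_).trans lintegral_zero
    filter_upwards [ht] with p hp
    simp [hp]
  filter_upwards [(lintegral_eq_zero_iff' hm.enorm).1 h0] with z hz
  simpa using hz

theorem IsSolution.ae_eq {a : ℝ → ℝ} (ha : ∀ T : ℝ, 0 < T → IntegrableOn a (Ioc 0 T))
    (ha0 : ∀ t, 0 ≤ a t) {h_in : Momentum → ℝ} {h₁ h₂ : ℝ → Momentum → ℝ}
    (hh₁ : IsSolution a h_in h₁) (hh₂ : IsSolution a h_in h₂) :
    ∀ᵐ z ∂timeMomentumMeasure, h₁ z.1 z.2 = h₂ z.1 z.2 := by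
  filter_upwards [ae_eq_zero_of_isSolution_zero ha ha0 (hh₁.sub ha hh₂)] with z hz
  exact sub_eq_zero.1 hz

/-! ### Contraction in `L¹` along a ray -/

theorem integral_pow_mul_exp_neg_mul_Ioi (n : ℕ) {r : ℝ} (hr : 0 < r) :
    ∫ q in Ioi (0 : ℝ), q ^ n * Real.exp (-(r * q)) = n.factorial / r ^ (n + 1) := by
  have h := Real.integral_rpow_mul_exp_neg_mul_Ioi (a := (n : ℝ) + 1) (by positivity) hr
  rw [add_sub_cancel_right, Real.Gamma_nat_eq_factorial] at h
  have e : ((n : ℝ) + 1) = ((n + 1 : ℕ) : ℝ) := by push_cast; ring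
  rw [e, Real.rpow_natCast] at h
  simp only [Real.rpow_natCast] at h
  rw [h, one_div, inv_pow]
  field_simp

theorem integrableOn_pow_mul_exp_neg_mul_Ioi (n : ℕ) {r : ℝ} (hr : 0 < r) :
    IntegrableOn (fun q : ℝ => q ^ n * Real.exp (-(r * q))) (Ioi 0) := by
  -- The integral of a non-integrable function is zero by convention, so the nonzero value found
  -- above proves integrability.
  refine Integrable.of_integral_ne_zero ?_
  rw [integral_pow_mul_exp_neg_mul_Ioi n hr]
  positivity

theorem lintegral_pow_mul_exp_neg_mul_Ioi (n : ℕ) {r : ℝ} (hr : 0 < r) :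
    ∫⁻ q in Ioi (0 : ℝ), ENNReal.ofReal (q ^ n * Real.exp (-(r * q)))
      = ENNReal.ofReal (n.factorial / r ^ (n + 1)) := by
  rw [← integral_pow_mul_exp_neg_mul_Ioi n hr, ofReal_integral_eq_lintegral_ofReal
    (integrableOn_pow_mul_exp_neg_mul_Ioi n hr)]
  filter_upwards [ae_restrict_mem measurableSet_Ioi] with q hq
  have : (0 : ℝ) < q := hq
  change 0 ≤ q ^ n * Real.exp (-(r * q))
  positivity

/-- The Poisson weights of the transition kernel. -/
noncomputable def poissonWeight (s : ℝ) (k : ℕ) (q : ℝ) : ℝ :=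
  (s⁻¹) ^ k / k.factorial * (q ^ k * Real.exp (-(s⁻¹ * q)))

/-- The gamma densities of the transition kernel. -/
noncomputable def gammaDensity (s : ℝ) (k : ℕ) (q : ℝ) : ℝ :=
  (s⁻¹) ^ (k + 3) / (k + 2).factorial * (q ^ (k + 2) * Real.exp (-(s⁻¹ * q)))

theorem poissonWeight_nonneg {s q : ℝ} (hs : 0 < s) (hq : 0 ≤ q) (k : ℕ) :
    0 ≤ poissonWeight s k q := by
  unfold poissonWeight; positivity

theorem gammaDensity_nonneg {s q : ℝ} (hs : 0 < s) (hq : 0 ≤ q) (k : ℕ) :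
    0 ≤ gammaDensity s k q := by
  unfold gammaDensity; positivity

theorem gammaDensity_mul_exp (s : ℝ) (k : ℕ) (q l : ℝ) :
    gammaDensity s k q * Real.exp (-(l * q)) = (s⁻¹) ^ (k + 3) / (k + 2).factorial *
      (q ^ (k + 2) * Real.exp (-((s⁻¹ + l) * q))) := by
  have : Real.exp (-((s⁻¹ + l) * q)) = Real.exp (-(s⁻¹ * q)) * Real.exp (-(l * q)) := by
    rw [← Real.exp_add]; congr 1; ring
  rw [this, gammaDensity]; ring

theorem integrableOn_gammaDensity_mul_exp {s l : ℝ} (hs : 0 < s) (hl : 0 < l) (k : ℕ) :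
    IntegrableOn (fun q => gammaDensity s k q * Real.exp (-(l * q))) (Ioi 0) := by
  simp only [gammaDensity_mul_exp]
  exact (integrableOn_pow_mul_exp_neg_mul_Ioi (k + 2) (by positivity)).const_mul _

theorem integral_gammaDensity_mul_exp {s l : ℝ} (hs : 0 < s) (hl : 0 < l) (k : ℕ) :
    ∫ q in Ioi (0 : ℝ), gammaDensity s k q * Real.exp (-(l * q)) = ((1 + l * s) ^ (k + 3))⁻¹ := by
  simp only [gammaDensity_mul_exp]
  rw [integral_const_mul, integral_pow_mul_exp_neg_mul_Ioi (k + 2) (by positivity)]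
  have h1 : s⁻¹ + l = s⁻¹ * (1 + l * s) := by field_simp
  have h2 : ((k + 2).factorial : ℝ) ≠ 0 := by positivity
  have h3 : 1 + l * s ≠ 0 := by positivity
  rw [h1, mul_pow]
  field_simp

/-- The gamma profile with rate `l` after time `s`, normalised to be `e^{-lq}` at time `0`. -/
noncomputable def evolvedExp (l s q : ℝ) : ℝ := (l⁻¹) ^ 3 * gammaProfile (l⁻¹ + s) q

/-- The exponential series. With `integral_gammaDensity_mul_exp`, it says that the kernel `∑ₖ
poissonWeight s k q · gammaDensity s k q'` sends `e^{-lq'}` to its evolution after time `s`. -/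
theorem hasSum_poissonWeight {s l : ℝ} (hs : 0 < s) (hl : 0 < l) (q : ℝ) :
    HasSum (fun k => poissonWeight s k q * ((1 + l * s) ^ (k + 3))⁻¹) (evolvedExp l s q) := by
  have h3 : 1 + l * s ≠ 0 := by positivity
  have h := (NormedSpace.expSeries_div_hasSum_exp (𝔸 := ℝ) (s⁻¹ * q * (1 + l * s)⁻¹))
  have h' := h.mul_left (((1 + l * s) ^ 3)⁻¹ * Real.exp (-(s⁻¹ * q)))
  rw [← Real.exp_eq_exp_ℝ] at h'
  have h1 : ∀ k : ℕ, poissonWeight s k q * ((1 + l * s) ^ (k + 3))⁻¹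
      = ((1 + l * s) ^ 3)⁻¹ * Real.exp (-(s⁻¹ * q)) *
        ((s⁻¹ * q * (1 + l * s)⁻¹) ^ k / k.factorial) := by
    intro k
    simp only [poissonWeight, pow_add, mul_inv, mul_pow, inv_pow]
    ring
  have h2 : evolvedExp l s q = ((1 + l * s) ^ 3)⁻¹ * Real.exp (-(s⁻¹ * q)) *
      Real.exp (s⁻¹ * q * (1 + l * s)⁻¹) := by
    have h4 : l⁻¹ + s = l⁻¹ * (1 + l * s) := by field_simp
    rw [evolvedExp, gammaProfile, mul_assoc, ← Real.exp_add, ← mul_assoc, h4]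
    congr 1
    · field_simp
    · congr 1
      field_simp
      ring
  simp only [h1, h2]
  exact h'

theorem lintegral_poissonWeight {s : ℝ} (hs : 0 < s) (k : ℕ) :
    ∫⁻ q in Ioi (0 : ℝ), ENNReal.ofReal (q ^ 2 * poissonWeight s k q)
      = ENNReal.ofReal (s ^ 3 * (k + 2).factorial / k.factorial) := by
  have h1 : ∀ q : ℝ, ENNReal.ofReal (q ^ 2 * poissonWeight s k q)
      = ENNReal.ofReal ((s⁻¹) ^ k / k.factorial) *
        ENNReal.ofReal (q ^ (k + 2) * Real.exp (-(s⁻¹ * q))) := by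
    intro q
    rw [← ENNReal.ofReal_mul (by positivity)]
    congr 1
    rw [poissonWeight]; ring
  simp only [h1]
  rw [lintegral_const_mul' _ _ ENNReal.ofReal_ne_top,
    lintegral_pow_mul_exp_neg_mul_Ioi (k + 2) (by positivity), ← ENNReal.ofReal_mul (by positivity)]
  congr 1
  simp only [inv_pow]
  field_simp
  ring

/-- Invariance of `q² dq`: the coefficients are the `q² dq`-masses of the Poisson weights, and mass
times gamma density is `q²` times the Poisson weight, whose sum over `k` is 1. -/
theorem tsum_gammaDensity {s : ℝ} (hs : 0 < s) {q : ℝ} (hq : 0 < q) :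
    ∑' k : ℕ, ENNReal.ofReal (s ^ 3 * (k + 2).factorial / k.factorial) *
      ENNReal.ofReal (gammaDensity s k q) = ENNReal.ofReal (q ^ 2) := by
  have h := (NormedSpace.expSeries_div_hasSum_exp (𝔸 := ℝ) (s⁻¹ * q)).mul_left
    (q ^ 2 * Real.exp (-(s⁻¹ * q)))
  rw [← Real.exp_eq_exp_ℝ, mul_assoc, ← Real.exp_add, neg_add_cancel, Real.exp_zero, mul_one] at h
  have h1 : ∀ k : ℕ, ENNReal.ofReal (s ^ 3 * (k + 2).factorial / k.factorial) *
      ENNReal.ofReal (gammaDensity s k q)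
      = ENNReal.ofReal (q ^ 2 * Real.exp (-(s⁻¹ * q)) * ((s⁻¹ * q) ^ k / k.factorial)) := by
    intro k
    rw [← ENNReal.ofReal_mul (by positivity)]
    congr 1
    have h2 : ((k + 2).factorial : ℝ) ≠ 0 := by positivity
    simp only [gammaDensity, mul_pow, inv_pow]
    field_simp
    ring
  simp only [h1]
  rw [← ENNReal.ofReal_tsum_of_nonneg (fun k => by positivity) h.summable, h.tsum_eq]

/-- The evolution of a finite combination of decaying exponentials contracts the norm of
`L¹(q² dq)`. -/
theorem lintegral_evolvedExp_le {ι : Type*} (S : Finset ι) (c l : ι → ℝ) (hl : ∀ i, 0 < l i)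
    {s : ℝ} (hs : 0 < s) :
    ∫⁻ q in Ioi (0 : ℝ), ENNReal.ofReal (q ^ 2) *
        ENNReal.ofReal |∑ i ∈ S, c i * evolvedExp (l i) s q|
      ≤ ∫⁻ q in Ioi (0 : ℝ), ENNReal.ofReal (q ^ 2) *
        ENNReal.ofReal |∑ i ∈ S, c i * Real.exp (-(l i * q))| := by
  set f : ℝ → ℝ := fun q => ∑ i ∈ S, c i * Real.exp (-(l i * q)) with hf
  have hfm : Measurable f := by
    rw [hf]; fun_prop
  -- The gamma averages of the initial profile; the evolved profile is their Poisson mixture.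
  set M : ℕ → ℝ := fun k => ∫ q in Ioi (0 : ℝ), gammaDensity s k q * f q with hM
  have hMeq : ∀ k, M k = ∑ i ∈ S, c i * ((1 + l i * s) ^ (k + 3))⁻¹ := by
    intro k
    have h1 : ∀ q, gammaDensity s k q * f q
        = ∑ i ∈ S, c i * (gammaDensity s k q * Real.exp (-(l i * q))) := by
      intro q
      rw [hf]; simp only
      rw [Finset.mul_sum]
      exact Finset.sum_congr rfl fun i _ => by ring
    simp only [hM, h1]
    rw [integral_finsetSum _ fun i _ =>
      (integrableOn_gammaDensity_mul_exp hs (hl i) k).const_mul (c i)]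
    refine Finset.sum_congr rfl fun i _ => ?_
    rw [integral_const_mul, integral_gammaDensity_mul_exp hs (hl i)]
  have hsum : ∀ q, HasSum (fun k => poissonWeight s k q * M k)
      (∑ i ∈ S, c i * evolvedExp (l i) s q) := by
    intro q
    have h1 := hasSum_sum (s := S) fun i _ => (hasSum_poissonWeight hs (hl i) q).mul_left (c i)
    have h2 : ∀ k, poissonWeight s k q * M k
        = ∑ i ∈ S, c i * (poissonWeight s k q * ((1 + l i * s) ^ (k + 3))⁻¹) := by
      intro k
      rw [hMeq, Finset.mul_sum]
      exact Finset.sum_congr rfl fun i _ => by ring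
    simpa only [h2] using h1
  have hMle : ∀ k, ENNReal.ofReal |M k|
      ≤ ∫⁻ q in Ioi (0 : ℝ), ENNReal.ofReal (gammaDensity s k q) * ENNReal.ofReal |f q| := by
    intro k
    rw [← Real.enorm_eq_ofReal_abs]
    refine (enorm_integral_le_lintegral_enorm _).trans (le_of_eq ?_)
    refine setLIntegral_congr_fun measurableSet_Ioi fun q hq => ?_
    have hq : (0 : ℝ) < q := hq
    rw [enorm_mul, Real.enorm_eq_ofReal_abs, Real.enorm_eq_ofReal_abs,
      abs_of_nonneg (gammaDensity_nonneg hs hq.le k)]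
  have hdm : ∀ k, Measurable (gammaDensity s k) := fun k => by unfold gammaDensity; fun_prop
  have hpm : ∀ k, Measurable (poissonWeight s k) := fun k => by unfold poissonWeight; fun_prop
  -- Triangle inequality in `k`, Tonelli to integrate the Poisson weights, triangle inequality for
  -- each average, and Tonelli again to reassemble `q²`.
  calc ∫⁻ q in Ioi (0 : ℝ), ENNReal.ofReal (q ^ 2) *
        ENNReal.ofReal |∑ i ∈ S, c i * evolvedExp (l i) s q|
      ≤ ∫⁻ q in Ioi (0 : ℝ), ∑' k, ENNReal.ofReal (q ^ 2 * poissonWeight s k q) *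
          ENNReal.ofReal |M k| := by
        refine setLIntegral_mono' measurableSet_Ioi fun q hq => ?_
        have hq : (0 : ℝ) < q := hq
        rw [← (hsum q).tsum_eq, ← Real.enorm_eq_ofReal_abs]
        refine (mul_le_mul_right (enorm_tsum_le_tsum_enorm) _).trans (le_of_eq ?_)
        rw [← ENNReal.tsum_mul_left]
        refine tsum_congr fun k => ?_
        rw [enorm_mul, Real.enorm_eq_ofReal_abs, Real.enorm_eq_ofReal_abs,
          abs_of_nonneg (poissonWeight_nonneg hs hq.le k), ENNReal.ofReal_mul (by positivity),
          mul_assoc]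
    _ = ∑' k, ENNReal.ofReal (s ^ 3 * (k + 2).factorial / k.factorial) *
          ENNReal.ofReal |M k| := by
        rw [lintegral_tsum fun k => by have := hpm k; fun_prop]
        refine tsum_congr fun k => ?_
        rw [lintegral_mul_const' _ _ ENNReal.ofReal_ne_top, lintegral_poissonWeight hs]
    _ ≤ ∑' k, ENNReal.ofReal (s ^ 3 * (k + 2).factorial / k.factorial) *
          ∫⁻ q in Ioi (0 : ℝ), ENNReal.ofReal (gammaDensity s k q) * ENNReal.ofReal |f q| :=
        ENNReal.tsum_le_tsum fun k => by gcongr; exact hMle k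
    _ = ∫⁻ q in Ioi (0 : ℝ), ∑' k, ENNReal.ofReal (s ^ 3 * (k + 2).factorial / k.factorial) *
          (ENNReal.ofReal (gammaDensity s k q) * ENNReal.ofReal |f q|) := by
        rw [lintegral_tsum fun k => by have := hdm k; fun_prop]
        exact tsum_congr fun k => (lintegral_const_mul' _ _ ENNReal.ofReal_ne_top).symm
    _ = _ := by
        refine setLIntegral_congr_fun measurableSet_Ioi fun q hq => ?_
        have hq : (0 : ℝ) < q := hq
        simp only [← mul_assoc]
        rw [ENNReal.tsum_mul_right, tsum_gammaDensity hs hq]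

/-! ### The evolution of a single exponential -/

theorem lintegral_gammaProfile {β : ℝ} (hβ : 0 < β) :
    ∫⁻ p : Momentum, ENNReal.ofReal (gammaProfile β ‖p‖)
      = ENNReal.ofReal 2 * sphereMeasure univ := by
  have hm : Measurable fun p : Momentum => ENNReal.ofReal (gammaProfile β ‖p‖) :=
    (measurable_gammaProfile.comp (measurable_const.prodMk measurable_norm)).ennreal_ofReal
  rw [lintegral_polar hm]
  have hray : ∀ w : Metric.sphere (0 : Momentum) 1,
      ∫⁻ q in Ioi (0 : ℝ), ENNReal.ofReal (q ^ 2) *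
        ENNReal.ofReal (gammaProfile β ‖q • (w : Momentum)‖) = ENNReal.ofReal 2 := by
    intro w
    have h1 : ∀ q ∈ Ioi (0 : ℝ), ENNReal.ofReal (q ^ 2) *
        ENNReal.ofReal (gammaProfile β ‖q • (w : Momentum)‖)
        = ENNReal.ofReal ((β ^ 3)⁻¹) * ENNReal.ofReal (q ^ 2 * Real.exp (-(β⁻¹ * q))) := by
      intro q hq
      rw [norm_smul_of_norm_eq_one hq (by simp), ← ENNReal.ofReal_mul (by positivity),
        ← ENNReal.ofReal_mul (by positivity), gammaProfile, div_eq_inv_mul]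
      congr 1; ring
    rw [setLIntegral_congr_fun measurableSet_Ioi h1,
      lintegral_const_mul' _ _ ENNReal.ofReal_ne_top,
      lintegral_pow_mul_exp_neg_mul_Ioi 2 (by positivity), ← ENNReal.ofReal_mul (by positivity)]
    congr 1
    simp only [inv_pow]
    field_simp
    norm_num [Nat.factorial, mul_comm]
  simp only [hray]
  rw [lintegral_const]

theorem lintegral_gammaProfile_eq_ofReal {β : ℝ} (hβ : 0 < β) :
    ∫⁻ p : Momentum, ENNReal.ofReal (gammaProfile β ‖p‖)
      = ENNReal.ofReal (2 * sphereMeasure.real univ) := by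
  rw [lintegral_gammaProfile hβ, ENNReal.ofReal_mul (by norm_num), Measure.real,
    ENNReal.ofReal_toReal (measure_ne_top _ _)]

/-- Half of the exponential absorbs the linear factor in `q`, the other half is the profile of scale
`2β`. The constant is 8 from `(2β)³` times 5. -/
theorem abs_gammaProfileOp_le_gammaProfile {β q : ℝ} (hβ : 0 < β) (hq : 0 ≤ q) :
    |gammaProfileOp β q| ≤ 40 * β⁻¹ * gammaProfile (2 * β) q := by
  have h1 := mul_gammaProfile_le (q := q) (β := 2 * β) (by positivity)
  have h2 := gammaProfile_nonneg (β := 2 * β) (by positivity) q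
  have hE : Real.exp (-(q / β)) = Real.exp (-(q / (2 * β))) * Real.exp (-(q / (2 * β))) := by
    rw [← Real.exp_add]; congr 1; field_simp; ring
  have hE1 : Real.exp (-(q / (2 * β))) ≤ 1 :=
    Real.exp_le_one_iff.2 (by have : 0 ≤ q / (2 * β) := by positivity
                              linarith)
  have hx : q / (2 * β) * Real.exp (-(q / (2 * β))) ≤ 1 := by
    have := Real.add_one_le_exp (q / (2 * β))
    rw [Real.exp_neg, ← div_eq_mul_inv, div_le_one (Real.exp_pos _)]
    linarith
  have hx0 : 0 ≤ q / (2 * β) := by positivity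
  have e : gammaProfileOp β q = 8 * β⁻¹ * gammaProfile (2 * β) q *
      (2 * (q / (2 * β) * Real.exp (-(q / (2 * β)))) - 3 * Real.exp (-(q / (2 * β)))) := by
    simp only [gammaProfileOp, gammaProfile, hE]
    field_simp
    ring
  have hb : |2 * (q / (2 * β) * Real.exp (-(q / (2 * β)))) - 3 * Real.exp (-(q / (2 * β)))| ≤ 5 := by
    have := mul_nonneg hx0 (Real.exp_pos (-(q / (2 * β)))).le
    have := (Real.exp_pos (-(q / (2 * β)))).le
    rw [abs_le]; constructor <;> linarith
  rw [e, abs_mul, abs_of_nonneg (by positivity : 0 ≤ 8 * β⁻¹ * gammaProfile (2 * β) q)]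
  calc 8 * β⁻¹ * gammaProfile (2 * β) q * _ ≤ 8 * β⁻¹ * gammaProfile (2 * β) q * 5 :=
        mul_le_mul_of_nonneg_left hb (by positivity)
    _ = _ := by ring

theorem integrable_angular_gammaProfile (m : Option (Fin 3) →₀ ℕ) {β : ℝ} (hβ : 0 < β) :
    Integrable fun p => angularMonomial m (direction p) * gammaProfile β ‖p‖ := by
  have hm : Measurable fun p : Momentum => gammaProfile β ‖p‖ :=
    measurable_gammaProfile.comp (measurable_const.prodMk measurable_norm)
  refine Integrable.bdd_mul (c := 1) ⟨hm.aestronglyMeasurable, ?_⟩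
    (measurable_angularMonomial_direction m).aestronglyMeasurable
    (Eventually.of_forall fun p => abs_angularMonomial_le m p)
  simp only [HasFiniteIntegral, Real.enorm_eq_ofReal_abs, abs_of_nonneg (gammaProfile_nonneg hβ _)]
  rw [lintegral_gammaProfile_eq_ofReal hβ]
  exact ENNReal.ofReal_lt_top

/-- Green's formula along a ray. -/
theorem integral_ray_green {v v₁ v₂ g g₁ g₂ : ℝ → ℝ} (hv : ∀ q, HasDerivAt v (v₁ q) q)
    (hv₁ : ∀ q, HasDerivAt v₁ (v₂ q) q) (hv₂ : Continuous v₂)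
    (hg : ∀ q, HasDerivAt g (g₁ q) q) (hg₁ : ∀ q, HasDerivAt g₁ (g₂ q) q) (hg₂ : Continuous g₂)
    (hc : HasCompactSupport g) :
    ∫ q in Ioi (0 : ℝ), q ^ 2 * (v q * (q * g₂ q + 3 * g₁ q) - (q * v₂ q + 3 * v₁ q) * g q) = 0 := by
  -- The Wronskian with the Sturm–Liouville weight: its derivative is the integrand. The factor `q³`
  -- removes the boundary term at the origin, so the test function is free there.
  set f : ℝ → ℝ := fun q => q ^ 3 * (v q * g₁ q - v₁ q * g q) with hf
  have hgc : HasCompactSupport g₁ := by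
    rw [show g₁ = deriv g from funext fun q => (hg q).deriv.symm]; exact hc.deriv
  have hd : ∀ q, HasDerivAt f
      (q ^ 2 * (v q * (q * g₂ q + 3 * g₁ q) - (q * v₂ q + 3 * v₁ q) * g q)) q := by
    intro q
    have := (hasDerivAt_pow 3 q).fun_mul
      (((hv q).fun_mul (hg₁ q)).fun_sub ((hv₁ q).fun_mul (hg q)))
    refine this.congr_deriv ?_
    simp only [Nat.cast_ofNat, Nat.add_one_sub_one]
    ring
  have cv : Continuous v := continuous_iff_continuousAt.2 fun q => (hv q).continuousAt
  have cv₁ : Continuous v₁ := continuous_iff_continuousAt.2 fun q => (hv₁ q).continuousAt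
  have cg : Continuous g := continuous_iff_continuousAt.2 fun q => (hg q).continuousAt
  have cg₁ : Continuous g₁ := continuous_iff_continuousAt.2 fun q => (hg₁ q).continuousAt
  have hder : deriv f = fun q =>
      q ^ 2 * (v q * (q * g₂ q + 3 * g₁ q) - (q * v₂ q + 3 * v₁ q) * g q) :=
    funext fun q => (hd q).deriv
  have hfs : HasCompactSupport f := by
    have h1 : HasCompactSupport fun q => v q * g₁ q - v₁ q * g q :=
      hgc.mul_left.sub hc.mul_left
    exact h1.mul_left
  have hC1 : ContDiff ℝ 1 f := by
    rw [contDiff_one_iff_deriv]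
    refine ⟨fun q => (hd q).differentiableAt, ?_⟩
    rw [hder]; fun_prop
  have h := hfs.integral_Ioi_deriv_eq hC1 0
  rw [hder] at h
  rw [h]
  simp [hf]

theorem integral_green (m : Option (Fin 3) →₀ ℕ) (β : ℝ)
    {Ψ : ℝ × ℝ × Momentum → ℝ} (hΨ : ContDiff ℝ ∞ Ψ) (hc : HasCompactSupport Ψ) (t : ℝ) :
    ∫ p, angularMonomial m (direction p) *
      (gammaProfile β ‖p‖ * radialOperator Ψ (spherical (t, p))
        - gammaProfileOp β ‖p‖ * Ψ (spherical (t, p))) = 0 := by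
  refine integral_eq_zero_of_rays fun w hw => ?_
  have h1 := contDiff_radDeriv hΨ
  have h2 := contDiff_radDeriv h1
  have hg₂ : Continuous fun q : ℝ => radDeriv (radDeriv Ψ) (t, q, w) :=
    h2.continuous.comp (by fun_prop)
  have hgc : HasCompactSupport fun q : ℝ => Ψ (t, q, w) := by
    refine HasCompactSupport.intro (hc.isCompact.image (continuous_fst.comp continuous_snd))
      fun q hq => ?_
    by_contra hne
    exact hq ⟨(t, q, w), subset_tsupport _ hne, rfl⟩
  have hgreen := integral_ray_green (hasDerivAt_gammaProfile_right β)
    (fun q => (hasDerivAt_gammaProfile_right β q).const_mul (-β⁻¹))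
    (by
      have : Continuous (gammaProfile β) := by unfold gammaProfile; fun_prop
      fun_prop)
    (fun q => hasDerivAt_radDeriv hΨ t q w) (fun q => hasDerivAt_radDeriv h1 t q w) hg₂ hgc
  refine Eq.trans ?_ ((congrArg (angularMonomial m w * ·) hgreen).trans (mul_zero _))
  rw [← integral_const_mul]
  refine setIntegral_congr_fun measurableSet_Ioi fun q hq => ?_
  simp only [spherical, direction_smul_of_norm_eq_one hq hw, norm_smul_of_norm_eq_one hq hw,
    radialOperator, gammaProfileOp]
  ring

/-- Used to compose the merely absolutely continuous scale `μ + τ(t)` with `b ↦ V(b, q)`, which is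
Lipschitz on `[μ, ∞)`. -/
theorem AbsolutelyContinuousOnInterval.lipschitz_comp {f g : ℝ → ℝ} {a b : ℝ} {K : NNReal}
    {s : Set ℝ} (hg : AbsolutelyContinuousOnInterval g a b) (hf : LipschitzOnWith K f s)
    (hs : MapsTo g (uIcc a b) s) : AbsolutelyContinuousOnInterval (fun t => f (g t)) a b := by
  rw [absolutelyContinuousOnInterval_iff] at hg ⊢
  intro ε hε
  obtain ⟨δ, hδ, h⟩ := hg (ε / (K + 1)) (by positivity)
  refine ⟨δ, hδ, fun E hE hEδ => ?_⟩
  have h1 := h E hE hEδ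
  have hmem := hE.1
  calc ∑ i ∈ Finset.range E.1, dist (f (g (E.2 i).1)) (f (g (E.2 i).2))
      ≤ ∑ i ∈ Finset.range E.1, K * dist (g (E.2 i).1) (g (E.2 i).2) :=
        Finset.sum_le_sum fun i hi =>
          hf.dist_le_mul _ (hs (hmem i hi).1) _ (hs (hmem i hi).2)
    _ = K * ∑ i ∈ Finset.range E.1, dist (g (E.2 i).1) (g (E.2 i).2) := (Finset.mul_sum ..).symm
    _ ≤ K * (ε / (K + 1)) := mul_le_mul_of_nonneg_left h1.le K.2
    _ < (K + 1) * (ε / (K + 1)) := mul_lt_mul_of_pos_right (by linarith) (by positivity)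
    _ = ε := by field_simp

theorem primitive_nonneg {a : ℝ → ℝ} (ha0 : ∀ t, 0 ≤ a t) {t : ℝ} (ht : 0 ≤ t) :
    0 ≤ ∫ s in (0 : ℝ)..t, a s :=
  intervalIntegral.integral_nonneg ht fun s _ => ha0 s

/-- The weak time derivative of a gamma profile whose scale grows with speed `a`. -/
theorem integral_time_gammaProfile {a : ℝ → ℝ}
    (ha : ∀ T : ℝ, 0 < T → IntegrableOn a (Ioc 0 T)) (ha0 : ∀ t, 0 ≤ a t) {μ q : ℝ} (hμ : 0 < μ)
    (hq : 0 ≤ q) {Ψ : ℝ × ℝ × Momentum → ℝ} (hΨ : ContDiff ℝ ∞ Ψ) (hc : HasCompactSupport Ψ)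
    (w : Momentum) :
    ∫ t in Ioi (0 : ℝ), (gammaProfile (μ + ∫ s in (0 : ℝ)..t, a s) q * timeDeriv Ψ (t, q, w)
      + a t * (gammaProfileOp (μ + ∫ s in (0 : ℝ)..t, a s) q * Ψ (t, q, w)))
      = -(gammaProfile μ q * Ψ (0, q, w)) := by
  obtain ⟨M, T, -, hT, hb⟩ := exists_indicator_bound hΨ.continuous hc
  obtain ⟨M', T', -, hT', hb'⟩ := exists_indicator_bound (contDiff_timeDeriv hΨ).continuous
    (hasCompactSupport_timeDeriv hc)
  set S := max T T' + 1 with hS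
  have hS0 : 0 < S := by positivity
  have hz : ∀ t, S ≤ t → Ψ (t, q, w) = 0 := by
    intro t ht
    have h1 := hb (t, q, w)
    rw [indicator_of_notMem (fun h => by linarith [h.2, le_max_left T T'])] at h1
    exact abs_nonpos_iff.1 h1
  have hz' : ∀ t, S ≤ t → timeDeriv Ψ (t, q, w) = 0 := by
    intro t ht
    have h1 := hb' (t, q, w)
    rw [indicator_of_notMem (fun h => by linarith [h.2, le_max_right T T'])] at h1
    exact abs_nonpos_iff.1 h1
  have haI := intervalIntegrable_of_integrableOn ha hS0.le
  set β : ℝ → ℝ := fun t => μ + ∫ s in (0 : ℝ)..t, a s with hβ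
  have hβac : AbsolutelyContinuousOnInterval β 0 S := by
    have h1 : AbsolutelyContinuousOnInterval (fun _ : ℝ => μ) 0 S :=
      (contDiff_const (c := μ)).contDiffOn.absolutelyContinuousOnInterval
    exact h1.add (haI.absolutelyContinuousOnInterval_intervalIntegral left_mem_uIcc)
  have hmaps : MapsTo β (uIcc 0 S) (Ici μ) := by
    intro t ht
    rw [uIcc_of_le hS0.le] at ht
    have := primitive_nonneg ha0 ht.1
    simp only [hβ, mem_Ici]; linarith
  have hlip : LipschitzOnWith (Real.toNNReal (4 * (μ ^ 4)⁻¹)) (fun b => gammaProfile b q)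
      (Ici μ) := by
    refine (convex_Ici μ).lipschitzOnWith_of_nnnorm_hasDerivWithin_le
      (fun b hb => (hasDerivAt_gammaProfile_left (hμ.trans_le hb) q).hasDerivWithinAt) ?_
    intro b hb
    rw [← NNReal.coe_le_coe, coe_nnnorm, Real.norm_eq_abs, Real.coe_toNNReal _ (by positivity)]
    exact (abs_gammaProfileOp_le (hμ.trans_le hb) hq).trans
      (mul_le_mul_of_nonneg_left (inv_pow_le_of_le hμ hb 4) (by norm_num))
  have hVac := hβac.lipschitz_comp hlip hmaps
  have hΨac : AbsolutelyContinuousOnInterval (fun t => Ψ (t, q, w)) 0 S := by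
    have : ContDiff ℝ 1 fun t : ℝ => Ψ (t, q, w) := (hΨ.of_le (by simp)).comp (by fun_prop)
    exact this.contDiffOn.absolutelyContinuousOnInterval
  -- Integration by parts for absolutely continuous functions; `Ψ` vanishes at `S`, so only the
  -- boundary term at `t = 0` remains.
  have hkey := hVac.integral_deriv_mul_eq_sub hΨac
  rw [hz S le_rfl, mul_zero, zero_sub] at hkey
  have hβ0 : β 0 = μ := by simp [hβ]
  rw [hβ0] at hkey
  rw [← hkey]
  have hres : ∫ t in Ioi (0 : ℝ), (gammaProfile (β t) q * timeDeriv Ψ (t, q, w)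
      + a t * (gammaProfileOp (β t) q * Ψ (t, q, w)))
      = ∫ t in Ioc 0 S, (gammaProfile (β t) q * timeDeriv Ψ (t, q, w)
      + a t * (gammaProfileOp (β t) q * Ψ (t, q, w))) := by
    refine setIntegral_eq_of_subset_of_forall_sdiff_eq_zero measurableSet_Ioi
      Ioc_subset_Ioi_self fun t ht => ?_
    have h1 : S ≤ t := by
      by_contra hlt
      exact ht.2 ⟨ht.1, (not_le.1 hlt).le⟩
    rw [hz t h1, hz' t h1]; ring
  refine hres.trans ?_
  rw [← intervalIntegral.integral_of_le hS0.le]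
  refine intervalIntegral.integral_congr_ae ?_
  filter_upwards [haI.ae_hasDerivAt_integral] with t ht htm
  have htm' : t ∈ uIcc 0 S := uIoc_subset_uIcc htm
  have h1 : HasDerivAt β (a t) t := (ht htm' 0 left_mem_uIcc).const_add μ
  have hpos : 0 < β t := hμ.trans_le (hmaps htm')
  have h2 := (hasDerivAt_gammaProfile_left hpos q).comp t h1
  have h3 : deriv (fun t => gammaProfile (β t) q) t = gammaProfileOp (β t) q * a t := h2.deriv
  rw [h3, (hasDerivAt_timeDeriv hΨ t q w).deriv]
  ring

theorem aemeasurable_scaled_coords {a : ℝ → ℝ}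
    (ha : ∀ T : ℝ, 0 < T → IntegrableOn a (Ioc 0 T)) (μ : ℝ) :
    AEMeasurable (fun z : ℝ × Momentum => (μ + ∫ s in (0 : ℝ)..z.1, a s, ‖z.2‖))
      timeMomentumMeasure := by
  have hτm : AEStronglyMeasurable (fun t => ∫ s in (0 : ℝ)..t, a s) (volume.restrict (Ioi 0)) :=
    ((continuousOn_primitive_Ici ha).mono Ioi_subset_Ici_self).aestronglyMeasurable
      measurableSet_Ioi
  exact ((aestronglyMeasurable_comp_fst hτm).aemeasurable.const_add μ).prodMk
    measurable_snd.norm.aemeasurable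

theorem memLinftyL1_angular_gammaProfile {a : ℝ → ℝ}
    (ha : ∀ T : ℝ, 0 < T → IntegrableOn a (Ioc 0 T)) (ha0 : ∀ t, 0 ≤ a t)
    (m : Option (Fin 3) →₀ ℕ) {μ : ℝ} (hμ : 0 < μ) :
    MemLinftyL1 fun t p => angularMonomial m (direction p) *
      gammaProfile (μ + ∫ s in (0 : ℝ)..t, a s) ‖p‖ := by
  refine ⟨?_, 2 * sphereMeasure.real univ, ?_⟩
  · exact ((measurable_angularMonomial_direction m).comp measurable_snd).aestronglyMeasurable.mul
      (measurable_gammaProfile.comp_aemeasurable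
        (aemeasurable_scaled_coords ha μ)).aestronglyMeasurable
  · filter_upwards [ae_restrict_mem measurableSet_Ioi] with t ht
    have hp : 0 < μ + ∫ s in (0 : ℝ)..t, a s :=
      add_pos_of_pos_of_nonneg hμ (primitive_nonneg ha0 (le_of_lt ht))
    rw [← lintegral_gammaProfile_eq_ofReal hp]
    refine lintegral_mono fun p => ENNReal.ofReal_le_ofReal ?_
    rw [abs_mul, abs_of_nonneg (gammaProfile_nonneg hp _)]
    exact mul_le_of_le_one_left (gammaProfile_nonneg hp _) (abs_angularMonomial_le m p)

theorem memLinftyL1_angular_gammaProfileOp {a : ℝ → ℝ}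
    (ha : ∀ T : ℝ, 0 < T → IntegrableOn a (Ioc 0 T)) (ha0 : ∀ t, 0 ≤ a t)
    (m : Option (Fin 3) →₀ ℕ) {μ : ℝ} (hμ : 0 < μ) :
    MemLinftyL1 fun t p => angularMonomial m (direction p) *
      gammaProfileOp (μ + ∫ s in (0 : ℝ)..t, a s) ‖p‖ := by
  refine ⟨?_, 40 * μ⁻¹ * (2 * sphereMeasure.real univ), ?_⟩
  · exact ((measurable_angularMonomial_direction m).comp measurable_snd).aestronglyMeasurable.mul
      (measurable_gammaProfileOp.comp_aemeasurable
        (aemeasurable_scaled_coords ha μ)).aestronglyMeasurable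
  · filter_upwards [ae_restrict_mem measurableSet_Ioi] with t ht
    have hτ := primitive_nonneg ha0 (le_of_lt (show 0 < t from ht))
    have hp : 0 < μ + ∫ s in (0 : ℝ)..t, a s := add_pos_of_pos_of_nonneg hμ hτ
    rw [ENNReal.ofReal_mul (by positivity),
      ← lintegral_gammaProfile_eq_ofReal (β := 2 * (μ + ∫ s in (0 : ℝ)..t, a s)) (by positivity),
      ← lintegral_const_mul' _ _ ENNReal.ofReal_ne_top]
    refine lintegral_mono fun p => ?_
    rw [← ENNReal.ofReal_mul (by positivity)]
    refine ENNReal.ofReal_le_ofReal ?_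
    rw [abs_mul]
    refine (mul_le_of_le_one_left (abs_nonneg _) (abs_angularMonomial_le m p)).trans ?_
    refine (abs_gammaProfileOp_le_gammaProfile hp (norm_nonneg p)).trans ?_
    have hV := gammaProfile_nonneg (β := 2 * (μ + ∫ s in (0 : ℝ)..t, a s)) (by positivity) ‖p‖
    gcongr
    linarith

/-- Green's formula moves the radial operator onto the profile at fixed time. After Fubini,
integration by parts in time at fixed momentum cancels it against the derivative of the scale and
leaves the datum. -/
theorem isSolution_angular_gammaProfile {a : ℝ → ℝ}
    (ha : ∀ T : ℝ, 0 < T → IntegrableOn a (Ioc 0 T)) (ha0 : ∀ t, 0 ≤ a t)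
    (m : Option (Fin 3) →₀ ℕ) {μ : ℝ} (hμ : 0 < μ) :
    IsSolution a (fun p => angularMonomial m (direction p) * gammaProfile μ ‖p‖)
      fun t p => angularMonomial m (direction p) *
        gammaProfile (μ + ∫ s in (0 : ℝ)..t, a s) ‖p‖ := by
  rw [isSolution_iff]
  have hV := memLinftyL1_angular_gammaProfile ha ha0 m hμ
  have hVop := memLinftyL1_angular_gammaProfileOp ha ha0 m hμ
  refine ⟨hV, fun Ψ hΨ hc => ?_⟩
  set β : ℝ → ℝ := fun t => μ + ∫ s in (0 : ℝ)..t, a s with hβ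
  have hzero : HasCompactSupport (0 : ℝ × ℝ × Momentum → ℝ) := HasCompactSupport.zero
  -- The two halves of the integrand are paired with different functions, the profile and its image
  -- under `L`, so each needs its own weight.
  obtain ⟨hm1, b1, hbi1, hb1⟩ := exists_weight ha (contDiff_timeDeriv hΨ).continuous
    (hasCompactSupport_timeDeriv hc) continuous_zero hzero
  obtain ⟨hm2, b2, hbi2, hb2⟩ := exists_weight ha continuous_zero hzero hΨ.continuous hc
  simp only [Pi.zero_apply, mul_zero, add_zero, zero_add] at hm1 hb1 hm2 hb2
  have hi1 := integrable_pairing hV hm1 hbi1 (Eventually.of_forall hb1)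
  have hi2 := integrable_pairing hVop hm2 hbi2 (Eventually.of_forall hb2)
  have hi := hi1.add hi2
  have hslice : ∀ t ∈ Ioi (0 : ℝ), ∫ p, angularMonomial m (direction p) * gammaProfile (β t) ‖p‖ *
        (timeDeriv Ψ (spherical (t, p)) + a t * radialOperator Ψ (spherical (t, p)))
      = ∫ p, (angularMonomial m (direction p) * gammaProfile (β t) ‖p‖ *
          timeDeriv Ψ (spherical (t, p)) + angularMonomial m (direction p) *
          gammaProfileOp (β t) ‖p‖ * (a t * Ψ (spherical (t, p)))) := by
    intro t ht
    have hp : 0 < β t :=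
      add_pos_of_pos_of_nonneg hμ (primitive_nonneg ha0 (le_of_lt ht))
    have hint := integrable_angular_gammaProfile m hp
    have j1 := integrable_datum hint (contDiff_timeDeriv hΨ) (hasCompactSupport_timeDeriv hc) t
    have j2 := (integrable_datum hint (contDiff_radialOperator hΨ)
      (hasCompactSupport_radialOperator hc) t).const_mul (a t)
    have hVopi : Integrable fun p => angularMonomial m (direction p) * gammaProfileOp (β t) ‖p‖ := by
      have h2 : Integrable fun p : Momentum => gammaProfile (2 * β t) ‖p‖ := by
        have := integrable_angular_gammaProfile 0 (β := 2 * β t) (by positivity)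
        simpa [angularMonomial] using this
      refine (h2.const_mul (40 * (β t)⁻¹)).mono' ?_ (Eventually.of_forall fun p => ?_)
      · exact ((measurable_angularMonomial_direction m).mul (measurable_gammaProfileOp.comp
          (measurable_const.prodMk measurable_norm))).aestronglyMeasurable
      · rw [Real.norm_eq_abs, abs_mul]
        exact (mul_le_of_le_one_left (abs_nonneg _) (abs_angularMonomial_le m p)).trans
          (abs_gammaProfileOp_le_gammaProfile hp (norm_nonneg p))
    have j3 := (integrable_datum hVopi hΨ hc t).const_mul (a t)
    have hg := integral_green m (β t) hΨ hc t
    rw [← sub_eq_zero, ← integral_sub]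
    · rw [← mul_zero (a t), ← hg, ← integral_const_mul]
      refine integral_congr_ae (Eventually.of_forall fun p => ?_)
      simp only
      ring
    · refine (j1.add j2).congr (Eventually.of_forall fun p => ?_)
      simp only [Pi.add_apply]; ring
    · refine (j1.add j3).congr (Eventually.of_forall fun p => ?_)
      simp only [Pi.add_apply]; ring
  have hiter : (∫ t in Ioi (0 : ℝ), ∫ p, (angularMonomial m (direction p) *
        gammaProfile (β t) ‖p‖ * timeDeriv Ψ (spherical (t, p)) + angularMonomial m (direction p) *
          gammaProfileOp (β t) ‖p‖ * (a t * Ψ (spherical (t, p)))))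
      = ∫ p, ∫ t in Ioi (0 : ℝ), (angularMonomial m (direction p) *
        gammaProfile (β t) ‖p‖ * timeDeriv Ψ (spherical (t, p)) + angularMonomial m (direction p) *
          gammaProfileOp (β t) ‖p‖ * (a t * Ψ (spherical (t, p)))) := by
    rw [timeMomentumMeasure] at hi
    exact integral_integral_swap hi
  rw [setIntegral_congr_fun measurableSet_Ioi hslice, hiter]
  have hinner : ∀ p : Momentum, ∫ t in Ioi (0 : ℝ), (angularMonomial m (direction p) *
        gammaProfile (β t) ‖p‖ * timeDeriv Ψ (spherical (t, p)) + angularMonomial m (direction p) *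
          gammaProfileOp (β t) ‖p‖ * (a t * Ψ (spherical (t, p))))
      = -(angularMonomial m (direction p) * gammaProfile μ ‖p‖ * Ψ (spherical (0, p))) := by
    intro p
    have h1 := integral_time_gammaProfile ha ha0 hμ (norm_nonneg p) hΨ hc (direction p)
    have h2 := congrArg (angularMonomial m (direction p) * ·) h1
    simp only [← integral_const_mul] at h2
    rw [mul_assoc, ← mul_neg]
    refine Eq.trans ?_ h2
    refine integral_congr_ae (Eventually.of_forall fun t => ?_)
    simp only [spherical, hβ]
    ring
  simp only [hinner]
  rw [integral_neg, neg_add_cancel]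

/-! ### Finite combinations -/

theorem isSolution_finsetSum {a : ℝ → ℝ} (ha : ∀ T : ℝ, 0 < T → IntegrableOn a (Ioc 0 T))
    {ι : Type*} (S : Finset ι) (c : ι → ℝ) {f : ι → Momentum → ℝ} {h : ι → ℝ → Momentum → ℝ}
    (hf : ∀ i, Integrable (f i)) (hh : ∀ i, IsSolution a (f i) (h i))
    (hmem : MemLinftyL1 fun t p => ∑ i ∈ S, c i * h i t p) :
    IsSolution a (fun p => ∑ i ∈ S, c i * f i p) fun t p => ∑ i ∈ S, c i * h i t p := by
  simp only [isSolution_iff_integral ha] at hh ⊢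
  refine ⟨hmem, fun Ψ hΨ hc => ?_⟩
  simp only [Finset.sum_mul, mul_assoc]
  rw [integral_finsetSum _ fun i _ =>
      (integrable_weakIntegrand ha (hh i).1 hΨ hc).const_mul (c i),
    integral_finsetSum _ fun i _ => (integrable_datum (hf i) hΨ hc 0).const_mul (c i),
    ← Finset.sum_add_distrib]
  refine Finset.sum_eq_zero fun i _ => ?_
  rw [integral_const_mul, integral_const_mul, ← mul_add, (hh i).2 Ψ hΨ hc, mul_zero]

/-- The evolution of `expPoly P` after the time `s`. -/
noncomputable def expFlow (P : MvPolynomial (Option (Fin 3)) ℝ) (s : ℝ) (p : Momentum) : ℝ :=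
  ∑ m ∈ P.support, P.coeff m *
    (angularMonomial m (direction p) * evolvedExp (decayRate m) s ‖p‖)

theorem evolvedExp_zero {l : ℝ} (hl : 0 < l) (q : ℝ) : evolvedExp l 0 q = Real.exp (-(l * q)) := by
  rw [evolvedExp, gammaProfile, add_zero, div_inv_eq_mul, mul_comm q]
  field_simp

theorem expFlow_zero (P : MvPolynomial (Option (Fin 3)) ℝ) (p : Momentum) :
    expFlow P 0 p = expPoly P p := by
  simp only [expFlow, expPoly_eq_sum, evolvedExp_zero (decayRate_pos _)]

theorem measurable_expFlow (P : MvPolynomial (Option (Fin 3)) ℝ) (s : ℝ) :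
    Measurable (expFlow P s) := by
  unfold expFlow evolvedExp
  refine Finset.measurable_sum _ fun m _ => Measurable.const_mul ?_ _
  exact (measurable_angularMonomial_direction m).mul (Measurable.const_mul
    (measurable_gammaProfile.comp (measurable_const.prodMk measurable_norm)) _)

theorem measurable_expPoly (P : MvPolynomial (Option (Fin 3)) ℝ) : Measurable (expPoly P) := by
  have := measurable_expFlow P 0
  rwa [show expFlow P 0 = expPoly P from funext (expFlow_zero P)] at this

theorem integrable_expPoly (P : MvPolynomial (Option (Fin 3)) ℝ) : Integrable (expPoly P) := by
  rw [show expPoly P = expFlow P 0 from funext fun p => (expFlow_zero P p).symm]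
  unfold expFlow evolvedExp
  refine integrable_finsetSum _ fun m _ => Integrable.const_mul ?_ _
  have h := (integrable_angular_gammaProfile m (β := (decayRate m)⁻¹ + 0)
    (by have := decayRate_pos m; positivity)).const_mul ((decayRate m)⁻¹ ^ 3)
  refine h.congr (Eventually.of_forall fun p => ?_)
  simp only
  ring

/-- For a fixed direction the flow is a finite sum of evolved exponentials, so the contraction
applies on each ray. The bound does not depend on the number of terms, which the passage to general
data requires. -/
theorem lintegral_expFlow_le (P : MvPolynomial (Option (Fin 3)) ℝ) {s : ℝ} (hs : 0 ≤ s) :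
    ∫⁻ p, ENNReal.ofReal |expFlow P s p| ≤ ENNReal.ofReal (∫ p, |expPoly P p|) := by
  rw [ofReal_integral_eq_lintegral_ofReal (integrable_expPoly P).abs
    (Eventually.of_forall fun _ => abs_nonneg _)]
  rcases hs.eq_or_lt with rfl | hs
  · simp only [expFlow_zero, le_refl]
  · refine lintegral_mono_of_rays (measurable_expFlow P s).abs.ennreal_ofReal
      (measurable_expPoly P).abs.ennreal_ofReal fun w hw => ?_
    have h := lintegral_evolvedExp_le P.support (fun m => P.coeff m * angularMonomial m w)
      decayRate decayRate_pos hs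
    refine le_of_eq_of_le ?_ (h.trans_eq ?_)
    · refine setLIntegral_congr_fun measurableSet_Ioi fun q hq => ?_
      simp only [expFlow, direction_smul_of_norm_eq_one hq hw, norm_smul_of_norm_eq_one hq hw,
        mul_assoc]
    · refine setLIntegral_congr_fun measurableSet_Ioi fun q hq => ?_
      simp only [expPoly_eq_sum, direction_smul_of_norm_eq_one hq hw,
        norm_smul_of_norm_eq_one hq hw, mul_assoc]

theorem isSolution_expFlow {a : ℝ → ℝ}
    (ha : ∀ T : ℝ, 0 < T → IntegrableOn a (Ioc 0 T)) (ha0 : ∀ t, 0 ≤ a t)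
    (P : MvPolynomial (Option (Fin 3)) ℝ) :
    IsSolution a (expPoly P) fun t p => expFlow P (∫ s in (0 : ℝ)..t, a s) p := by
  have hpos : ∀ m : Option (Fin 3) →₀ ℕ, 0 < (decayRate m)⁻¹ := fun m => inv_pos.2 (decayRate_pos m)
  have hflow : ∀ s p, expFlow P s p = ∑ m ∈ P.support, (P.coeff m * (decayRate m)⁻¹ ^ 3) *
      (angularMonomial m (direction p) * gammaProfile ((decayRate m)⁻¹ + s) ‖p‖) := by
    intro s p
    simp only [expFlow, evolvedExp]
    exact Finset.sum_congr rfl fun m _ => by ring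
  have hpoly : expPoly P = fun p => ∑ m ∈ P.support, (P.coeff m * (decayRate m)⁻¹ ^ 3) *
      (angularMonomial m (direction p) * gammaProfile (decayRate m)⁻¹ ‖p‖) := by
    ext p
    rw [← expFlow_zero, hflow]
    simp only [add_zero]
  simp only [hflow, hpoly]
  refine isSolution_finsetSum ha P.support _
    (fun m => integrable_angular_gammaProfile m (hpos m))
    (fun m => isSolution_angular_gammaProfile ha ha0 m (hpos m)) ?_
  refine ⟨?_, ∫ p, |expPoly P p|, ?_⟩
  · refine Finset.aestronglyMeasurable_fun_sum _ fun m _ => ?_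
    exact (memLinftyL1_angular_gammaProfile ha ha0 m (hpos m)).1.const_mul _
  · filter_upwards [ae_restrict_mem measurableSet_Ioi] with t ht
    simp only [← hflow]
    exact lintegral_expFlow_le P (primitive_nonneg ha0 (le_of_lt ht))

/-! ### Series of solutions -/

/-- A bound in `L^∞_t L¹_p` is not integrable over infinite time. The weight `e^{-t}` makes the sum
of the norms finite, and it is divided out pointwise afterwards. -/
theorem ae_summable_of_summable_bound {h : ℕ → ℝ → Momentum → ℝ}
    (hm : ∀ n, AEStronglyMeasurable (fun z : ℝ × Momentum => h n z.1 z.2) timeMomentumMeasure)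
    {B : ℕ → ℝ} (hB0 : ∀ n, 0 ≤ B n) (hBs : Summable B)
    (hB : ∀ n, ∀ᵐ t ∂(volume.restrict (Ioi (0 : ℝ))),
      ∫⁻ p, ENNReal.ofReal |h n t p| ≤ ENNReal.ofReal (B n)) :
    ∀ᵐ z ∂timeMomentumMeasure, Summable fun n => h n z.1 z.2 := by
  have hexp : IntegrableOn (fun t : ℝ => Real.exp (-t)) (Ioi 0) := integrableOn_exp_neg_Ioi 0
  have hem : AEStronglyMeasurable (fun z : ℝ × Momentum => Real.exp (-z.1)) timeMomentumMeasure :=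
    (by fun_prop : Measurable fun z : ℝ × Momentum => Real.exp (-z.1)).aestronglyMeasurable
  have hle : ∀ n, ∫⁻ z, ‖h n z.1 z.2 * Real.exp (-z.1)‖ₑ ∂timeMomentumMeasure
      ≤ ENNReal.ofReal (B n) * ∫⁻ t in Ioi (0 : ℝ), ENNReal.ofReal (Real.exp (-t)) := fun n =>
    lintegral_pairing_le (hm n) (hB n) hem
      (Eventually.of_forall fun t p => (abs_of_pos (Real.exp_pos _)).le)
  have hmeas : ∀ n, AEMeasurable (fun z : ℝ × Momentum => ‖h n z.1 z.2 * Real.exp (-z.1)‖ₑ)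
      timeMomentumMeasure := fun n => ((hm n).mul hem).enorm
  have hfin : ∫⁻ z, ∑' n, ‖h n z.1 z.2 * Real.exp (-z.1)‖ₑ ∂timeMomentumMeasure ≠ ⊤ := by
    rw [lintegral_tsum hmeas]
    refine ne_top_of_le_ne_top ?_ (ENNReal.tsum_le_tsum hle)
    rw [ENNReal.tsum_mul_right]
    refine ENNReal.mul_ne_top ?_ hexp.lintegral_lt_top.ne
    rw [← ENNReal.ofReal_tsum_of_nonneg hB0 hBs]
    exact ENNReal.ofReal_ne_top
  filter_upwards [ae_lt_top' (AEMeasurable.tsum hmeas) hfin] with z hz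
  have h1 : Summable fun n => h n z.1 z.2 * Real.exp (-z.1) := by
    refine Summable.of_norm ?_
    have := ENNReal.summable_toReal hz.ne
    simpa using this
  have h2 := h1.mul_right (Real.exp z.1)
  refine h2.congr fun n => ?_
  rw [mul_assoc, ← Real.exp_add, neg_add_cancel, Real.exp_zero, mul_one]

/-- The summable bounds allow exchanging the series with the pairing, and `L¹` convergence of the
partial data handles the initial term. -/
theorem isSolution_tsum {a : ℝ → ℝ} (ha : ∀ T : ℝ, 0 < T → IntegrableOn a (Ioc 0 T))
    {f : ℕ → Momentum → ℝ} {h : ℕ → ℝ → Momentum → ℝ} (hf : ∀ n, Integrable (f n))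
    (hh : ∀ n, IsSolution a (f n) (h n)) {B : ℕ → ℝ} (hB0 : ∀ n, 0 ≤ B n) (hBs : Summable B)
    (hB : ∀ n, ∀ᵐ t ∂(volume.restrict (Ioi (0 : ℝ))),
      ∫⁻ p, ENNReal.ofReal |h n t p| ≤ ENNReal.ofReal (B n))
    {h_in : Momentum → ℝ} (h_int : Integrable h_in)
    (hlim : Tendsto (fun n => ∫ p, |(∑ i ∈ Finset.range (n + 1), f i p) - h_in p|) atTop (𝓝 0)) :
    IsSolution a h_in fun t p => ∑' n, h n t p := by
  simp only [isSolution_iff_integral ha] at hh ⊢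
  have hm := fun n => (hh n).1.1
  have hsum := ae_summable_of_summable_bound hm hB0 hBs hB
  refine ⟨⟨?_, ∑' n, B n, ?_⟩, fun Ψ hΨ hc => ?_⟩
  · refine aestronglyMeasurable_of_tendsto_ae (u := atTop)
      (f := fun (N : ℕ) (z : ℝ × Momentum) => ∑ n ∈ Finset.range N, h n z.1 z.2)
      (fun N => Finset.aestronglyMeasurable_fun_sum _ fun n _ => hm n) ?_
    filter_upwards [hsum] with z hz using hz.hasSum.tendsto_sum_nat
  · have hsl : ∀ᵐ t ∂(volume.restrict (Ioi (0 : ℝ))), ∀ n, AEStronglyMeasurable (h n t) volume := by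
      rw [ae_all_iff]
      intro n
      have := hm n
      rw [timeMomentumMeasure] at this
      exact this.prodMk_left
    filter_upwards [ae_all_iff.2 hB, hsl] with t ht hts
    have hmeas : ∀ n, AEMeasurable (fun p => ENNReal.ofReal |h n t p|) := fun n => by
      have := (hts n).enorm
      simpa only [Real.enorm_eq_ofReal_abs] using this
    calc ∫⁻ p, ENNReal.ofReal |∑' n, h n t p| ≤ ∫⁻ p, ∑' n, ENNReal.ofReal |h n t p| := by
          refine lintegral_mono fun p => ?_
          simp only [← Real.enorm_eq_ofReal_abs]
          exact enorm_tsum_le_tsum_enorm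
      _ = ∑' n, ∫⁻ p, ENNReal.ofReal |h n t p| := lintegral_tsum hmeas
      _ ≤ ∑' n, ENNReal.ofReal (B n) := ENNReal.tsum_le_tsum ht
      _ = _ := (ENNReal.ofReal_tsum_of_nonneg hB0 hBs).symm
  · obtain ⟨hΘm, b, hbi, hb⟩ := exists_weight_weakIntegrand ha hΨ hc
    have hint := fun n => integrable_weakIntegrand ha (hh n).1 hΨ hc
    have hs : HasSum (fun n => ∫ z : ℝ × Momentum, h n z.1 z.2 * weakIntegrand a Ψ z
        ∂timeMomentumMeasure) (∫ z : ℝ × Momentum, ∑' n, h n z.1 z.2 * weakIntegrand a Ψ z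
        ∂timeMomentumMeasure) := by
      refine hasSum_integral_of_summable_integral_norm hint ?_
      refine Summable.of_nonneg_of_le (fun n => integral_nonneg fun _ => norm_nonneg _)
        (fun n => abs_integral_pairing_le (hB0 n) (hm n) (hB n) hΘm hbi (Eventually.of_forall hb))
        (hBs.mul_right _)
    simp only [tsum_mul_right] at hs
    have ht := (hs.tendsto_sum_nat).comp (tendsto_add_atTop_nat 1)
    obtain ⟨M, hM⟩ := hΨ.continuous.bounded_above_of_compact_support hc
    have hdat : Tendsto (fun n => ∑ i ∈ Finset.range (n + 1), ∫ p, f i p * Ψ (spherical (0, p)))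
        atTop (𝓝 (∫ p, h_in p * Ψ (spherical (0, p)))) := by
      rw [tendsto_iff_norm_sub_tendsto_zero]
      refine squeeze_zero (fun _ => norm_nonneg _) (fun n => ?_) (by simpa using hlim.mul_const M)
      have hfi : ∀ i ∈ Finset.range (n + 1), Integrable fun p => f i p * Ψ (spherical (0, p)) :=
        fun i _ => integrable_datum (hf i) hΨ hc 0
      rw [← integral_finsetSum _ hfi,
        ← integral_sub (integrable_finsetSum _ hfi) (integrable_datum h_int hΨ hc 0),
        ← integral_mul_const]
      refine (norm_integral_le_integral_norm _).trans ?_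
      refine integral_mono_of_nonneg (Eventually.of_forall fun _ => norm_nonneg _) ?_
        (Eventually.of_forall fun p => ?_)
      · exact ((integrable_finsetSum _ fun i _ => hf i).sub h_int).abs.mul_const M
      · simp only
        rw [← Finset.sum_mul, ← sub_mul, norm_mul, Real.norm_eq_abs]
        exact mul_le_mul_of_nonneg_left (hM _) (abs_nonneg _)
    have heq : (fun n => ∑ i ∈ Finset.range (n + 1), ∫ p, f i p * Ψ (spherical (0, p)))
        = fun n => -∑ i ∈ Finset.range (n + 1), ∫ z : ℝ × Momentum,
          h i z.1 z.2 * weakIntegrand a Ψ z ∂timeMomentumMeasure := by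
      ext n
      rw [← Finset.sum_neg_distrib]
      refine Finset.sum_congr rfl fun i _ => ?_
      linarith [(hh i).2 Ψ hΨ hc]
    rw [heq] at hdat
    have := tendsto_nhds_unique hdat ht.neg
    linarith

/-! ### Approximation of the datum -/

theorem expPoly_add (P Q : MvPolynomial (Option (Fin 3)) ℝ) (p : Momentum) :
    expPoly (P + Q) p = expPoly P p + expPoly Q p := by
  simp only [expPoly, map_add, mul_add]

/-- Exponential polynomials as elements of `L¹`. -/
noncomputable def expPolyL1 : MvPolynomial (Option (Fin 3)) ℝ →+ (Momentum →₁[volume] ℝ) :=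
  AddMonoidHom.mk' (fun P => (integrable_expPoly P).toL1 (expPoly P)) fun P Q => by
    rw [← Integrable.toL1_add]
    congr 1
    exact funext (expPoly_add P Q)

theorem norm_expPolyL1 (P : MvPolynomial (Option (Fin 3)) ℝ) :
    ‖expPolyL1 P‖ = ∫ p, |expPoly P p| := by
  change ‖(integrable_expPoly P).toL1 (expPoly P)‖ = _
  rw [L1.norm_of_fun_eq_integral_norm]
  rfl

theorem norm_expPolyL1_sub {f : Momentum → ℝ} (hf : Integrable f volume)
    (P : MvPolynomial (Option (Fin 3)) ℝ) :
    ‖expPolyL1 P - hf.toL1 f‖ = ∫ p, |expPoly P p - f p| := by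
  change ‖(integrable_expPoly P).toL1 (expPoly P) - hf.toL1 f‖ = _
  rw [← Integrable.toL1_sub, L1.norm_of_fun_eq_integral_norm]
  rfl

theorem integrable_exp_neg_norm : Integrable fun p : Momentum => Real.exp (-‖p‖) := by
  refine (integrable_expPoly 1).congr (Eventually.of_forall fun p => ?_)
  simp [expPoly]

theorem mem_closure_range_expPolyL1 {f : Momentum → ℝ} (hf : Integrable f volume) :
    hf.toL1 f ∈ closure (expPolyL1.range : Set (Momentum →₁[volume] ℝ)) := by
  rw [Metric.mem_closure_iff]
  intro ε hε
  obtain ⟨g, hgc, hg, hgcont, hgi⟩ := hf.exists_hasCompactSupport_integral_sub_le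
    (show 0 < ε / 2 by positivity)
  set I := ∫ p : Momentum, Real.exp (-‖p‖) with hI
  have hI0 : 0 ≤ I := integral_nonneg fun p => (Real.exp_pos _).le
  -- This tolerance integrates to at most `ε/4`; added to the `ε/2` of the previous approximation it
  -- stays strictly below `ε`.
  obtain ⟨P, hP⟩ := exists_expPoly_near hgcont hgc (show 0 < ε / (4 * (I + 1)) by positivity)
  refine ⟨expPolyL1 P, ⟨P, rfl⟩, ?_⟩
  rw [dist_comm, dist_eq_norm, norm_expPolyL1_sub hf]
  have h1 : ∫ p, |g p - expPoly P p| ≤ ε / 4 := by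
    calc ∫ p, |g p - expPoly P p| ≤ ∫ p : Momentum, ε / (4 * (I + 1)) * Real.exp (-‖p‖) :=
          integral_mono (hgi.sub (integrable_expPoly P)).abs
            (integrable_exp_neg_norm.const_mul _) hP
      _ = ε / (4 * (I + 1)) * I := integral_const_mul _ _
      _ ≤ ε / 4 := by
          rw [div_mul_eq_mul_div, div_le_div_iff₀ (by positivity) (by norm_num)]
          nlinarith
  have h2 : ∫ p, |expPoly P p - f p| ≤ ∫ p, (‖f p - g p‖ + |g p - expPoly P p|) := by
    refine integral_mono ((integrable_expPoly P).sub hf).abs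
      ((hf.sub hgi).norm.add (hgi.sub (integrable_expPoly P)).abs) fun p => ?_
    change |expPoly P p - f p| ≤ |f p - g p| + |g p - expPoly P p|
    rw [abs_sub_comm]
    exact abs_sub_le _ _ _
  have h3 : ∫ p, (‖f p - g p‖ + |g p - expPoly P p|)
      = (∫ p, ‖f p - g p‖) + ∫ p, |g p - expPoly P p| :=
    integral_add (hf.sub hgi).norm (hgi.sub (integrable_expPoly P)).abs
  linarith

theorem exists_expPoly_series {f : Momentum → ℝ} (hf : Integrable f) :
    ∃ P : ℕ → MvPolynomial (Option (Fin 3)) ℝ, Summable (fun n => ∫ p, |expPoly (P n) p|) ∧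
      Tendsto (fun n => ∫ p, |(∑ i ∈ Finset.range (n + 1), expPoly (P i) p) - f p|)
        atTop (𝓝 0) := by
  -- A point in the closure of a subgroup is the sum of a series in it whose terms, except the
  -- first, are bounded by a prescribed sequence; hence the shift by one in the summability proof.
  obtain ⟨v, hlim, hv, -, hP⟩ := controlled_sum_of_mem_closure (mem_closure_range_expPolyL1 hf)
    (b := fun n => (1 / 2 : ℝ) ^ n) (fun n => by positivity)
  choose P hPv using hv
  simp only [← hPv] at hlim hP
  refine ⟨P, ?_, ?_⟩
  · simp only [← norm_expPolyL1]
    rw [← summable_nat_add_iff 1]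
    exact Summable.of_nonneg_of_le (fun n => norm_nonneg _)
      (fun n => (hP (n + 1) n.succ_pos).le)
      ((summable_nat_add_iff 1).2 (summable_geometric_of_lt_one (by norm_num) (by norm_num)))
  · rw [tendsto_iff_norm_sub_tendsto_zero] at hlim
    refine hlim.congr fun n => ?_
    rw [← map_sum, norm_expPolyL1_sub hf]
    have : ∀ p, expPoly (∑ i ∈ Finset.range (n + 1), P i) p
        = ∑ i ∈ Finset.range (n + 1), expPoly (P i) p := fun p => by
      simp only [expPoly, map_sum, Finset.mul_sum]
    simp only [this]

/-- The flow of an integrable datum, which solves the equation for every speed of time. -/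
theorem exists_flow {f : Momentum → ℝ} (hf : Integrable f) :
    ∃ G : ℝ → Momentum → ℝ, ∀ a : ℝ → ℝ, (∀ T : ℝ, 0 < T → IntegrableOn a (Ioc 0 T)) →
      (∀ t, 0 ≤ a t) → IsSolution a f fun t p => G (∫ s in (0 : ℝ)..t, a s) p := by
  obtain ⟨P, hs, hlim⟩ := exists_expPoly_series hf
  refine ⟨fun s p => ∑' n, expFlow (P n) s p, fun a ha ha0 => ?_⟩
  refine isSolution_tsum ha (fun n => integrable_expPoly (P n))
    (fun n => isSolution_expFlow ha ha0 (P n)) (fun n => integral_nonneg fun _ => abs_nonneg _) hs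
    (fun n => ?_) hf hlim
  filter_upwards [ae_restrict_mem measurableSet_Ioi] with t ht
  exact lintegral_expFlow_le (P n) (primitive_nonneg ha0 (le_of_lt ht))

/-! ### Change of time -/

theorem primitive_lt_primitive {a : ℝ → ℝ} (ha : ∀ T : ℝ, 0 < T → IntegrableOn a (Ioc 0 T))
    (ha0 : ∀ t, 0 < a t) {s t : ℝ} (hs : 0 ≤ s) (hst : s < t) :
    ∫ r in (0 : ℝ)..s, a r < ∫ r in (0 : ℝ)..t, a r := by
  have h1 := intervalIntegrable_of_integrableOn ha hs
  have h2 := intervalIntegrable_of_integrableOn ha (hs.trans hst.le)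
  have h3 : IntervalIntegrable a volume s t := h1.symm.trans h2
  have := intervalIntegral.intervalIntegral_pos_of_pos h3 ha0 hst
  rw [← intervalIntegral.integral_add_adjacent_intervals h1 h3]
  linarith

/-- The change of time pulls null sets back to null sets. -/
theorem quasiMeasurePreserving_primitive {a : ℝ → ℝ}
    (ha : ∀ T : ℝ, 0 < T → IntegrableOn a (Ioc 0 T)) (ha0 : ∀ t, 0 < a t) :
    Measure.QuasiMeasurePreserving (fun t => ∫ s in (0 : ℝ)..(max t 0), a s)
      (volume.restrict (Ioi 0)) (volume.restrict (Ioi 0)) := by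
  -- Freezing the clock for `t ≤ 0` makes it continuous on the whole line, hence measurable.
  set τ : ℝ → ℝ := fun t => ∫ s in (0 : ℝ)..(max t 0), a s with hτ
  have hτe : ∀ t, 0 < t → τ t = ∫ s in (0 : ℝ)..t, a s := fun t ht => by
    simp only [hτ, max_eq_left ht.le]
  have hτc : Continuous τ :=
    (continuousOn_primitive_Ici ha).comp_continuous (by fun_prop) fun t => le_max_right t 0
  refine ⟨hτc.measurable, Measure.AbsolutelyContinuous.mk fun B hB hB0 => ?_⟩
  rw [Measure.map_apply hτc.measurable hB, Measure.restrict_apply (hτc.measurable hB)]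
  rw [Measure.restrict_apply hB] at hB0
  have hae : ∀ᵐ t, 0 < t → HasDerivAt (fun t => ∫ s in (0 : ℝ)..t, a s) (a t) t := by
    have h1 : ∀ᵐ t, ∀ n : ℕ, t ∈ uIcc 0 ((n : ℝ) + 1) → ∀ c ∈ uIcc 0 ((n : ℝ) + 1),
        HasDerivAt (fun x => ∫ s in c..x, a s) (a t) t :=
      ae_all_iff.2 fun n =>
        (intervalIntegrable_of_integrableOn ha (T := (n : ℝ) + 1)
          (by positivity)).ae_hasDerivAt_integral
    filter_upwards [h1] with t ht ht0
    obtain ⟨n, hn⟩ := exists_nat_ge t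
    refine ht n ?_ 0 left_mem_uIcc
    rw [uIcc_of_le (by positivity)]
    exact ⟨ht0.le, by linarith⟩
  -- The null set where the clock is not differentiable with derivative `a`; its measurable hull is
  -- removed so that the change of variables applies to a measurable set.
  set A : Set ℝ := {t | ¬(0 < t → HasDerivAt (fun t => ∫ s in (0 : ℝ)..t, a s) (a t) t)} with hA
  have hA0 : volume (toMeasurable volume A) = 0 := by rw [measure_toMeasurable]; exact hae
  set S : Set ℝ := (τ ⁻¹' B ∩ Ioi 0) \ toMeasurable volume A with hS
  have hSm : MeasurableSet S := MeasurableSet.diff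
    ((hτc.measurable hB).inter measurableSet_Ioi) (measurableSet_toMeasurable _ _)
  have hSpos : ∀ t ∈ S, 0 < t := fun t ht => ht.1.2
  have hderiv : ∀ t ∈ S, HasDerivWithinAt τ (a t) S t := by
    intro t ht
    have h1 : ¬ t ∈ A := fun h => ht.2 (subset_toMeasurable _ _ h)
    simp only [hA, mem_ofPred_eq, not_not] at h1
    exact (h1 (hSpos t ht)).hasDerivWithinAt.congr (fun x hx => hτe x (hSpos x hx))
      (hτe t (hSpos t ht))
  have hinj : InjOn τ S := by
    have : StrictMonoOn τ S := by
      intro s hs t ht hst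
      rw [hτe s (hSpos s hs), hτe t (hSpos t ht)]
      exact primitive_lt_primitive ha ha0 (hSpos s hs).le hst
    exact this.injOn
  -- Change of variables gives `∫_S a = |τ(S)|`, which is zero because `τ(S)` lies in a null set.
  -- Strict positivity of `a` then forces `|S| = 0`.
  have himg := lintegral_image_eq_lintegral_abs_deriv_mul hSm hderiv hinj fun _ => 1
  have himg0 : volume (τ '' S) = 0 := by
    refine measure_mono_null ?_ hB0
    rintro _ ⟨t, ht, rfl⟩
    refine ⟨ht.1.1, ?_⟩
    rw [mem_Ioi, hτe t (hSpos t ht)]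
    have := primitive_lt_primitive ha ha0 le_rfl (hSpos t ht)
    simpa using this
  rw [setLIntegral_one, himg0] at himg
  simp only [mul_one] at himg
  have hS0 : volume S = 0 := by
    have ham : AEMeasurable (fun t => ENNReal.ofReal |a t|) (volume.restrict S) := by
      have := (aestronglyMeasurable_Ioi_of_integrableOn ha).mono_measure
        (Measure.restrict_mono (fun t ht => hSpos t ht : S ⊆ Ioi 0) le_rfl)
      simpa only [Real.enorm_eq_ofReal_abs] using this.enorm
    have hfalse : ∀ᵐ t ∂volume.restrict S, False := by
      filter_upwards [(lintegral_eq_zero_iff' ham).1 himg.symm] with t ht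
      simp only [Pi.zero_apply, ENNReal.ofReal_eq_zero, abs_nonpos_iff] at ht
      exact (ha0 t).ne' ht
    rw [eventually_false_iff_eq_bot, ae_eq_bot, Measure.restrict_eq_zero] at hfalse
    exact hfalse
  have hsub : τ ⁻¹' B ∩ Ioi 0 ⊆ S ∪ toMeasurable volume A := by
    intro t ht
    by_cases h : t ∈ toMeasurable volume A
    · exact Or.inr h
    · exact Or.inl ⟨ht, h⟩
  exact measure_mono_null hsub (measure_union_null hS0 hA0)

theorem ae_comp_primitive {a : ℝ → ℝ} (ha : ∀ T : ℝ, 0 < T → IntegrableOn a (Ioc 0 T))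
    (ha0 : ∀ t, 0 < a t) {g₁ g₂ : ℝ → Momentum → ℝ}
    (hg : ∀ᵐ z ∂timeMomentumMeasure, g₁ z.1 z.2 = g₂ z.1 z.2) :
    ∀ᵐ z ∂timeMomentumMeasure,
      g₁ (∫ s in (0 : ℝ)..z.1, a s) z.2 = g₂ (∫ s in (0 : ℝ)..z.1, a s) z.2 := by
  have hq : Measure.QuasiMeasurePreserving
      (Prod.map (fun t => ∫ s in (0 : ℝ)..(max t 0), a s) (id : Momentum → Momentum))
      timeMomentumMeasure timeMomentumMeasure := by
    unfold timeMomentumMeasure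
    exact MeasureTheory.QuasiMeasurePreserving.prodMap (quasiMeasurePreserving_primitive ha ha0)
      (Measure.QuasiMeasurePreserving.id _)
  have hpos : ∀ᵐ z ∂timeMomentumMeasure, 0 < z.1 :=
    ae_timeMomentumMeasure_of_forall_ae (Q := fun t => 0 < t) (ae_restrict_mem measurableSet_Ioi)
      fun t p ht => ht
  filter_upwards [hq.ae hg, hpos] with z hz hz0
  simpa only [Prod.map_fst, Prod.map_snd, id, max_eq_left hz0.le] using hz

theorem corollary1 (φ : ℝ → ℝ)
    (hφ : ∀ T : ℝ, 0 < T → IntegrableOn (fun t => Real.exp (2 * φ t)) (Ioc 0 T))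
    (h_in : Momentum → ℝ) (h_in_int : Integrable h_in) (h_in_nonneg : ∀ᵐ p, 0 ≤ h_in p) :
    -- the autonomous equation has a solution, and only one up to null sets
    (∃ g : ℝ → Momentum → ℝ, IsSolution (fun _ => 1) h_in g) ∧
    (∀ g₁ g₂ : ℝ → Momentum → ℝ,
      IsSolution (fun _ => 1) h_in g₁ → IsSolution (fun _ => 1) h_in g₂ →
      ∀ᵐ z ∂timeMomentumMeasure, g₁ z.1 z.2 = g₂ z.1 z.2) ∧
    -- `g (τ(t), p)` solves the equation with the field, and every solution is equal to it
    ∀ g : ℝ → Momentum → ℝ, IsSolution (fun _ => 1) h_in g →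
      IsSolution (fun t => Real.exp (2 * φ t)) h_in (fun t p => g (rescaledTime φ t) p) ∧
      ∀ h : ℝ → Momentum → ℝ, IsSolution (fun t => Real.exp (2 * φ t)) h_in h →
        ∀ᵐ z ∂timeMomentumMeasure, h z.1 z.2 = g (rescaledTime φ z.1) z.2 := by
  have ha1 : ∀ T : ℝ, 0 < T → IntegrableOn (fun _ : ℝ => (1 : ℝ)) (Ioc 0 T) :=
    fun T _ => integrableOn_const (by simp)
  have ha : ∀ t, 0 < Real.exp (2 * φ t) := fun t => Real.exp_pos _
  -- One flow serves both equations; for `a = 1` the clock is `t` itself.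
  obtain ⟨G, hG⟩ := exists_flow h_in_int
  have hG1 : IsSolution (fun _ => 1) h_in G := by
    simpa using hG (fun _ => 1) ha1 fun _ => zero_le_one
  refine ⟨⟨G, hG1⟩, fun g₁ g₂ h₁ h₂ => h₁.ae_eq ha1 (fun _ => zero_le_one) h₂, fun g hg => ?_⟩
  -- `G(τ(t), p)` is known to be a solution. The given `g` agrees with `G` only off a null set,
  -- which the time change pulls back to a null set.
  have hsol : IsSolution (fun t => Real.exp (2 * φ t)) h_in
      fun t p => g (rescaledTime φ t) p :=
    (hG _ hφ fun t => (ha t).le).congr hφ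
      (ae_comp_primitive hφ ha (hG1.ae_eq ha1 (fun _ => zero_le_one) hg))
  exact ⟨hsol, fun h hh => hh.ae_eq hφ (fun t => (ha t).le) hsol⟩
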